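/- Let $k$ be a field. A connected algebra is an associative $k$-algebra $R=\bigoplus_{n\ge 0}R_n$ graded by the non-negative integers with $R_0=k$; all modules and ideals are right and graded. For a graded submodule $L$ of an $\mathbb N$-graded $R$-module let $m_0(L)\in\mathbb N\cup\{\infty\}$ be the supremum of the degrees of the elements of a minimal set of homogeneous generators of $L$, and $m_1(L)$ the supremum of the degrees of minimal homogeneous relations of $L$, i.e. $m_1(L)=m_0(\Omega)$ where $\Omega$ is the module of relations between the elements of a minimal set of homogeneous generators of $L$, a relation $(x_s)$ between generators $s$ being homogeneous of degree $n$ if $\deg s+\deg x_s=n$ whenever $x_s\neq 0$ (suprema of the empty set are $0$). For a graded $R$-module $M$ put $D_M(d)=\sup\{m_1(L): L\subseteq M,\ m_0(L)\le d\}$, and let $D_R$ be the function of $R$ as a right module over itself. The algebra $R$ is coherent if each of its finitely generated ideals is finitely presented, and effectively coherent if $D_R(d)<\infty$ for all $d>0$. Let $m(R_+)$ denote the supremum of the degrees of minimal homogeneous generators of the algebra $R$, that is, $m_0$ of the right ideal $R_+=\bigoplus_{n>0}R_n$. Proposition 3.6 (direct sum and free product). Let $A$ and $B$ be connected algebras over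 $k$. Let $C=A\oplus B$ be their direct sum with common unit, i.e. the subalgebra of $A\times B$ of the pairs $(a,b)$ whose degree zero components are the same scalar, with $C_n=\{(a,b)\in C: a\in A_n, b\in B_n\}$, and let $E=A*B$ be their free product over $k$, with the grading that extends those of $A$ and $B$. Then $C$ and $E$ are connected algebras, and: 1. If $A$ and $B$ are coherent, then $E$ is coherent; if moreover $A$ and $B$ are finitely generated as algebras, then $C$ is coherent. 2. If $A$ and $B$ are finitely generated as algebras and effectively coherent, then $C$ and $E$ are effectively coherent. 3. For all $d\ge 0$, $$D_C(d)\le\max\{D_A(d),\ D_B(d),\ d+m(A_+),\ d+m(B_+)\},$$ $$D_E(d)\le\max\{D_{E_{\le d}A}(d),\ D_{E_{\le d}B}(d)\},$$ where $E_{\le d}A$ and $E_{\le d}B$ are the right $A$-submodule and the right $B$-submodule of $E$ generated by the elements of degree at most $d$. Moreover, every connected algebra over $k$ that is freely generated, as an associative algebra, by finitely many homogeneous elements is effectively coherent. -/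

import Mathlib

/-!
Graded right modules over graded algebras, degrees of generators and relations, (effective)
coherence, the direct sum with common unit and the free product of connected graded algebras.

Throughout `k` is a field, an algebra `A` is graded by a family `𝒜 : ℕ → Submodule k A`, and right
`A`-modules are `Aᵐᵒᵖ`-modules; a graded right module is an `Aᵐᵒᵖ`-module `V` together with the
family `𝒱 : ℕ → Submodule k V` of its homogeneous components.
-/

open MulOpposite

noncomputable section

namespace GradedCoherence

universe u v w

/-- A graded algebra is connected if every element of degree `0` is a scalar, in a unique way
(so the algebra is nonzero and its degree zero part is the ground field). -/
def Connected {k : Type u} [Field k] {A : Type v} [Ring A] [Algebra k A]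
    (𝒜 : ℕ → Submodule k A) : Prop :=
  ∀ a ∈ 𝒜 0, ∃! c : k, algebraMap k A c = a

section Modules

variable {k : Type u} [Field k] {A : Type v} [Ring A] [Algebra k A] (𝒜 : ℕ → Submodule k A)
  {V : Type w} [AddCommGroup V] [Module k V] [Module Aᵐᵒᵖ V] (𝒱 : ℕ → Submodule k V)

/-- The right submodule `L` is generated by its homogeneous elements of degree at most `d`.
(In particular `L` is then a graded submodule.) -/
def GeneratedInDegreeLE (L : Submodule Aᵐᵒᵖ V) (d : ℕ) : Prop :=
  Submodule.span Aᵐᵒᵖ {x : V | x ∈ L ∧ ∃ n ≤ d, x ∈ 𝒱 n} = L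

/-- `m₀ L`: the supremum of the degrees of minimal homogeneous generators of the graded
submodule `L`, that is, the least `d` such that `L` is generated in degrees at most `d`
(`⊤` if there is none). -/
def m₀ (L : Submodule Aᵐᵒᵖ V) : ℕ∞ :=
  ⨅ (d : ℕ) (_ : GeneratedInDegreeLE 𝒱 L d), (d : ℕ∞)

/-- `S` is a minimal set of homogeneous generators of the right submodule `L`, the generator `s`
having degree `e s`. -/
structure IsMinimalGenerating (L : Submodule Aᵐᵒᵖ V) (S : Set V) (e : S → ℕ) : Prop where
  homogeneous : ∀ s : S, (s : V) ∈ 𝒱 (e s)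
  span_eq : Submodule.span Aᵐᵒᵖ S = L
  minimal : ∀ s ∈ S, s ∉ Submodule.span Aᵐᵒᵖ (S \ {s})

/-- The solution module of the linear equation `∑ s, s * x s = 0` whose coefficients are the
elements of `S`; a submodule of the free right module on `S`. -/
def syzygies (A : Type v) [Ring A] {V : Type w} [AddCommGroup V] [Module Aᵐᵒᵖ V] (S : Set V) :
    Submodule Aᵐᵒᵖ (S →₀ A) where
  carrier := {x | (x.sum fun s a => op a • (s : V)) = 0}
  zero_mem' := by simp
  add_mem' := by
    classical
    intro x y hx hy
    have h := Finsupp.sum_add_index' (f := x) (g := y) (h := fun (s : S) a => op a • (s : V))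
      (by simp) (by intro s a b; simp [add_smul])
    simp only [Set.mem_ofPred_eq] at hx hy ⊢
    rw [h, hx, hy, add_zero]
  smul_mem' := by
    intro c x hx
    simp only [Set.mem_ofPred_eq] at hx ⊢
    have h : ((c • x).sum fun s a => op a • (s : V))
        = c • (x.sum fun s a => op a • (s : V)) := by
      rw [Finsupp.sum_smul_index' (by simp), Finsupp.smul_sum]
      refine Finsupp.sum_congr fun s _ => ?_
      rw [smul_smul]
      rfl
    rw [h, hx, smul_zero]

/-- The grading of the free right module on `S` whose basis vector `s` has degree `e s`: a vector
`x` is homogeneous of degree `n` if `e s + deg (x s) = n` for all nonzero `x s`. -/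
def freeGrading {S : Type*} (e : S → ℕ) (n : ℕ) : Submodule k (S →₀ A) :=
  ⨅ s : S, (if e s ≤ n then 𝒜 (n - e s) else ⊥).comap (Finsupp.lapply s)

/-- `m₁ L`: the supremum of the degrees of minimal homogeneous relations of the graded submodule
`L`, that is, of minimal homogeneous generators of the module of relations between the elements of
a minimal homogeneous generating set of `L`. (It does not depend on this set.) -/
def m₁ (L : Submodule Aᵐᵒᵖ V) : ℕ∞ :=
  ⨆ (S : Set V) (e : S → ℕ) (_ : IsMinimalGenerating 𝒱 L S e),
    m₀ (freeGrading 𝒜 e) (syzygies A S)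

/-- The function `D_M` of a graded right module `M` (given as a graded submodule of `V`):
`D_M(d)` is the supremum of `m₁ L` over all graded submodules `L` of `M` with `m₀ L ≤ d`. -/
def degreeBound (M : Submodule Aᵐᵒᵖ V) (d : ℕ) : ℕ∞ :=
  ⨆ (L : Submodule Aᵐᵒᵖ V) (_ : L ≤ M) (_ : m₀ 𝒱 L ≤ d), m₁ 𝒜 𝒱 L

end Modules

section Algebras

variable {k : Type u} [Field k] {A : Type v} [Ring A] [Algebra k A] (𝒜 : ℕ → Submodule k A)

/-- The function `D_A` of a graded algebra: that of `A` as a right module over itself. -/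
def algebraDegreeBound (d : ℕ) : ℕ∞ :=
  degreeBound 𝒜 𝒜 (⊤ : Submodule Aᵐᵒᵖ A) d

/-- A graded algebra is (graded right) coherent if every finitely generated graded right ideal is
finitely presented. -/
def Coherent : Prop :=
  ∀ S : Finset A, (∀ s ∈ S, SetLike.IsHomogeneousElem 𝒜 s) →
    Module.FinitePresentation Aᵐᵒᵖ (Submodule.span Aᵐᵒᵖ (S : Set A))

/-- A graded algebra is effectively coherent if `D_A(d)` is finite for every `d > 0`. -/
def EffectivelyCoherent : Prop :=
  ∀ d : ℕ, 0 < d → algebraDegreeBound 𝒜 d ≠ ⊤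

/-- The right ideal generated by the homogeneous elements of positive degree. -/
def positiveIdeal : Submodule Aᵐᵒᵖ A :=
  Submodule.span Aᵐᵒᵖ {a : A | ∃ n : ℕ, 0 < n ∧ a ∈ 𝒜 n}

/-- The supremum of the degrees of the elements of a minimal set of homogeneous generators of the
connected algebra `A`, that is, of its ideal of elements of positive degree. -/
def generatorDegree : ℕ∞ :=
  m₀ 𝒜 (positiveIdeal 𝒜)

end Algebras

section Constructions

open DirectSum LinearAlgebra

variable {k : Type u} [Field k] {I : Type w} {A : I → Type v} [∀ i, Ring (A i)]
  [∀ i, Algebra k (A i)] (𝒜 : ∀ i, ℕ → Submodule k (A i)) [∀ i, GradedAlgebra (𝒜 i)]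

/-- The direct sum with common unit of connected algebras: the subalgebra of the product formed by
the families whose degree zero components are all equal to the same scalar. -/
def UnitalSum : Subalgebra k (∀ i, A i) where
  carrier := {x | ∃ c : k, ∀ i, GradedRing.projZeroRingHom (𝒜 i) (x i) = algebraMap k (A i) c}
  mul_mem' := by
    rintro x y ⟨c, hc⟩ ⟨d, hd⟩
    exact ⟨c * d, fun i => by rw [Pi.mul_apply, map_mul, map_mul, hc, hd]⟩
  add_mem' := by
    rintro x y ⟨c, hc⟩ ⟨d, hd⟩
    exact ⟨c + d, fun i => by rw [Pi.add_apply, map_add, map_add, hc, hd]⟩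
  algebraMap_mem' := by
    intro c
    refine ⟨c, fun i => ?_⟩
    exact DirectSum.decompose_of_mem_same (𝒜 i) (SetLike.algebraMap_mem_graded (𝒜 i) c)

/-- The grading of the direct sum with common unit: `x` is homogeneous of degree `n` if all its
components are. -/
def unitalSumGrading (n : ℕ) : Submodule k (UnitalSum 𝒜) :=
  ⨅ i : I, (𝒜 i n).comap ((LinearMap.proj i).comp (UnitalSum 𝒜).val.toLinearMap)

theorem mem_unitalSumGrading {n : ℕ} {x : UnitalSum 𝒜} :
    x ∈ unitalSumGrading 𝒜 n ↔ ∀ i, (x : ∀ i, A i) i ∈ 𝒜 i n := by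
  simp [unitalSumGrading]

instance unitalSumGradedMonoid : SetLike.GradedMonoid (unitalSumGrading 𝒜) where
  one_mem := by
    rw [mem_unitalSumGrading]
    exact fun i => SetLike.GradedOne.one_mem
  mul_mem := by
    intro m n x y hx hy
    rw [mem_unitalSumGrading] at *
    exact fun i => SetLike.GradedMul.mul_mem (hx i) (hy i)

/-- The homogeneous components of an element of the direct sum with common unit. -/
def unitalSumComponent (x : UnitalSum 𝒜) (n : ℕ) : unitalSumGrading 𝒜 n :=
  ⟨⟨fun i => (decompose (𝒜 i) ((x : ∀ i, A i) i) n : A i), by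
    rcases Nat.eq_zero_or_pos n with rfl | hn
    · obtain ⟨c, hc⟩ := x.2
      refine ⟨c, fun i => ?_⟩
      rw [← hc i]
      exact DirectSum.decompose_of_mem_same (𝒜 i) (SetLike.coe_mem _)
    · refine ⟨0, fun i => ?_⟩
      rw [map_zero]
      exact DirectSum.decompose_of_mem_ne (𝒜 i) (SetLike.coe_mem _) hn.ne'⟩,
    (mem_unitalSumGrading 𝒜).2 fun i => SetLike.coe_mem _⟩

instance unitalSumGradedAlgebra [Finite I] : GradedAlgebra (unitalSumGrading 𝒜) := by
  classical
  letI : Fintype I := Fintype.ofFinite I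
  let supp : UnitalSum 𝒜 → Finset ℕ := fun x =>
    Finset.univ.biUnion fun i => (decompose (𝒜 i) ((x : ∀ i, A i) i)).support
  have hsupp : ∀ x n, n ∉ supp x → unitalSumComponent 𝒜 x n = 0 := by
    intro x n hn
    simp only [supp, Finset.mem_biUnion, Finset.mem_univ, true_and, not_exists,
      DFinsupp.mem_support_toFun, not_not] at hn
    apply Subtype.ext
    apply Subtype.ext
    funext i
    simp [unitalSumComponent, hn i]
  let dec : UnitalSum 𝒜 → ⨁ n, unitalSumGrading 𝒜 n := fun x =>
    DirectSum.mk _ (supp x) fun n => unitalSumComponent 𝒜 x n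
  have hdec : ∀ x n, dec x n = unitalSumComponent 𝒜 x n := by
    intro x n
    by_cases hn : n ∈ supp x
    · exact DirectSum.mk_apply_of_mem hn
    · rw [hsupp x n hn]
      exact DirectSum.mk_apply_of_notMem hn
  have hcoe : ∀ (y : ⨁ n, unitalSumGrading 𝒜 n) i,
      ((DirectSum.coeAddMonoidHom (unitalSumGrading 𝒜) y : UnitalSum 𝒜) : ∀ i, A i) i
        = DirectSum.coeAddMonoidHom (𝒜 i)
            (DirectSum.map (fun n => (⟨⟨fun z => ⟨(z : ∀ i, A i) i,
              (mem_unitalSumGrading 𝒜).1 z.2 i⟩, rfl⟩, fun _ _ => rfl⟩ :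
                unitalSumGrading 𝒜 n →+ 𝒜 i n)) y) := by
    intro y i
    induction y using DirectSum.induction_on with
    | zero => simp
    | of n z => simp [DirectSum.map_of]
    | add y z hy hz => simp only [map_add, Subalgebra.coe_add, Pi.add_apply, hy, hz]
  refine
    { unitalSumGradedMonoid 𝒜 with
      decompose' := dec
      left_inv := ?_
      right_inv := ?_ }
  · intro x
    apply Subtype.ext
    funext i
    rw [hcoe]
    rw [← (decompose (𝒜 i)).symm_apply_apply ((x : ∀ i, A i) i)]
    change _ = DirectSum.coeAddMonoidHom (𝒜 i) _
    congr 1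
    ext n
    rw [DirectSum.map_apply, hdec]
    rfl
  · intro y
    ext n i
    rw [hdec]
    simp only [unitalSumComponent]
    rw [hcoe]
    change ((decompose (𝒜 i) ((decompose (𝒜 i)).symm _) n : 𝒜 i n) : A i) = _
    rw [Equiv.apply_symm_apply, DirectSum.map_apply]
    rfl

variable [DecidableEq I]

/-- `IsProductOfDegree 𝒜 n x`: the element `x` of the free product is a product of homogeneous
elements of the factors whose degrees add up to `n`. -/
inductive IsProductOfDegree : ℕ → FreeProduct k A → Prop
  | one : IsProductOfDegree 0 1
  | mul {i : I} {m n : ℕ} {a : A i} {x : FreeProduct k A} (ha : a ∈ 𝒜 i m)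
      (hx : IsProductOfDegree n x) : IsProductOfDegree (m + n) (FreeProduct.ι k A i a * x)

/-- The grading of the free product that extends the gradings of the factors. -/
def freeProductGrading (n : ℕ) : Submodule k (FreeProduct k A) :=
  Submodule.span k {x | IsProductOfDegree 𝒜 n x}

instance freeProductGradedMonoid : SetLike.GradedMonoid (freeProductGrading 𝒜) where
  one_mem := Submodule.subset_span IsProductOfDegree.one
  mul_mem := by
    intro m n x y hx hy
    have hprod : ∀ m x, IsProductOfDegree 𝒜 m x → ∀ n y, IsProductOfDegree 𝒜 n y →
        IsProductOfDegree 𝒜 (m + n) (x * y) := by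
      intro m x hx
      induction hx with
      | one => intro n y hy; simpa using hy
      | mul ha _ ih =>
        intro n y hy
        rw [add_assoc, mul_assoc]
        exact IsProductOfDegree.mul ha (ih n y hy)
    refine (show freeProductGrading 𝒜 m * freeProductGrading 𝒜 n ≤
      freeProductGrading 𝒜 (m + n) from ?_) (Submodule.mul_mem_mul hx hy)
    rw [freeProductGrading, freeProductGrading, Submodule.span_mul_span]
    apply Submodule.span_mono
    rintro _ ⟨x, hx, y, hy, rfl⟩
    exact hprod m x hx n y hy

set_option linter.unusedSectionVars false in
theorem ι_mem_freeProductGrading {i : I} {n : ℕ} {a : A i} (ha : a ∈ 𝒜 i n) :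
    FreeProduct.ι k A i a ∈ freeProductGrading 𝒜 n := by
  have h := IsProductOfDegree.mul ha (IsProductOfDegree.one (𝒜 := 𝒜))
  rw [mul_one, add_zero] at h
  exact Submodule.subset_span h

/-- The inclusion of a factor into the direct sum of the graded components of the free product. -/
def toFreeProductComponents (i : I) : A i →ₐ[k] ⨁ n, freeProductGrading 𝒜 n :=
  (DirectSum.toAlgebra k (fun n => 𝒜 i n)
    (fun n => (DirectSum.lof k ℕ (fun n => freeProductGrading 𝒜 n) n).comp
      (((FreeProduct.ι k A i).toLinearMap.comp (𝒜 i n).subtype).codRestrict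
        (freeProductGrading 𝒜 n) fun a => ι_mem_freeProductGrading 𝒜 a.2))
    (by
      simp only [LinearMap.comp_apply, DirectSum.lof_eq_of]
      refine DirectSum.of_eq_of_gradedMonoid_eq (Sigma.subtype_ext rfl ?_)
      exact map_one (FreeProduct.ι k A i))
    (by
      intro m n a b
      simp only [LinearMap.comp_apply, DirectSum.lof_eq_of]
      rw [DirectSum.of_mul_of]
      refine DirectSum.of_eq_of_gradedMonoid_eq (Sigma.subtype_ext rfl ?_)
      exact map_mul (FreeProduct.ι k A i) _ _)).comp
    (DirectSum.decomposeAlgEquiv (𝒜 i)).toAlgHom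

theorem toFreeProductComponents_of_mem {i : I} {n : ℕ} {a : A i} (ha : a ∈ 𝒜 i n) :
    toFreeProductComponents 𝒜 i a =
      DirectSum.of (fun n => freeProductGrading 𝒜 n) n
        ⟨FreeProduct.ι k A i a, ι_mem_freeProductGrading 𝒜 ha⟩ := by
  lift a to 𝒜 i n using ha
  rw [toFreeProductComponents, AlgHom.comp_apply]
  have h : (DirectSum.decomposeAlgEquiv (𝒜 i)).toAlgHom (a : A i)
      = DirectSum.of (fun n => 𝒜 i n) n a := DirectSum.decompose_coe (𝒜 i) a
  rw [h]
  exact DirectSum.toAddMonoid_of (β := fun n => 𝒜 i n) _ n a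

theorem lift_ι_apply {B : Type*} [Semiring B] [Algebra k B] (f : ∀ i, A i →ₐ[k] B) (i : I)
    (a : A i) :
    FreeProduct.lift k A (fun {i} => f i) (FreeProduct.ι k A i a) = f i a :=
  DFunLike.congr_fun (FreeProduct.lift_comp_ι k A (fun {i} => f i)) a

theorem freeProduct_hom_ext {B : Type*} [Semiring B] [Algebra k B] {f g : FreeProduct k A →ₐ[k] B}
    (h : ∀ i, f.comp (FreeProduct.ι k A i) = g.comp (FreeProduct.ι k A i)) : f = g :=
  (FreeProduct.lift_unique k A (fun {i} => g.comp (FreeProduct.ι k A i)) f h).trans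
    (FreeProduct.lift_unique k A (fun {i} => g.comp (FreeProduct.ι k A i)) g fun _ => rfl).symm

instance freeProductGradedAlgebra : GradedAlgebra (freeProductGrading 𝒜) :=
  GradedAlgebra.ofAlgHom _ (FreeProduct.lift k A fun {i} => toFreeProductComponents 𝒜 i)
    (by
      apply freeProduct_hom_ext
      intro i
      ext a
      simp only [AlgHom.comp_apply, AlgHom.id_apply]
      rw [lift_ι_apply]
      induction a using DirectSum.Decomposition.inductionOn (𝒜 i) with
      | zero => simp
      | homogeneous a => rw [toFreeProductComponents_of_mem 𝒜 a.2]; simp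
      | add a b ha hb => simp only [map_add, ha, hb])
    (by
      have key : ∀ n x, (hx : IsProductOfDegree 𝒜 n x) →
          FreeProduct.lift k A (fun {i} => toFreeProductComponents 𝒜 i) x =
            DirectSum.of (fun n => freeProductGrading 𝒜 n) n ⟨x, Submodule.subset_span hx⟩ := by
        intro n x hx
        induction hx with
        | one => rw [map_one]; rfl
        | mul ha hx ih =>
          rw [map_mul, ih, lift_ι_apply, toFreeProductComponents_of_mem 𝒜 ha,
            DirectSum.of_mul_of]
          rfl
      rintro n ⟨x, hx⟩
      change x ∈ Submodule.span k _ at hx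
      induction hx using Submodule.span_induction with
      | mem x hx => exact key n x hx
      | zero => rw [map_zero]; exact (map_zero _).symm
      | add x y hx hy ihx ihy => rw [map_add, ihx, ihy, ← map_add]; rfl
      | smul c x hx ih =>
        rw [map_smul, ih, ← DirectSum.lof_eq_of k, ← map_smul]; rfl)

/-- The free product as a right module over the factor `A i`. -/
abbrev freeProductRightModule (k : Type u) [Field k] {I : Type w} (A : I → Type v)
    [∀ i, Ring (A i)] [∀ i, Algebra k (A i)] [DecidableEq I] (i : I) :
    Module (A i)ᵐᵒᵖ (FreeProduct k A) :=
  Module.compHom _ (RingHom.op (FreeProduct.ι k A i).toRingHom)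

/-- The function `D_P` of the right `A i`-module `P = E_{≤ N} A i`, the `A i`-submodule of the
free product `E` generated by the elements of degree at most `N`. (If all `A i` are connected,
`P` is a free `A i`-module.) -/
def truncatedDegreeBound (i : I) (N d : ℕ) : ℕ∞ :=
  letI := freeProductRightModule k A i
  degreeBound (𝒜 i) (freeProductGrading 𝒜)
    (Submodule.span (A i)ᵐᵒᵖ {x : FreeProduct k A | ∃ n ≤ N, x ∈ freeProductGrading 𝒜 n}) d

end Constructions

end GradedCoherence

end

/-! Everything is read off from Tor. Let the family `s` generate the right module `L` over a
connected algebra `R`, with free module `F` on the family and relation module `K`. Then `Tor₁(L, k)`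
is `(K ∩ F R₊) / K R₊`: relations with coefficients of positive degree, modulo products of relations
with positive elements. `TorBound` bounds the degrees (and, on demand, the number) of its
generators. By `TorBound.of_span_eq` it depends only on `L`, so the generating family may be changed
at will. For a minimal family every homogeneous relation has positive coefficients, and graded
Nakayama (`ker_le_of_generates`) identifies generators of Tor with generators of `K`; this recovers
`m₁` and finite presentation.

Free product. As a left ideal, `E₊` is the direct sum of the `E (A i)₊`, with projections given by
derivations. Hence a relation with positive coefficients splits into one relation per factor. If `L`
is a right ideal generated by all its homogeneous elements, a term `s (y a)` with `a` in a factor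
may be read as `(s y) a`, since `s y` is again in `L`. So relations over `E` come from relations
over the factors (`IsGradedCoproduct.torBound`). Moreover `E` is free over `A i` on the span of `1`
and of the products ending in another factor, the heads. As an `A i`-module, `L` is a small
submodule plus a free one (`torBound_homogeneousElements`), and the free part has no Tor. If `L` is
generated in degrees at most `d`, the small part is generated by the elements of `L` of degree at
most `d`, which gives the bound for `D_E`. For finiteness, the small part lies in a free module on
finitely many heads, and (effective) coherence passes from the algebra to such modules one
coordinate at a time (`UniformlyCoherent.of_functionals`).

Direct sum. `C₊` is the sum of the ideals `(A i)₊`, whose mutual products vanish. Relations over `C`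
with positive coefficients are therefore sums of such relations over the factors. The latter are
generated by Tor generators and by products of arbitrary relations with generators of `(A i)₊`
(`torBound_unitalSum`), whence the terms `D_A(d)` and `d + m(A₊)`.

Free algebras. Fox derivatives show that minimal generators of a right ideal satisfy no relation at
all (`ker_relMap_eq_bot_of_lift_bijective`), so `D = 0`. -/

noncomputable section

namespace GradedCoherence

set_option linter.unusedSectionVars false

/-! ### Families in graded modules and their relations -/

section Families

variable {k : Type*} [Field k] {A : Type*} [Ring A] [Algebra k A]
  {V : Type*} [AddCommGroup V] [Module k V] [Module Aᵐᵒᵖ V]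
  {ι κ : Type*}

/-- Right multiplication `a ↦ v * a` as a map of right modules. -/
def orbitMap (A : Type*) [Ring A] {V : Type*} [AddCommGroup V] [Module Aᵐᵒᵖ V] (v : V) :
    A →ₗ[Aᵐᵒᵖ] V where
  toFun a := op a • v
  map_add' a b := by simp [add_smul]
  map_smul' c a := by
    rw [RingHom.id_apply, smul_smul]
    rfl

/-- The map from the free right module on `ι` to `V` given by a family of elements of `V`; its
kernel is the module of relations between the elements of the family. -/
def relMap (A : Type*) [Ring A] {V : Type*} [AddCommGroup V] [Module Aᵐᵒᵖ V] {ι : Type*}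
    (s : ι → V) : (ι →₀ A) →ₗ[Aᵐᵒᵖ] V :=
  Finsupp.lsum ℕ fun i => orbitMap A (s i)

theorem relMap_apply (s : ι → V) (x : ι →₀ A) : relMap A s x = x.sum fun i a => op a • s i := rfl

@[simp] theorem relMap_single (s : ι → V) (i : ι) (a : A) :
    relMap A s (Finsupp.single i a) = op a • s i := by
  simp [relMap, orbitMap]

theorem op_smul_single (i : ι) (a b : A) :
    op b • Finsupp.single i a = Finsupp.single i (a * b) := by
  simp

theorem relMap_relMap (s : ι → V) (q : κ → ι →₀ A) (x : κ →₀ A) :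
    relMap A s (relMap A q x) = relMap A (fun j => relMap A s (q j)) x := by
  induction x using Finsupp.induction_linear with
  | zero => simp
  | add x y hx hy => simp [hx, hy]
  | single j a => simp

theorem range_relMap (s : ι → V) :
    LinearMap.range (relMap A s) = Submodule.span Aᵐᵒᵖ (Set.range s) := by
  apply le_antisymm
  · rintro _ ⟨x, rfl⟩
    rw [relMap_apply]
    exact Submodule.sum_mem _ fun i _ => Submodule.smul_mem _ _ (Submodule.subset_span ⟨i, rfl⟩)
  · rw [Submodule.span_le]
    rintro _ ⟨i, rfl⟩
    exact ⟨Finsupp.single i 1, by simp⟩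

theorem syzygies_eq_ker (S : Set V) :
    syzygies A S = LinearMap.ker (relMap A (Subtype.val : S → V)) := rfl

variable (𝒜 : ℕ → Submodule k A) (𝒱 : ℕ → Submodule k V)

/-- The action of `A` on the right module `V` respects the gradings. -/
class GradedRightModule : Prop where
  smul_mem : ∀ {m n : ℕ} {a : A} {v : V}, a ∈ 𝒜 m → v ∈ 𝒱 n → op a • v ∈ 𝒱 (n + m)

instance [SetLike.GradedMonoid 𝒜] : GradedRightModule 𝒜 𝒜 where
  smul_mem ha hv := SetLike.GradedMul.mul_mem hv ha

theorem mem_freeGrading {e : ι → ℕ} {n : ℕ} {x : ι →₀ A} :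
    x ∈ freeGrading 𝒜 e n ↔ ∀ i, x i = 0 ∨ ∃ j, e i + j = n ∧ x i ∈ 𝒜 j := by
  simp only [freeGrading, Submodule.mem_iInf, Submodule.mem_comap, Finsupp.lapply_apply]
  refine forall_congr' fun i => ?_
  split_ifs with h
  · constructor
    · exact fun hx => Or.inr ⟨n - e i, by omega, hx⟩
    · rintro (hx | ⟨j, hj, hx⟩)
      · rw [hx]; exact zero_mem _
      · rwa [← hj, Nat.add_sub_cancel_left]
  · constructor
    · exact fun hx => Or.inl hx
    · rintro (hx | ⟨j, hj, -⟩)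
      · exact hx
      · omega

theorem single_mem_freeGrading {e : ι → ℕ} {i : ι} {j n : ℕ} {a : A} (ha : a ∈ 𝒜 j)
    (h : e i + j = n) : Finsupp.single i a ∈ freeGrading 𝒜 e n := by
  classical
  rw [mem_freeGrading]
  intro i'
  by_cases hi : i = i'
  · subst hi
    exact Or.inr ⟨j, h, by simpa using ha⟩
  · exact Or.inl (Finsupp.single_eq_of_ne' hi)

instance [SetLike.GradedMonoid 𝒜] (e : ι → ℕ) : GradedRightModule 𝒜 (freeGrading 𝒜 e) where
  smul_mem := by
    intro m n a x ha hx
    rw [mem_freeGrading] at *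
    intro i
    rcases hx i with h | ⟨j, hj, h⟩
    · exact Or.inl (by simp [h])
    · exact Or.inr ⟨j + m, by omega, SetLike.GradedMul.mul_mem h ha⟩

variable {𝒜 𝒱}

theorem relMap_mem [GradedRightModule 𝒜 𝒱] {s : ι → V} {e : ι → ℕ} (hs : ∀ i, s i ∈ 𝒱 (e i))
    {n : ℕ} {x : ι →₀ A} (hx : x ∈ freeGrading 𝒜 e n) : relMap A s x ∈ 𝒱 n := by
  rw [relMap_apply]
  refine Submodule.sum_mem _ fun i hi => ?_
  rcases (mem_freeGrading 𝒜).1 hx i with h | ⟨j, hj, h⟩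
  · exact absurd h (Finsupp.mem_support_iff.1 hi)
  · rw [← hj]
    exact GradedRightModule.smul_mem h (hs i)

theorem exists_sum_freeGrading [GradedAlgebra 𝒜] (e : ι → ℕ) (x : ι →₀ A) :
    ∃ f : ℕ →₀ (ι →₀ A), (∀ n, f n ∈ freeGrading 𝒜 e n) ∧ (f.sum fun _ y => y) = x := by
  rw [← Submodule.mem_iSup_iff_exists_finsupp]
  induction x using Finsupp.induction_linear with
  | zero => exact zero_mem _
  | add x y hx hy => exact add_mem hx hy
  | single i a =>
    induction a using DirectSum.Decomposition.inductionOn 𝒜 with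
    | zero => simp
    | homogeneous a =>
      exact Submodule.mem_iSup_of_mem _ (single_mem_freeGrading 𝒜 a.2 rfl)
    | add a b ha hb => rw [Finsupp.single_add]; exact add_mem ha hb

section Component

variable (𝒱) [DirectSum.Decomposition 𝒱]

/-- The homogeneous component of degree `n`, as a linear map. -/
def component (n : ℕ) : V →ₗ[k] V :=
  (𝒱 n).subtype ∘ₗ DirectSum.component k ℕ (fun i => 𝒱 i) n ∘ₗ
    (DirectSum.decomposeLinearEquiv 𝒱).toLinearMap

theorem component_apply (n : ℕ) (v : V) : component 𝒱 n v = DirectSum.decompose 𝒱 v n := rfl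

theorem component_mem (n : ℕ) (v : V) : component 𝒱 n v ∈ 𝒱 n := SetLike.coe_mem _

variable {𝒱}

theorem component_same {n : ℕ} {v : V} (h : v ∈ 𝒱 n) : component 𝒱 n v = v :=
  DirectSum.decompose_of_mem_same 𝒱 h

theorem component_ne {m n : ℕ} {v : V} (h : v ∈ 𝒱 m) (hmn : m ≠ n) : component 𝒱 n v = 0 :=
  DirectSum.decompose_of_mem_ne 𝒱 h hmn

theorem mem_of_component_mem {X : Type*} [SetLike X V] [AddSubmonoidClass X V] {x : X} {v : V}
    (h : ∀ n, component 𝒱 n v ∈ x) : v ∈ x := by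
  classical
  rw [← DirectSum.sum_support_decompose 𝒱 v]
  exact sum_mem fun n _ => h n

theorem component_mem_span {Y : Set V} (hY : ∀ y ∈ Y, ∃ n, y ∈ 𝒱 n) {v : V}
    (hv : v ∈ Submodule.span k Y) (n : ℕ) :
    component 𝒱 n v ∈ Submodule.span k {y | y ∈ Y ∧ y ∈ 𝒱 n} := by
  induction hv using Submodule.span_induction with
  | mem y hy =>
    obtain ⟨m, hm⟩ := hY y hy
    by_cases h : m = n
    · subst h
      rw [component_same hm]
      exact Submodule.subset_span ⟨hy, hm⟩
    · rw [component_ne hm h]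
      exact zero_mem _
  | zero => rw [map_zero]; exact zero_mem _
  | add x y _ _ hx hy => rw [map_add]; exact add_mem hx hy
  | smul c x _ hx => rw [map_smul]; exact Submodule.smul_mem _ _ hx

/-- Relations decompose into homogeneous relations. -/
theorem mem_span_homogeneous_relations [GradedAlgebra 𝒜] [GradedRightModule 𝒜 𝒱]
    {s : ι → V} {e : ι → ℕ} (hs : ∀ i, s i ∈ 𝒱 (e i)) {x : ι →₀ A} (hx : relMap A s x = 0) :
    x ∈ Submodule.span Aᵐᵒᵖ {y : ι →₀ A | relMap A s y = 0 ∧ ∃ n, y ∈ freeGrading 𝒜 e n} := by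
  obtain ⟨f, hf, rfl⟩ := exists_sum_freeGrading (𝒜 := 𝒜) e x
  refine Submodule.sum_mem _ fun n _ => Submodule.subset_span ⟨?_, n, hf n⟩
  rw [Finsupp.sum, map_sum] at hx
  -- The images of the homogeneous parts `f m` have distinct degrees, so they vanish separately.
  have h := congrArg (component 𝒱 n) hx
  rw [map_sum, map_zero] at h
  by_cases hn : n ∈ f.support
  · rwa [Finset.sum_eq_single_of_mem n hn, component_same (relMap_mem hs (hf n))] at h
    intro m _ hm
    exact component_ne (relMap_mem hs (hf m)) hm
  · rw [Finsupp.notMem_support_iff.1 hn, map_zero]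

end Component

end Families

/-! ### Minimal homogeneous generators -/

section Minimal

variable {k : Type*} [Field k] {A : Type*} [Ring A] [Algebra k A]
  {V : Type*} [AddCommGroup V] [Module k V] [Module Aᵐᵒᵖ V] [IsScalarTower k Aᵐᵒᵖ V]
  {𝒜 : ℕ → Submodule k A} {𝒱 : ℕ → Submodule k V} [GradedAlgebra 𝒜]
  [DirectSum.Decomposition 𝒱] [GradedRightModule 𝒜 𝒱]

theorem op_algebraMap_smul (c : k) (v : V) : op (algebraMap k A c) • v = c • v := by
  rw [Algebra.algebraMap_eq_smul_one, op_smul, smul_assoc, op_one, one_smul]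


variable (𝒜 𝒱) in
/-- The products of homogeneous elements of `L` and homogeneous elements of `A` of positive
degree. -/
def decomposables (L : Submodule Aᵐᵒᵖ V) : Set V :=
  {v | ∃ m j, 0 < j ∧ ∃ l ∈ L, l ∈ 𝒱 m ∧ ∃ a ∈ 𝒜 j, v = op a • l}

/-- Connectedness splits each coefficient into a scalar and elements of positive degree. The scalars
keep the vectors in the `k`-span of `Y`; the rest produces decomposables. -/
theorem mem_span_union_decomposables (hconn : Connected 𝒜) {L : Submodule Aᵐᵒᵖ V} {Y : Set V}
    (hY : ∀ y ∈ Y, ∃ n, y ∈ 𝒱 n) (hL : Y ⊆ L) {v : V} (hv : v ∈ Submodule.span Aᵐᵒᵖ Y) :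
    v ∈ Submodule.span k (Y ∪ decomposables 𝒜 𝒱 L) := by
  have hhom : ∀ y ∈ Y ∪ decomposables 𝒜 𝒱 L, y ∈ L ∧ ∃ n, y ∈ 𝒱 n := by
    rintro y (hy | ⟨m, j, -, l, hl, hlm, a, ha, rfl⟩)
    · exact ⟨hL hy, hY y hy⟩
    · exact ⟨L.smul_mem _ hl, _, GradedRightModule.smul_mem ha hlm⟩
  induction hv using Submodule.span_induction with
  | mem y hy => exact Submodule.subset_span (Or.inl hy)
  | zero => exact zero_mem _
  | add x y _ _ hx hy => exact add_mem hx hy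
  | smul b x hx0 hx =>
    clear hx0
    induction b using MulOpposite.rec' with | _ b
    induction b using DirectSum.Decomposition.inductionOn 𝒜 with
    | zero => simp
    | add a b ha hb => rw [op_add, add_smul]; exact add_mem ha hb
    | @homogeneous j b =>
      induction hx using Submodule.span_induction with
      | mem y hy =>
        rcases Nat.eq_zero_or_pos j with rfl | hj
        · obtain ⟨c, hc, -⟩ := hconn b b.2
          rw [← hc, op_algebraMap_smul]
          exact Submodule.smul_mem _ _ (Submodule.subset_span hy)
        · obtain ⟨hyL, n, hn⟩ := hhom y hy
          exact Submodule.subset_span (Or.inr ⟨n, j, hj, y, hyL, hn, b, b.2, rfl⟩)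
      | zero => simp
      | add x y _ _ hx hy => rw [smul_add]; exact add_mem hx hy
      | smul c x _ hx => rw [smul_comm]; exact Submodule.smul_mem _ _ hx

/-- Graded Nakayama without any finiteness: elements of `H` that form a basis of `L / L A₊` generate
`L`, by induction on the degree, and are irredundant because they are independent modulo `L A₊`. -/
theorem exists_isMinimalGenerating (hconn : Connected 𝒜) (H : Set V)
    (hH : ∀ h ∈ H, ∃ n, h ∈ 𝒱 n) :
    ∃ (S : Set V) (e : S → ℕ), S ⊆ H ∧ IsMinimalGenerating 𝒱 (Submodule.span Aᵐᵒᵖ H) S e := by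
  set L := Submodule.span Aᵐᵒᵖ H with hLdef
  set P := Submodule.span k (decomposables 𝒜 𝒱 L) with hP
  obtain ⟨κ, a, ha, hspan, hli⟩ := exists_linearIndependent' k (fun h : H => P.mkQ (h : V))
  set S : Set V := Set.range fun x => (a x : V) with hS
  have hSH : S ⊆ H := by rintro _ ⟨x, rfl⟩; exact (a x).2
  have hHS : H ⊆ Submodule.span k (S ∪ decomposables 𝒜 𝒱 L) := by
    intro h hh
    have h1 : P.mkQ h ∈ Submodule.span k (Set.range fun h : H => P.mkQ (h : V)) :=
      Submodule.subset_span ⟨⟨h, hh⟩, rfl⟩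
    have h2 : Set.range ((fun h : H => P.mkQ (h : V)) ∘ a) = P.mkQ '' S := by
      rw [hS, ← Set.range_comp]; rfl
    rw [← hspan, h2, Submodule.span_image, ← Submodule.mem_comap, Submodule.comap_map_mkQ,
      sup_comm, hP, ← Submodule.span_union] at h1
    exact h1
  choose e he using fun s : S => hH s (hSH s.2)
  refine ⟨S, e, hSH, he, le_antisymm (Submodule.span_mono hSH) ?_, ?_⟩
  · have key : ∀ n, ∀ l ∈ L, l ∈ 𝒱 n → l ∈ Submodule.span Aᵐᵒᵖ S := by
      intro n
      induction n using Nat.strong_induction_on with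
      | _ n ih =>
        intro l hl hn
        have h1 := mem_span_union_decomposables hconn hH Submodule.subset_span (hLdef ▸ hl)
        have h2 : l ∈ Submodule.span k (S ∪ decomposables 𝒜 𝒱 L) := by
          refine Submodule.span_le.2 ?_ h1
          exact Set.union_subset hHS (Set.subset_union_right.trans Submodule.subset_span)
        have h3 := component_mem_span (𝒱 := 𝒱) ?_ h2 n
        · rw [component_same hn] at h3
          refine (Submodule.span_le (p := (Submodule.span Aᵐᵒᵖ S).restrictScalars k)).2 ?_ h3
          rintro y ⟨hy | ⟨m, j, hj, l', hl', hm, b, hb, rfl⟩, hyn⟩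
          · exact Submodule.subset_span hy
          -- Zero lies in every degree, so `m + j = n` can only be inferred for a nonzero product.
          · by_cases h0 : op b • l' = 0
            · rw [h0]; exact zero_mem _
            · have hmj : m + j = n := by
                by_contra hne
                apply h0
                rw [← component_same hyn]
                exact component_ne (GradedRightModule.smul_mem hb hm) hne
              exact Submodule.smul_mem (Submodule.span Aᵐᵒᵖ S) _ (ih m (by omega) l' hl' hm)
        · rintro y (hy | ⟨m, j, -, l', hl', hlm, b, hb, rfl⟩)
          · exact hH y (hSH hy)
          · exact ⟨_, GradedRightModule.smul_mem hb hlm⟩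
    rw [hLdef, Submodule.span_le]
    intro h hh
    obtain ⟨n, hn⟩ := hH h hh
    exact key n h (Submodule.subset_span hh) hn
  · rintro _ ⟨x, rfl⟩ hmem
    have h1 := mem_span_union_decomposables hconn (𝒱 := 𝒱) (L := L)
      (fun y hy => hH y (hSH hy.1)) (fun y hy => Submodule.subset_span (hSH hy.1)) hmem
    refine hli.notMem_span_image (s := {x}ᶜ) (x := x) (by simp) ?_
    rw [Submodule.span_union, ← hP, sup_comm, ← Submodule.comap_map_mkQ, Submodule.mem_comap,
      ← Submodule.span_image] at h1
    refine Submodule.span_mono ?_ h1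
    rintro _ ⟨_, ⟨⟨y, rfl⟩, hy⟩, rfl⟩
    refine ⟨y, ?_, rfl⟩
    rintro rfl
    exact hy rfl

end Minimal

/-! ### Tor of a family and its independence of the generators -/

section RelationBounds

variable {k : Type*} [Field k] {A : Type*} [Ring A] [Algebra k A]
  {V : Type*} [AddCommGroup V] [Module Aᵐᵒᵖ V]
  (𝒜 : ℕ → Submodule k A) {ι κ : Type*}

/-- `x` is a homogeneous relation of degree `n` between the elements of the family `s`. -/
def IsRelation (s : ι → V) (e : ι → ℕ) (n : ℕ) (x : ι →₀ A) : Prop :=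
  x ∈ freeGrading 𝒜 e n ∧ relMap A s x = 0

/-- The vector `x`, homogeneous of degree `n`, has coefficients of positive degree. -/
def HasPositiveCoeffs (e : ι → ℕ) (n : ℕ) (x : ι →₀ A) : Prop :=
  ∀ i, x i = 0 ∨ ∃ j, 0 < j ∧ e i + j = n ∧ x i ∈ 𝒜 j

/-- Products of relations with homogeneous elements of positive degree, of total degree `n`. -/
def decomposableRelations (s : ι → V) (e : ι → ℕ) (n : ℕ) : Set (ι →₀ A) :=
  {y | ∃ m j, 0 < j ∧ m + j = n ∧ ∃ x, IsRelation 𝒜 s e m x ∧ ∃ a ∈ 𝒜 j, y = op a • x}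

/-- The first Tor of the module generated by the family `s` is generated by elements of degree at
most `N`, finitely many if `c` holds: up to decomposable relations, the relations with
coefficients of positive degree are generated by such ones. -/
def TorBound (N : ℕ∞) (c : Prop) (s : ι → V) (e : ι → ℕ) : Prop :=
  ∃ Φ : Set (ι →₀ A),
    (∀ φ ∈ Φ, ∃ n : ℕ, (n : ℕ∞) ≤ N ∧ HasPositiveCoeffs 𝒜 e n φ ∧ relMap A s φ = 0) ∧
    (c → Φ.Finite) ∧
    ∀ n x, HasPositiveCoeffs 𝒜 e n x → relMap A s x = 0 →
      x ∈ Submodule.span Aᵐᵒᵖ (Φ ∪ decomposableRelations 𝒜 s e n)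

/-- The relations of the family `s` are generated by homogeneous ones of degree at most `N`,
finitely many if `c` holds. -/
def RelationBound (N : ℕ∞) (c : Prop) (s : ι → V) (e : ι → ℕ) : Prop :=
  ∃ Φ : Set (ι →₀ A), (∀ φ ∈ Φ, ∃ n : ℕ, (n : ℕ∞) ≤ N ∧ φ ∈ freeGrading 𝒜 e n) ∧
    (c → Φ.Finite) ∧ Submodule.span Aᵐᵒᵖ Φ = LinearMap.ker (relMap A s)

variable {𝒜}

theorem HasPositiveCoeffs.mem_freeGrading {e : ι → ℕ} {n : ℕ} {x : ι →₀ A}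
    (h : HasPositiveCoeffs 𝒜 e n x) : x ∈ freeGrading 𝒜 e n := by
  rw [GradedCoherence.mem_freeGrading]
  intro i
  rcases h i with h | ⟨j, -, h⟩
  · exact Or.inl h
  · exact Or.inr ⟨j, h⟩

theorem hasPositiveCoeffs_of_lt {e : ι → ℕ} {n : ℕ} {x : ι →₀ A}
    (hx : x ∈ freeGrading 𝒜 e n) (h : ∀ i, e i < n) : HasPositiveCoeffs 𝒜 e n x := by
  intro i
  rcases (GradedCoherence.mem_freeGrading 𝒜).1 hx i with h' | ⟨j, hj, h'⟩
  · exact Or.inl h'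
  · exact Or.inr ⟨j, by have := h i; omega, hj, h'⟩

variable (𝒜) in
theorem hasPositiveCoeffs_single {e : ι → ℕ} {i : ι} {j n : ℕ} {a : A} (ha : a ∈ 𝒜 j)
    (hj : 0 < j) (h : e i + j = n) : HasPositiveCoeffs 𝒜 e n (Finsupp.single i a) := by
  classical
  intro i'
  by_cases hi : i = i'
  · subst hi
    exact Or.inr ⟨j, hj, h, by simpa using ha⟩
  · exact Or.inl (Finsupp.single_eq_of_ne' hi)

variable (𝒜) in
/-- Vectors with coefficients of positive degree, as a subspace. -/
def positiveVectors (e : ι → ℕ) (n : ℕ) : Submodule k (ι →₀ A) where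
  carrier := {x | HasPositiveCoeffs 𝒜 e n x}
  zero_mem' := fun i => Or.inl rfl
  add_mem' := by
    intro x y hx hy i
    rcases hx i with h | ⟨j, hj, hn, h⟩
    · rcases hy i with h' | ⟨j', h'⟩
      · left; simp [h, h']
      · right; exact ⟨j', by simpa [h] using h'⟩
    · right
      refine ⟨j, hj, hn, ?_⟩
      rcases hy i with h' | ⟨j', -, hn', h'⟩
      · simpa [h'] using h
      · obtain rfl : j = j' := by omega
        exact add_mem h h'
  smul_mem' := by
    intro c x hx i
    rcases hx i with h | ⟨j, hj, hn, h⟩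
    · left; simp [h]
    · exact Or.inr ⟨j, hj, hn, Submodule.smul_mem _ _ h⟩

theorem HasPositiveCoeffs.relMap [SetLike.GradedMonoid 𝒜] {e : ι → ℕ} {e' : κ → ℕ}
    {q : κ → ι →₀ A} (hq : ∀ j, q j ∈ freeGrading 𝒜 e (e' j)) {n : ℕ} {x : κ →₀ A}
    (hx : HasPositiveCoeffs 𝒜 e' n x) : HasPositiveCoeffs 𝒜 e n (relMap A q x) := by
  rw [relMap_apply]
  refine (positiveVectors 𝒜 e n).sum_mem fun j hj => ?_
  rcases hx j with h | ⟨m, hm, hn, h⟩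
  · exact absurd h (Finsupp.mem_support_iff.1 hj)
  · intro i
    rcases (GradedCoherence.mem_freeGrading 𝒜).1 (hq j) i with h' | ⟨l, hl, h'⟩
    · left; simp [h']
    · exact Or.inr ⟨l + m, by omega, by omega, SetLike.GradedMul.mul_mem h' h⟩

/-- A homogeneous element of the module generated by a homogeneous family is the image of a
homogeneous vector. -/
theorem exists_relMap_eq [GradedAlgebra 𝒜] [Module k V] {𝒱 : ℕ → Submodule k V}
    [DirectSum.Decomposition 𝒱] [GradedRightModule 𝒜 𝒱] {s : ι → V} {e : ι → ℕ}
    (hs : ∀ i, s i ∈ 𝒱 (e i)) {v : V} (hv : v ∈ Submodule.span Aᵐᵒᵖ (Set.range s)) {n : ℕ}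
    (hn : v ∈ 𝒱 n) : ∃ x ∈ freeGrading 𝒜 e n, relMap A s x = v := by
  rw [← range_relMap] at hv
  obtain ⟨x, rfl⟩ := hv
  obtain ⟨f, hf, rfl⟩ := exists_sum_freeGrading (𝒜 := 𝒜) e x
  refine ⟨f n, hf n, ?_⟩
  rw [← component_same hn, Finsupp.sum, map_sum, map_sum]
  by_cases hn : n ∈ f.support
  · rw [Finset.sum_eq_single_of_mem n hn, component_same (relMap_mem hs (hf n))]
    intro m _ hm
    exact component_ne (relMap_mem hs (hf m)) hm
  · rw [Finsupp.notMem_support_iff.1 hn, map_zero]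
    refine (Finset.sum_eq_zero fun m hm => ?_).symm
    refine component_ne (relMap_mem hs (hf m)) ?_
    rintro rfl
    exact hn hm

/-- `TorBound` only depends on the module generated by the family. -/
theorem TorBound.of_span_eq [GradedAlgebra 𝒜] [Module k V] {𝒱 : ℕ → Submodule k V}
    [DirectSum.Decomposition 𝒱] [GradedRightModule 𝒜 𝒱] {s : ι → V} {e : ι → ℕ}
    {t : κ → V} {e' : κ → ℕ} {N : ℕ∞} {c : Prop}
    (hs : ∀ i, s i ∈ 𝒱 (e i)) (ht : ∀ j, t j ∈ 𝒱 (e' j))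
    (hst : Submodule.span Aᵐᵒᵖ (Set.range s) = Submodule.span Aᵐᵒᵖ (Set.range t))
    (h : TorBound 𝒜 N c s e) : TorBound 𝒜 N c t e' := by
  obtain ⟨Φ, hΦ, hfin, hgen⟩ := h
  -- `p` and `q` express the two families through each other, homogeneously; they carry relations of
  -- one to relations of the other.
  choose p hp hps using fun i => exists_relMap_eq (𝒜 := 𝒜) ht
    (hst ▸ Submodule.subset_span ⟨i, rfl⟩ : s i ∈ Submodule.span Aᵐᵒᵖ (Set.range t)) (hs i)
  choose q hq hqt using fun j => exists_relMap_eq (𝒜 := 𝒜) hs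
    (hst ▸ Submodule.subset_span ⟨j, rfl⟩ : t j ∈ Submodule.span Aᵐᵒᵖ (Set.range s)) (ht j)
  have hp' : ∀ x, relMap A t (relMap A p x) = relMap A s x := fun x => by
    rw [relMap_relMap]; simp only [hps]
  have hq' : ∀ x, relMap A s (relMap A q x) = relMap A t x := fun x => by
    rw [relMap_relMap]; simp only [hqt]
  refine ⟨relMap A p '' Φ, ?_, fun hc => (hfin hc).image _, ?_⟩
  · rintro _ ⟨φ, hφ, rfl⟩
    obtain ⟨n, hn, hpos, hrel⟩ := hΦ φ hφ
    exact ⟨n, hn, hpos.relMap hp, by rw [hp', hrel]⟩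
  · intro n x hpos hrel
    have h1 := hgen n (relMap A q x) (hpos.relMap hq) (by rw [hq', hrel])
    have h2 : relMap A p (relMap A q x) ∈
        Submodule.span Aᵐᵒᵖ (relMap A p '' Φ ∪ decomposableRelations 𝒜 t e' n) := by
      have h3 := Submodule.mem_map_of_mem (f := relMap A p) h1
      rw [Submodule.map_span, Set.image_union] at h3
      refine Submodule.span_mono (Set.union_subset_union_right _ ?_) h3
      rintro _ ⟨_, ⟨m, j, hj, hmj, y, ⟨hy, hy'⟩, a, ha, rfl⟩, rfl⟩
      exact ⟨m, j, hj, hmj, relMap A p y, ⟨relMap_mem hp hy, by rw [hp', hy']⟩, a, ha,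
        by rw [map_smul]⟩
    -- Going back and forth changes `x` only by decomposable relations: each basis vector minus its
    -- image `p (q j)` is a relation, and it gets multiplied by the coefficient `x j` of positive
    -- degree.
    have h4 : x - relMap A p (relMap A q x) ∈
        Submodule.span Aᵐᵒᵖ (relMap A p '' Φ ∪ decomposableRelations 𝒜 t e' n) := by
      have h5 : x - relMap A p (relMap A q x) =
          x.sum fun j a => op a • (Finsupp.single j 1 - relMap A p (q j)) := by
        rw [relMap_relMap, relMap_apply]
        simp only [smul_sub, op_smul_single, one_mul]
        rw [Finsupp.sum_sub, Finsupp.sum_single]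
      rw [h5]
      refine Submodule.sum_mem _ fun j hj => ?_
      rcases hpos j with h | ⟨m, hm, hn, h⟩
      · exact absurd h (Finsupp.mem_support_iff.1 hj)
      · refine Submodule.subset_span (Or.inr ⟨e' j, m, hm, hn, _, ⟨?_, ?_⟩, x j, h, rfl⟩)
        · exact sub_mem (single_mem_freeGrading 𝒜 SetLike.GradedOne.one_mem rfl)
            (relMap_mem hp (hq j))
        · rw [map_sub, hp', hqt]; simp
    simpa using add_mem h4 h2

end RelationBounds

/-! ### Tor, degree bounds and finite presentation -/

section Bounds

variable {k : Type*} [Field k] {A : Type*} [Ring A] [Algebra k A]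
  {V : Type*} [AddCommGroup V] [Module k V] [Module Aᵐᵒᵖ V]
  {𝒜 : ℕ → Submodule k A} {𝒱 : ℕ → Submodule k V} {ι : Type*}

/-- A nonzero coefficient of degree zero is an invertible scalar, so its generator would lie in the
span of the others. -/
theorem IsMinimalGenerating.hasPositiveCoeffs [IsScalarTower k Aᵐᵒᵖ V] (hconn : Connected 𝒜)
    {L : Submodule Aᵐᵒᵖ V} {S : Set V} {e : S → ℕ} (h : IsMinimalGenerating 𝒱 L S e) {n : ℕ}
    {x : S →₀ A} (hx : x ∈ freeGrading 𝒜 e n) (hrel : relMap A (Subtype.val : S → V) x = 0) :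
    HasPositiveCoeffs 𝒜 e n x := by
  classical
  intro s
  rcases (mem_freeGrading 𝒜).1 hx s with h0 | ⟨j, hj, hs⟩
  · exact Or.inl h0
  rcases Nat.eq_zero_or_pos j with rfl | hpos
  · left
    obtain ⟨c, hc, -⟩ := hconn _ hs
    by_contra hne
    have hc0 : c ≠ 0 := by
      rintro rfl
      exact hne (by rw [← hc, map_zero])
    apply h.minimal s s.2
    have h1 : c • (s : V) = - relMap A Subtype.val (x.erase s) := by
      rw [eq_neg_iff_add_eq_zero, ← op_algebraMap_smul (A := A), hc, ← relMap_single, ← map_add,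
        Finsupp.single_add_erase, hrel]
    have h2 : relMap A Subtype.val (x.erase s) ∈ Submodule.span Aᵐᵒᵖ (S \ {(s : V)}) := by
      rw [relMap_apply]
      refine Submodule.sum_mem _ fun t ht => Submodule.smul_mem _ _ (Submodule.subset_span ?_)
      rw [Finsupp.support_erase, Finset.mem_erase] at ht
      exact ⟨t.2, fun h => ht.1 (Subtype.ext h)⟩
    have h3 : (s : V) = op (algebraMap k A c⁻¹) • (c • (s : V)) := by
      rw [op_algebraMap_smul, smul_smul, inv_mul_cancel₀ hc0, one_smul]
    have h4 := Submodule.smul_mem _ (op (algebraMap k A c⁻¹)) (neg_mem h2)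
    rwa [← h1, ← h3] at h4
  · exact Or.inr ⟨j, hpos, hj, hs⟩

/-- Since homogeneous relations of a minimal family have positive coefficients, generators of the
relation module already serve as Tor generators, and no decomposable relations are needed. -/
theorem RelationBound.torBound_of_minimal [IsScalarTower k Aᵐᵒᵖ V] (hconn : Connected 𝒜)
    {L : Submodule Aᵐᵒᵖ V} {S : Set V} {e : S → ℕ} (h : IsMinimalGenerating 𝒱 L S e)
    {N : ℕ∞} {c : Prop} (hT : RelationBound 𝒜 N c (Subtype.val : S → V) e) :
    TorBound 𝒜 N c (Subtype.val : S → V) e := by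
  obtain ⟨Φ, hΦ, hfin, hspan⟩ := hT
  have hker : ∀ φ ∈ Φ, relMap A (Subtype.val : S → V) φ = 0 := fun φ hφ => by
    rw [← LinearMap.mem_ker, ← hspan]
    exact Submodule.subset_span hφ
  refine ⟨Φ, fun φ hφ => ?_, hfin, fun n x _ hr => ?_⟩
  · obtain ⟨n, hn, hφn⟩ := hΦ φ hφ
    exact ⟨n, hn, h.hasPositiveCoeffs hconn hφn (hker φ hφ), hker φ hφ⟩
  · rw [← LinearMap.mem_ker, ← hspan] at hr
    exact Submodule.span_mono Set.subset_union_left hr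

/-- An infimum of natural numbers bounded by `d` is attained, and generation in degrees at most `d'`
persists for every larger bound. -/
theorem m₀_le_iff {L : Submodule Aᵐᵒᵖ V} {d : ℕ} :
    m₀ 𝒱 L ≤ d ↔ GeneratedInDegreeLE 𝒱 L d := by
  constructor
  · intro h
    obtain ⟨d', hd', hle⟩ : ∃ d', GeneratedInDegreeLE 𝒱 L d' ∧ d' ≤ d := by
      by_contra! hcon
      have h1 : ((d + 1 : ℕ) : ℕ∞) ≤ m₀ 𝒱 L :=
        le_iInf₂ fun d' hd' => by exact_mod_cast hcon d' hd'
      have h2 : d + 1 ≤ d := by exact_mod_cast h1.trans h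
      omega
    refine le_antisymm (Submodule.span_le.2 fun x hx => hx.1) ?_
    conv_lhs => rw [← hd']
    exact Submodule.span_mono fun x hx => ⟨hx.1, hx.2.choose, hx.2.choose_spec.1.trans hle,
      hx.2.choose_spec.2⟩
  · exact fun h => iInf₂_le d h

theorem m₀_span_le {s : ι → V} {e : ι → ℕ} (hs : ∀ i, s i ∈ 𝒱 (e i)) {d : ℕ}
    (hd : ∀ i, e i ≤ d) : m₀ 𝒱 (Submodule.span Aᵐᵒᵖ (Set.range s)) ≤ d := by
  rw [m₀_le_iff]
  refine le_antisymm (Submodule.span_le.2 fun x hx => hx.1) (Submodule.span_mono ?_)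
  rintro _ ⟨i, rfl⟩
  exact ⟨Submodule.subset_span ⟨i, rfl⟩, e i, hd i, hs i⟩

theorem m₀_relations_le {s : ι → V} {e : ι → ℕ} {N : ℕ∞} {c : Prop}
    (h : RelationBound 𝒜 N c s e) : m₀ (freeGrading 𝒜 e) (LinearMap.ker (relMap A s)) ≤ N := by
  obtain ⟨Φ, hΦ, -, hspan⟩ := h
  induction N using ENat.recTopCoe with
  | top => exact le_top
  | coe N =>
    rw [m₀_le_iff]
    refine le_antisymm (Submodule.span_le.2 fun x hx => hx.1) ?_
    conv_lhs => rw [← hspan]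
    refine Submodule.span_mono fun φ hφ => ⟨?_, ?_⟩
    · rw [← hspan]
      exact Submodule.subset_span hφ
    · obtain ⟨n, hn, h⟩ := hΦ φ hφ
      exact ⟨n, by exact_mod_cast hn, h⟩

theorem algebraDegreeBound_mono {d d' : ℕ} (h : d ≤ d') :
    algebraDegreeBound 𝒜 d ≤ algebraDegreeBound 𝒜 d' :=
  iSup_mono fun _ => iSup_mono fun _ => iSup_mono' fun hd =>
    ⟨hd.trans (by exact_mod_cast h), le_rfl⟩

/-- The right module `A` is free of rank one. -/
def opLinearEquivSelf (A : Type*) [Ring A] : Aᵐᵒᵖ ≃ₗ[Aᵐᵒᵖ] A where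
  toFun := unop
  invFun := op
  map_add' _ _ := rfl
  map_smul' _ _ := rfl
  left_inv _ := rfl
  right_inv _ := rfl

instance (A : Type*) [Ring A] : Module.Free Aᵐᵒᵖ A := Module.Free.of_equiv (opLinearEquivSelf A)

instance (A : Type*) [Ring A] : Module.Finite Aᵐᵒᵖ A := Module.Finite.equiv (opLinearEquivSelf A)

theorem finitePresentation_of_relationBound [Finite ι] {s : ι → V} {e : ι → ℕ} {N : ℕ∞}
    (h : RelationBound 𝒜 N True s e) :
    Module.FinitePresentation Aᵐᵒᵖ (Submodule.span Aᵐᵒᵖ (Set.range s)) := by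
  obtain ⟨Φ, -, hfin, hspan⟩ := h
  have : Module.FinitePresentation Aᵐᵒᵖ (ι →₀ A) := Module.finitePresentation_of_projective _ _
  rw [← range_relMap]
  refine Module.finitePresentation_of_surjective (relMap A s).rangeRestrict
    (LinearMap.surjective_rangeRestrict _) ?_
  rw [LinearMap.ker_rangeRestrict, ← hspan]
  exact Submodule.fg_span (hfin trivial)

variable [GradedAlgebra 𝒜] [DirectSum.Decomposition 𝒱] [GradedRightModule 𝒜 𝒱]

/-- Graded Nakayama lemma for modules of relations. -/
theorem ker_le_of_generates {s : ι → V} {e : ι → ℕ} (hs : ∀ i, s i ∈ 𝒱 (e i))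
    {P : Submodule Aᵐᵒᵖ (ι →₀ A)}
    (hgen : ∀ n x, HasPositiveCoeffs 𝒜 e n x → relMap A s x = 0 →
      x ∈ P ⊔ Submodule.span Aᵐᵒᵖ (decomposableRelations 𝒜 s e n))
    (hP : ∀ n x, IsRelation 𝒜 s e n x → HasPositiveCoeffs 𝒜 e n x ∨ x ∈ P) :
    LinearMap.ker (relMap A s) ≤ P := by
  have key : ∀ n x, IsRelation 𝒜 s e n x → x ∈ P := by
    intro n
    induction n using Nat.strong_induction_on with
    | _ n ih =>
      intro x hx
      rcases hP n x hx with hpos | h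
      · refine SetLike.le_def.1 (sup_le le_rfl (Submodule.span_le.2 ?_)) (hgen n x hpos hx.2)
        rintro _ ⟨m, j, hj, hmj, y, hy, a, -, rfl⟩
        exact P.smul_mem _ (ih m (by omega) y hy)
      · exact h
  intro x hx
  refine Submodule.span_le.2 ?_ (mem_span_homogeneous_relations (𝒜 := 𝒜) hs hx)
  rintro y ⟨hy, n, hn⟩
  exact key n y ⟨hn, hy⟩

/-- The converse of `RelationBound.torBound_of_minimal`, by Nakayama: decomposable relations can be
dropped from a generating set. -/
theorem TorBound.relationBound_of_minimal [IsScalarTower k Aᵐᵒᵖ V] (hconn : Connected 𝒜)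
    {L : Submodule Aᵐᵒᵖ V} {S : Set V} {e : S → ℕ} (h : IsMinimalGenerating 𝒱 L S e)
    {N : ℕ∞} {c : Prop} (hT : TorBound 𝒜 N c (Subtype.val : S → V) e) :
    RelationBound 𝒜 N c (Subtype.val : S → V) e := by
  obtain ⟨Φ, hΦ, hfin, hgen⟩ := hT
  refine ⟨Φ, fun φ hφ => ?_, hfin, le_antisymm ?_ ?_⟩
  · obtain ⟨n, hn, hpos, -⟩ := hΦ φ hφ
    exact ⟨n, hn, hpos.mem_freeGrading⟩
  · rw [Submodule.span_le]
    exact fun φ hφ => (hΦ φ hφ).choose_spec.2.2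
  · refine ker_le_of_generates h.homogeneous (fun n x hx hr => ?_) fun n x hx =>
      Or.inl (h.hasPositiveCoeffs hconn hx.1 hx.2)
    rw [← Submodule.span_union]
    exact hgen n x hx hr

/-- The relations of a family of elements of degrees at most `d` are generated by the relations of
degree at most `d` and the generators of the Tor. -/
theorem TorBound.relationBound {s : ι → V} {e : ι → ℕ} (hs : ∀ i, s i ∈ 𝒱 (e i)) {d : ℕ}
    (hd : ∀ i, e i ≤ d) {N : ℕ∞} {c : Prop} (hT : TorBound 𝒜 N c s e) :
    RelationBound 𝒜 (max N d) False s e := by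
  obtain ⟨Φ, hΦ, -, hgen⟩ := hT
  -- In degrees above `d` all coefficients have positive degree, so the Tor generators suffice
  -- there; a redundant family may also have relations with scalar coefficients, but only in degrees
  -- at most `d`.
  refine ⟨Φ ∪ {x | ∃ n ≤ d, IsRelation 𝒜 s e n x}, ?_, False.elim, le_antisymm ?_ ?_⟩
  · rintro φ (hφ | ⟨n, hn, hφ⟩)
    · obtain ⟨n, hn, hpos, -⟩ := hΦ φ hφ
      exact ⟨n, le_max_of_le_left hn, hpos.mem_freeGrading⟩
    · exact ⟨n, le_max_of_le_right (by exact_mod_cast hn), hφ.1⟩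
  · rw [Submodule.span_le]
    rintro φ (hφ | ⟨n, hn, hφ⟩)
    · exact (hΦ φ hφ).choose_spec.2.2
    · exact hφ.2
  · refine ker_le_of_generates (𝒜 := 𝒜) hs (fun n x hx hr => ?_) fun n x hx => ?_
    · refine SetLike.le_def.1 ?_ (hgen n x hx hr)
      rw [Submodule.span_union, Submodule.span_union]
      exact sup_le_sup_right le_sup_left _
    · by_cases hn : n ≤ d
      · exact Or.inr (Submodule.subset_span (Or.inr ⟨n, hn, hx⟩))
      · exact Or.inl (hasPositiveCoeffs_of_lt hx.1 fun i => by have := hd i; omega)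

/-- `m₁` is a supremum over all minimal families of the module, and a Tor bound for one generating
family transfers to each of them. -/
theorem m₁_le [IsScalarTower k Aᵐᵒᵖ V] (hconn : Connected 𝒜) {s : ι → V} {e : ι → ℕ}
    (hs : ∀ i, s i ∈ 𝒱 (e i)) {N : ℕ∞} {c : Prop} (hT : TorBound 𝒜 N c s e) :
    m₁ 𝒜 𝒱 (Submodule.span Aᵐᵒᵖ (Set.range s)) ≤ N := by
  refine iSup_le fun S => iSup_le fun e' => iSup_le fun hS => ?_
  rw [syzygies_eq_ker]
  refine m₀_relations_le (TorBound.relationBound_of_minimal hconn hS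
    (hT.of_span_eq hs hS.homogeneous ?_))
  rw [Subtype.range_coe, hS.span_eq]

/-- A bound on the function `D_M` bounds the Tor of every family in `M`. -/
theorem torBound_of_degreeBound_le [IsScalarTower k Aᵐᵒᵖ V] (hconn : Connected 𝒜)
    {M : Submodule Aᵐᵒᵖ V} {d : ℕ} {N : ℕ∞} (hN : degreeBound 𝒜 𝒱 M d ≤ N) {s : ι → V}
    {e : ι → ℕ} (hs : ∀ i, s i ∈ 𝒱 (e i)) (hd : ∀ i, e i ≤ d) (hM : ∀ i, s i ∈ M) :
    TorBound 𝒜 N False s e := by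
  obtain ⟨S, e', hS, hmin⟩ := exists_isMinimalGenerating (𝒱 := 𝒱) hconn (Set.range s)
    (by rintro _ ⟨i, rfl⟩; exact ⟨_, hs i⟩)
  refine TorBound.of_span_eq hmin.homogeneous hs (by rw [Subtype.range_coe, hmin.span_eq]) ?_
  refine RelationBound.torBound_of_minimal hconn hmin ?_
  -- The relation module of this one minimal family is among those over which `m₁`, hence `D_M`,
  -- takes its supremum.
  have hle : m₀ (freeGrading 𝒜 e') (LinearMap.ker (relMap A (Subtype.val : S → V))) ≤ N := by
    refine le_trans ?_ hN
    have h1 : m₁ 𝒜 𝒱 (Submodule.span Aᵐᵒᵖ (Set.range s)) ≤ degreeBound 𝒜 𝒱 M d :=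
      le_iSup_of_le _ <| le_iSup_of_le (by rw [Submodule.span_le]; rintro _ ⟨i, rfl⟩; exact hM i)
        <| le_iSup_of_le (m₀_span_le hs hd) le_rfl
    refine le_trans ?_ h1
    exact le_iSup_of_le S <| le_iSup_of_le e' <| le_iSup_of_le hmin le_rfl
  induction N using ENat.recTopCoe with
  | top =>
    refine ⟨_, fun φ hφ => ?_, False.elim, le_antisymm ?_ fun x hx =>
      mem_span_homogeneous_relations (𝒜 := 𝒜) hmin.homogeneous hx⟩
    · obtain ⟨-, n, hn⟩ := hφ
      exact ⟨n, le_top, hn⟩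
    · exact Submodule.span_le.2 fun x hx => hx.1
  | coe N =>
    rw [m₀_le_iff] at hle
    refine ⟨_, fun φ hφ => ?_, False.elim, hle⟩
    obtain ⟨-, n, hn, h⟩ := hφ
    exact ⟨n, by exact_mod_cast hn, h⟩

/-- The relation module is finitely generated and is spanned by homogeneous relations, so finitely
many homogeneous ones suffice. -/
theorem relationBound_of_finitePresentation [Finite ι] {s : ι → V} {e : ι → ℕ}
    (hs : ∀ i, s i ∈ 𝒱 (e i))
    (h : Module.FinitePresentation Aᵐᵒᵖ (Submodule.span Aᵐᵒᵖ (Set.range s))) :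
    RelationBound 𝒜 ⊤ True s e := by
  have hfg : (LinearMap.ker (relMap A s)).FG := by
    rw [← range_relMap] at h
    have := Module.FinitePresentation.fg_ker (relMap A s).rangeRestrict
      (LinearMap.surjective_rangeRestrict _)
    rwa [LinearMap.ker_rangeRestrict] at this
  have hspan : Submodule.span Aᵐᵒᵖ
      {y : ι →₀ A | relMap A s y = 0 ∧ ∃ n, y ∈ freeGrading 𝒜 e n} =
      LinearMap.ker (relMap A s) :=
    le_antisymm (Submodule.span_le.2 fun x hx => hx.1)
      fun x hx => mem_span_homogeneous_relations hs hx
  rw [← hspan, Submodule.fg_span_iff_fg_span_finset_subset] at hfg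
  obtain ⟨Φ, hΦ, heq⟩ := hfg
  refine ⟨Φ, fun φ hφ => ?_, fun _ => Φ.finite_toSet, by rw [← heq, hspan]⟩
  obtain ⟨-, n, hn⟩ := hΦ hφ
  exact ⟨n, le_top, hn⟩

/-- A finite homogeneous family generates a finitely presented module if and only if its Tor is
finitely generated. -/
theorem torBound_of_relationBound [IsScalarTower k Aᵐᵒᵖ V] (hconn : Connected 𝒜) [Finite ι]
    {s : ι → V} {e : ι → ℕ} (hs : ∀ i, s i ∈ 𝒱 (e i)) (h : RelationBound 𝒜 ⊤ True s e) :
    TorBound 𝒜 ⊤ True s e := by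
  obtain ⟨S, e', hS, hmin⟩ := exists_isMinimalGenerating (𝒱 := 𝒱) hconn (Set.range s)
    (by rintro _ ⟨i, rfl⟩; exact ⟨_, hs i⟩)
  have hfin : Finite S := (Set.finite_range s).subset hS
  have heq : Submodule.span Aᵐᵒᵖ (Set.range (Subtype.val : S → V)) =
    Submodule.span Aᵐᵒᵖ (Set.range s) := by rw [Subtype.range_coe, hmin.span_eq]
  refine TorBound.of_span_eq hmin.homogeneous hs heq ?_
  refine RelationBound.torBound_of_minimal hconn hmin ?_
  refine relationBound_of_finitePresentation hmin.homogeneous ?_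
  rw [heq]
  exact finitePresentation_of_relationBound h

theorem finitePresentation_of_torBound [IsScalarTower k Aᵐᵒᵖ V] (hconn : Connected 𝒜) [Finite ι]
    {s : ι → V} {e : ι → ℕ} (hs : ∀ i, s i ∈ 𝒱 (e i)) {N : ℕ∞} (h : TorBound 𝒜 N True s e) :
    Module.FinitePresentation Aᵐᵒᵖ (Submodule.span Aᵐᵒᵖ (Set.range s)) := by
  obtain ⟨S, e', hS, hmin⟩ := exists_isMinimalGenerating (𝒱 := 𝒱) hconn (Set.range s)
    (by rintro _ ⟨i, rfl⟩; exact ⟨_, hs i⟩)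
  have hfin : Finite S := (Set.finite_range s).subset hS
  have heq : Submodule.span Aᵐᵒᵖ (Set.range (Subtype.val : S → V)) =
    Submodule.span Aᵐᵒᵖ (Set.range s) := by rw [Subtype.range_coe, hmin.span_eq]
  rw [← heq]
  exact finitePresentation_of_relationBound
    (TorBound.relationBound_of_minimal hconn hmin (h.of_span_eq hs hmin.homogeneous heq.symm))

/-- A graded algebra is coherent as soon as the Tor of every finite homogeneous family is finitely
generated. -/
theorem coherent_of_torBound (hconn : Connected 𝒜)
    (h : ∀ (S : Finset A) (e : S → ℕ), (∀ s : S, (s : A) ∈ 𝒜 (e s)) →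
      TorBound 𝒜 ⊤ True (Subtype.val : S → A) e) : Coherent 𝒜 := by
  intro S hS
  choose e he using fun s : S => hS s s.2
  have := finitePresentation_of_torBound hconn he (h S e he)
  have heq : Submodule.span Aᵐᵒᵖ (Set.range (Subtype.val : S → A)) =
    Submodule.span Aᵐᵒᵖ (S : Set A) := congrArg _ Subtype.range_coe
  rwa [heq] at this

theorem Coherent.relationBound (h : Coherent 𝒜) [Finite ι] {s : ι → A} {e : ι → ℕ}
    (hs : ∀ i, s i ∈ 𝒜 (e i)) : RelationBound 𝒜 ⊤ True s e := by
  classical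
  have := Fintype.ofFinite ι
  refine relationBound_of_finitePresentation hs ?_
  have h1 := h (Finset.univ.image s) (by
    intro a ha
    obtain ⟨i, -, rfl⟩ := Finset.mem_image.1 ha
    exact ⟨e i, hs i⟩)
  rwa [Finset.coe_image, Finset.coe_univ, Set.image_univ] at h1

/-- It suffices to treat families of degrees at most `d`: a submodule with `m₀ L ≤ d` is generated
by all its homogeneous elements of such degrees. -/
theorem degreeBound_le_of_torBound [IsScalarTower k Aᵐᵒᵖ V] (hconn : Connected 𝒜)
    {M : Submodule Aᵐᵒᵖ V} {d : ℕ} {N : ℕ∞}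
    (h : ∀ (S : Set V) (e : S → ℕ), (∀ s : S, (s : V) ∈ 𝒱 (e s)) → (∀ s, e s ≤ d) → S ⊆ M →
      TorBound 𝒜 N False (Subtype.val : S → V) e) : degreeBound 𝒜 𝒱 M d ≤ N := by
  refine iSup_le fun L => iSup_le fun hL => iSup_le fun hd => ?_
  rw [m₀_le_iff] at hd
  set S : Set V := {x : V | x ∈ L ∧ ∃ n ≤ d, x ∈ 𝒱 n}
  choose e hed he using fun s : S => s.2.2
  have h1 := m₁_le hconn he (h S e he hed fun x hx => hL hx.1)
  rwa [Subtype.range_coe, hd] at h1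

/-- Effective coherence says nothing about `d = 0`; monotonicity of the degree bound covers that
case. -/
theorem EffectivelyCoherent.exists_bound (h : EffectivelyCoherent 𝒜) (d : ℕ) :
    ∃ N : ℕ, algebraDegreeBound 𝒜 d ≤ N := by
  have h1 := h (d + 1) (Nat.succ_pos d)
  lift algebraDegreeBound 𝒜 (d + 1) to ℕ using h1 with N hN
  exact ⟨N, hN ▸ algebraDegreeBound_mono (Nat.le_succ d)⟩

end Bounds

/-! ### Transfer of coherence to submodules of free modules -/

section UniformCoherence

universe u v w x

variable {k : Type u} [Field k] {A : Type v} [Ring A] [Algebra k A] (𝒜 : ℕ → Submodule k A)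

/-- A common form of coherence (`c` holds) and effective coherence (`c` fails): there are bounds on
the relations of all homogeneous families of elements of `A` of degrees at most `N` that are
finite if `c` holds, where `N = ⊤` is only allowed if `c` holds. -/
def UniformlyCoherent (c : Prop) : Prop :=
  ∀ N : ℕ∞, (c ∨ N ≠ ⊤) → ∃ N' : ℕ∞, (c ∨ N' ≠ ⊤) ∧
    ∀ (ι : Type x) (s : ι → A) (e : ι → ℕ), (∀ i, s i ∈ 𝒜 (e i)) → (∀ i, (e i : ℕ∞) ≤ N) →
      (c → Finite ι) → RelationBound 𝒜 N' c s e

variable {𝒜} [GradedAlgebra 𝒜]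

theorem Coherent.uniformlyCoherent (h : Coherent 𝒜) : UniformlyCoherent.{u, v, x} 𝒜 True :=
  fun _ _ => ⟨⊤, Or.inl trivial, fun _ _ _ hs _ hfin =>
    have := hfin trivial
    h.relationBound hs⟩

/-- The families are not assumed minimal, so the bound is the larger of that on Tor and of the
degree bound `N` of the family. -/
theorem EffectivelyCoherent.uniformlyCoherent (hconn : Connected 𝒜) (h : EffectivelyCoherent 𝒜) :
    UniformlyCoherent.{u, v, x} 𝒜 False := by
  intro N hN
  lift N to ℕ using hN.resolve_left id
  obtain ⟨N', hN'⟩ := h.exists_bound N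
  refine ⟨max N' N, Or.inr (by simp), fun ι s e hs hd _ => ?_⟩
  have hd' : ∀ i, e i ≤ N := fun i => by exact_mod_cast hd i
  exact (torBound_of_degreeBound_le hconn hN' hs hd' fun _ => trivial).relationBound hs hd'

variable {V : Type w} [AddCommGroup V] [Module k V] [Module Aᵐᵒᵖ V] {𝒱 : ℕ → Submodule k V}
  [GradedRightModule 𝒜 𝒱]

/-- (Effective) coherence passes from `A` to the graded modules on which finitely many homogeneous
`A`-valued functionals are jointly injective, in particular to submodules of free modules. -/
theorem UniformlyCoherent.of_functionals {c : Prop}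
    (h : UniformlyCoherent.{u, v, max v x} 𝒜 c) :
    ∀ (r : ℕ) (T : Fin r → V →ₗ[Aᵐᵒᵖ] A) (g : Fin r → ℕ)
      (_ : ∀ i n, ∀ v ∈ 𝒱 n, T i v = 0 ∨ ∃ m, g i + m = n ∧ T i v ∈ 𝒜 m)
      (N : ℕ∞), (c ∨ N ≠ ⊤) → ∃ N' : ℕ∞, (c ∨ N' ≠ ⊤) ∧
        ∀ (ι : Type (max v x)) (s : ι → V) (e : ι → ℕ), (∀ i, s i ∈ 𝒱 (e i)) →
          (∀ i, (e i : ℕ∞) ≤ N) → (c → Finite ι) →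
          (∀ v ∈ Submodule.span Aᵐᵒᵖ (Set.range s), (∀ i, T i v = 0) → v = 0) →
          RelationBound 𝒜 N' c s e := by
  classical
  intro r
  induction r with
  | zero =>
    intro T g _ N hN
    refine ⟨N, hN, fun ι s e hs hd hfin hinj => ?_⟩
    have hs0 : ∀ i, s i = 0 := fun i =>
      hinj _ (Submodule.subset_span ⟨i, rfl⟩) fun j => j.elim0
    -- With no functionals the generated module is zero, so every basis vector is a relation.
    refine ⟨Set.range fun i => Finsupp.single i 1, ?_, fun hc => ?_, ?_⟩
    · rintro _ ⟨i, rfl⟩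
      exact ⟨e i, hd i, single_mem_freeGrading 𝒜 SetLike.GradedOne.one_mem rfl⟩
    · have := hfin hc
      exact Set.finite_range _
    · refine le_antisymm ?_ ?_
      · rw [Submodule.span_le]
        rintro _ ⟨i, rfl⟩
        simp [hs0]
      · intro x _
        rw [← Finsupp.sum_single x]
        refine Submodule.sum_mem _ fun i _ => ?_
        rw [← one_mul (x i), ← op_smul_single]
        exact Submodule.smul_mem _ _ (Submodule.subset_span ⟨i, rfl⟩)
  | succ r ih =>
    intro T g hT N hN
    obtain ⟨N₁, hN₁, hb₁⟩ := h N hN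
    -- The functional `T 0` lowers degrees by `g 0`: a relation of degree at most `N₁` between the
    -- values gets degree at most `N₁ + g 0`. The basis vectors added in `Ψ'` have degree at most
    -- `N`.
    have hN₂ : c ∨ max N (N₁ + g 0) ≠ ⊤ := by
      rcases hN with hc | hN
      · exact Or.inl hc
      rcases hN₁ with hc | hN₁
      · exact Or.inl hc
      right
      simp [hN, hN₁, ENat.add_eq_top]
    obtain ⟨N₃, hN₃, hb₃⟩ := ih (fun i => T i.succ) (fun i => g i.succ)
      (fun i => hT i.succ) _ hN₂
    refine ⟨N₃, hN₃, fun ι s e hs hd hfin hinj => ?_⟩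
    set t : ι → A := fun i => T 0 (s i) with ht
    -- The subtraction is truncated. When `e i < g 0` the recorded degree `0` is spurious but
    -- harmless, since then `t i = 0`.
    have htdeg : ∀ i, t i ∈ 𝒜 (e i - g 0) := by
      intro i
      rcases hT 0 (e i) (s i) (hs i) with h0 | ⟨m, hm, h0⟩
      · rw [ht]; simp only [h0]; exact zero_mem _
      · rwa [← hm, Nat.add_sub_cancel_left]
    have htzero : ∀ i, ¬ g 0 ≤ e i → t i = 0 := by
      intro i hi
      rcases hT 0 (e i) (s i) (hs i) with h0 | ⟨m, hm, h0⟩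
      · exact h0
      · omega
    have hTs : ∀ x, T 0 (relMap A s x) = relMap A t x := by
      intro x
      induction x using Finsupp.induction_linear with
      | zero => simp
      | add x y hx hy => simp [hx, hy]
      | single i a => simp only [relMap_single, map_smul, ht]
    obtain ⟨Ψ, hΨ, hΨfin, hΨspan⟩ := hb₁ ι t (fun i => e i - g 0) htdeg
      (fun i => le_trans (by exact_mod_cast Nat.sub_le _ _) (hd i)) hfin
    have hfilter : ∀ x : ι →₀ A, relMap A t (x.filter fun i => g 0 ≤ e i) = relMap A t x := by
      intro x
      induction x using Finsupp.induction_linear with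
      | zero => rw [Finsupp.filter_zero]
      | add x y hx hy => rw [Finsupp.filter_add, map_add, map_add, hx, hy]
      | single i a =>
        by_cases hi : g 0 ≤ e i
        · rw [Finsupp.filter_single_of_pos (fun i => g 0 ≤ e i) hi]
        · rw [Finsupp.filter_single_of_neg (fun i => g 0 ≤ e i) hi]; simp [htzero i hi]
    -- Homogeneous generators, for the degrees `e`, of the relations between the `t i`: the
    -- coordinates with spurious degree are removed from `Ψ` and their basis vectors, which are
    -- relations, are adjoined.
    set Ψ' : Set (ι →₀ A) := (fun x => x.filter fun i => g 0 ≤ e i) '' Ψ ∪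
      (fun i => Finsupp.single i 1) '' {i | ¬ g 0 ≤ e i} with hΨ'
    have hΨ'deg : ∀ x : Ψ', ∃ n : ℕ, (n : ℕ∞) ≤ max N (N₁ + g 0) ∧ (x : ι →₀ A) ∈
        freeGrading 𝒜 e n := by
      rintro ⟨_, (⟨ψ, hψ, rfl⟩ | ⟨i, hi, rfl⟩)⟩
      · obtain ⟨n, hn, hψn⟩ := hΨ ψ hψ
        refine ⟨n + g 0, le_max_of_le_right ?_, ?_⟩
        · push_cast
          gcongr
        · rw [mem_freeGrading] at hψn ⊢
          intro i
          by_cases hi : g 0 ≤ e i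
          · simp only [Finsupp.filter_apply, hi, if_true]
            rcases hψn i with h0 | ⟨j, hj, h0⟩
            · exact Or.inl h0
            · exact Or.inr ⟨j, by omega, h0⟩
          · left; simp [hi]
      · exact ⟨e i, le_max_of_le_left (hd i),
          single_mem_freeGrading 𝒜 SetLike.GradedOne.one_mem rfl⟩
    have hΨ'ker : ∀ x ∈ Ψ', relMap A t x = 0 := by
      rintro _ (⟨ψ, hψ, rfl⟩ | ⟨i, hi, rfl⟩)
      · simp only [hfilter]
        rw [← LinearMap.mem_ker, ← hΨspan]
        exact Submodule.subset_span hψ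
      · simp [htzero i hi]
    have hΨ'span : LinearMap.ker (relMap A t) ≤ Submodule.span Aᵐᵒᵖ Ψ' := by
      rw [← hΨspan, Submodule.span_le]
      intro ψ hψ
      rw [← Finsupp.filter_add_filter_not ψ fun i => g 0 ≤ e i]
      refine add_mem (Submodule.subset_span (Or.inl ⟨ψ, hψ, rfl⟩)) ?_
      rw [← Finsupp.sum_single (Finsupp.filter _ ψ)]
      refine Submodule.sum_mem _ fun i hi => ?_
      rw [← one_mul ((Finsupp.filter _ ψ) i), ← op_smul_single]
      refine Submodule.smul_mem _ _ (Submodule.subset_span (Or.inr ⟨i, ?_, rfl⟩))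
      rw [Finsupp.support_filter, Finset.mem_filter] at hi
      exact hi.2
    choose n hn hdeg using hΨ'deg
    -- A relation between the `s i` is a combination of `Ψ'` whose coefficients form a relation
    -- between the images of `Ψ'` in `V`. These images lie in the kernel of `T 0`, where the other
    -- functionals are jointly injective, so induction applies.
    obtain ⟨Θ, hΘ, hΘfin, hΘspan⟩ := hb₃ Ψ' (fun x => relMap A s (x : ι →₀ A)) n
      (fun x => relMap_mem hs (hdeg x)) hn
      (fun hc => by
        have := hfin hc
        exact ((hΨfin hc).image _).union (Set.toFinite _))
      (by
        intro v hv hv0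
        have hmem : v ∈ Submodule.span Aᵐᵒᵖ (Set.range s) ∧ T 0 v = 0 := by
          refine SetLike.le_def.1 (Submodule.span_le
            (p := Submodule.span Aᵐᵒᵖ (Set.range s) ⊓ LinearMap.ker (T 0)).2 ?_) hv
          rintro _ ⟨x, rfl⟩
          refine ⟨?_, ?_⟩
          · rw [← range_relMap]
            exact ⟨_, rfl⟩
          · simp only [SetLike.mem_coe, LinearMap.mem_ker, hTs]
            exact hΨ'ker _ x.2
        refine hinj v hmem.1 fun i => ?_
        refine Fin.cases hmem.2 (fun i => hv0 i) i)
    refine ⟨relMap A (Subtype.val : Ψ' → ι →₀ A) '' Θ, ?_, fun hc => (hΘfin hc).image _, ?_⟩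
    · rintro _ ⟨θ, hθ, rfl⟩
      obtain ⟨m, hm, hθm⟩ := hΘ θ hθ
      exact ⟨m, hm, relMap_mem hdeg hθm⟩
    · rw [← Submodule.map_span, hΘspan]
      refine le_antisymm ?_ ?_
      · rintro _ ⟨y, hy, rfl⟩
        rw [LinearMap.mem_ker, relMap_relMap]
        exact hy
      · intro x hx
        have h1 : x ∈ LinearMap.range (relMap A (Subtype.val : Ψ' → ι →₀ A)) := by
          rw [range_relMap, Subtype.range_coe]
          apply hΨ'span
          rw [LinearMap.mem_ker, ← hTs, LinearMap.mem_ker.1 hx, map_zero]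
        obtain ⟨y, rfl⟩ := h1
        refine ⟨y, ?_, rfl⟩
        rw [LinearMap.mem_ker, relMap_relMap] at hx
        exact hx

end UniformCoherence

/-! ### The augmentation of a connected algebra -/

section Augmentation

variable {k : Type*} [Field k] {A : Type*} [Ring A] [Algebra k A] {𝒜 : ℕ → Submodule k A}

theorem Connected.algebraMap_injective [SetLike.GradedMonoid 𝒜] (h : Connected 𝒜) :
    Function.Injective (algebraMap k A) := fun c _ hcd =>
  (h _ (SetLike.algebraMap_mem_graded 𝒜 c)).unique rfl hcd.symm

variable [GradedAlgebra 𝒜]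

/-- The augmentation of a connected algebra, the projection onto the component of degree zero. -/
def Connected.augmentation (h : Connected 𝒜) : A →ₐ[k] k :=
  have hspec : ∀ a, algebraMap k A (h (component 𝒜 0 a) (component_mem 𝒜 0 a)).choose =
      GradedRing.projZeroRingHom 𝒜 a := fun a =>
    (h (component 𝒜 0 a) (component_mem 𝒜 0 a)).choose_spec.1
  { toFun a := (h (component 𝒜 0 a) (component_mem 𝒜 0 a)).choose
    map_one' := h.algebraMap_injective (by rw [hspec, map_one, map_one])
    map_zero' := h.algebraMap_injective (by rw [hspec, map_zero, map_zero])
    map_mul' a b := h.algebraMap_injective (by rw [hspec, map_mul, map_mul, hspec, hspec])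
    map_add' a b := h.algebraMap_injective (by rw [hspec, map_add, map_add, hspec, hspec])
    commutes' c := h.algebraMap_injective (by
      rw [hspec]
      exact component_same (SetLike.algebraMap_mem_graded 𝒜 c)) }

theorem Connected.algebraMap_augmentation (h : Connected 𝒜) (a : A) :
    algebraMap k A (h.augmentation a) = component 𝒜 0 a :=
  (h (component 𝒜 0 a) (component_mem 𝒜 0 a)).choose_spec.1

theorem Connected.augmentation_eq_zero (h : Connected 𝒜) {n : ℕ} (hn : 0 < n) {a : A}
    (ha : a ∈ 𝒜 n) : h.augmentation a = 0 :=
  h.algebraMap_injective (by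
    rw [h.algebraMap_augmentation, component_ne ha hn.ne', map_zero])

end Augmentation

/-! ### Graded coproducts; functionals from derivations -/

section Coproduct

variable {k : Type*} [Field k] {I : Type*} {A : I → Type*} [∀ i, Ring (A i)]
  [∀ i, Algebra k (A i)] {E : Type*} [Ring E] [Algebra k E]

/-- The properties of the grading of a free product `E` of connected algebras `A i` that describe
`E` as a module over itself and over the factors. -/
structure IsGradedCoproduct (𝒜 : ∀ i, ℕ → Submodule k (A i)) (ℰ : ℕ → Submodule k E)
    (f : ∀ i, A i →ₐ[k] E) : Prop where
  connected : Connected ℰ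
  map_mem : ∀ i n, ∀ a ∈ 𝒜 i n, f i a ∈ ℰ n
  le_span : ∀ n, 0 < n → ℰ n ≤ Submodule.span k {y | ∃ i p q, 0 < q ∧ p + q = n ∧
    ∃ x ∈ ℰ p, ∃ a ∈ 𝒜 i q, y = x * f i a}
  /-- The projections onto the left ideals generated by the elements of positive degree of the
  factors. -/
  exists_projection : ∀ i, ∃ P : E →ₗ[k] E,
    (∀ x n, 0 < n → ∀ a ∈ 𝒜 i n, P (x * f i a) = x * f i a) ∧
    ∀ j, j ≠ i → ∀ x n, 0 < n → ∀ a ∈ 𝒜 j n, P (x * f j a) = 0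
  /-- Every linear functional on `E` induces a functional of right `A i`-modules: `E` is freely
  generated over `A i` by any basis of the span of `1` and of the products ending in another
  factor. -/
  exists_functional : ∀ (i : I) (φ : E →ₗ[k] k), ∃ T : E →ₗ[k] A i,
    (∀ x a, T (x * f i a) = T x * a) ∧ T 1 = algebraMap k (A i) (φ 1) ∧
      ∀ j, j ≠ i → ∀ x n, 0 < n → ∀ a ∈ 𝒜 j n,
        T (x * f j a) = algebraMap k (A i) (φ (x * f j a))

open TensorProduct

/-- A derivation relative to the identity and the augmentation gives a projection. -/
theorem exists_projection_of_derivation {B : Type*} [Ring B] [Algebra k B] {f : B →ₐ[k] E}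
    {D : E →ₗ[k] E} {ε : E →ₐ[k] E} (hD : ∀ x y, D (x * y) = x * D y + D x * ε y)
    (hDf : ∀ a, D (f a) = ε (f a) - f a) :
    (∀ x a, ε (f a) = 0 → (-D) (x * f a) = x * f a) ∧
    ∀ x y, D y = 0 → ε y = 0 → (-D) (x * y) = 0 := by
  refine ⟨fun x a ha => ?_, fun x y hy hε => ?_⟩
  · simp [hD, hDf, ha]
  · simp [hD, hy, hε]

/-- A derivation with values in `E ⊗ B` gives functionals of right `B`-modules. -/
theorem exists_functional_of_derivation {B : Type*} [Ring B] [Algebra k B] {f : B →ₐ[k] E}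
    {ρ : E →ₐ[k] B} {D : E →ₗ[k] E ⊗[k] B}
    (hD : ∀ x y, D (x * y) = (x ⊗ₜ 1) * D y + D x * (1 ⊗ₜ ρ y))
    (hDf : ∀ a, D (f a) = 1 ⊗ₜ a - f a ⊗ₜ 1) (hρ : ∀ a, ρ (f a) = a) (φ : E →ₗ[k] k) :
    ∃ T : E →ₗ[k] B, (∀ x a, T (x * f a) = T x * a) ∧ T 1 = algebraMap k B (φ 1) ∧
      ∀ x y, D y = 0 → ρ y = 0 → T (x * y) = algebraMap k B (φ (x * y)) := by
  have hD1 : D 1 = 0 := by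
    have h := hD 1 1
    rw [map_one ρ, mul_one (1 : E), ← Algebra.TensorProduct.one_def, one_mul, mul_one] at h
    simpa using h
  -- Adding `x ⊗ 1` turns the derivation into a right `B`-linear map, as the terms `x f(a) ⊗ 1`
  -- cancel. It sends `y f(a)` to `y ⊗ a` if `D y = 0`.
  set τ : E →ₗ[k] E ⊗[k] B := D + (TensorProduct.mk k E B).flip 1 with hτ
  have hτ1 : ∀ x, τ x = D x + x ⊗ₜ 1 := fun x => rfl
  have hτi : ∀ x a, τ (x * f a) = τ x * (1 ⊗ₜ a) := by
    intro x a
    simp only [hτ1, hD, hDf, hρ, mul_sub, add_mul, Algebra.TensorProduct.tmul_mul_tmul, mul_one,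
      one_mul]
    abel
  set ev : E ⊗[k] B →ₗ[k] B := (TensorProduct.lid k B).toLinearMap ∘ₗ LinearMap.rTensor B φ
    with hev
  have hev1 : ∀ x b, ev (x ⊗ₜ b) = φ x • b := fun x b => by simp [hev]
  have hevm : ∀ z a, ev (z * (1 ⊗ₜ a)) = ev z * a := by
    intro z a
    induction z using TensorProduct.induction_on with
    | zero => simp
    | tmul x b => simp [hev1]
    | add x y hx hy => rw [add_mul, map_add, map_add, add_mul, hx, hy]
  refine ⟨ev ∘ₗ τ, fun x a => ?_, ?_, fun x y hy hρy => ?_⟩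
  · simp only [LinearMap.comp_apply, hτi, hevm]
  · simp only [LinearMap.comp_apply, hτ1, hD1, zero_add, hev1, Algebra.algebraMap_eq_smul_one]
  · simp only [LinearMap.comp_apply, hτ1, hD, hy, hρy, hev1, Algebra.algebraMap_eq_smul_one,
      mul_zero, TensorProduct.tmul_zero, zero_add]

end Coproduct

/-! ### The free product is a graded coproduct -/

section FreeProduct

open LinearAlgebra TensorProduct

universe u v w

variable {k : Type u} [Field k] {I : Type w} [DecidableEq I] {A : I → Type v} [∀ i, Ring (A i)]
  [∀ i, Algebra k (A i)]

/-- The inclusions of the factors lift to a map into `S`, which composed with the inclusion of `S`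
is the identity by uniqueness of lifts. -/
theorem freeProduct_mem_subalgebra {S : Subalgebra k (FreeProduct k A)}
    (h : ∀ i a, FreeProduct.ι k A i a ∈ S) (x : FreeProduct k A) : x ∈ S := by
  have h1 : S.val.comp (FreeProduct.lift k A fun {i} => (FreeProduct.ι k A i).codRestrict S (h i)) =
      AlgHom.id k _ := by
    apply freeProduct_hom_ext
    intro i
    ext a
    rw [AlgHom.comp_apply, AlgHom.comp_apply, lift_ι_apply]
    rfl
  rw [← AlgHom.id_apply (R := k) x, ← h1]
  exact SetLike.coe_mem _

/-- The algebra homomorphism to upper triangular matrices with diagonal `f`, `g` and the inner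
derivation `c • (g - f)` above the diagonal. -/
def triangularHom {B R : Type*} [Ring B] [Algebra k B] [Ring R] [Algebra k R] (c : k)
    (f g : B →ₐ[k] R) : B →ₐ[k] Matrix (Fin 2) (Fin 2) R :=
  AlgHom.ofLinearMap
    { toFun x := !![f x, c • (g x - f x); 0, g x]
      map_add' x y := by
        ext i j; fin_cases i <;> fin_cases j <;> simp [← smul_add, add_sub_add_comm]
      map_smul' a x := by
        ext i j; fin_cases i <;> fin_cases j <;> simp [← smul_sub, smul_comm a c] }
    (by ext i j; fin_cases i <;> fin_cases j <;> simp)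
    (by
      intro x y
      ext i j; fin_cases i <;> fin_cases j <;> simp [Matrix.mul_apply, ← smul_add]
      congr 1
      noncomm_ring)

/-- The derivation of the free product, relative to two homomorphisms `f` and `g`, which is the
inner one `g - f` on the factor `A i` and vanishes on the other factors. -/
theorem exists_derivation {R : Type*} [Ring R] [Algebra k R] (f g : FreeProduct k A →ₐ[k] R)
    (i : I) : ∃ D : FreeProduct k A →ₗ[k] R,
      (∀ x y, D (x * y) = f x * D y + D x * g y) ∧
      (∀ a, D (FreeProduct.ι k A i a) = g (FreeProduct.ι k A i a) - f (FreeProduct.ι k A i a)) ∧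
      ∀ j, j ≠ i → ∀ a, D (FreeProduct.ι k A j a) = 0 := by
  -- The upper right entry of a homomorphism to upper triangular matrices is a derivation relative
  -- to the diagonal entries; by the universal property it may be prescribed on each factor
  -- separately.
  set h : FreeProduct k A →ₐ[k] Matrix (Fin 2) (Fin 2) R := FreeProduct.lift k A fun {j} =>
    triangularHom (if j = i then 1 else 0) (f.comp (FreeProduct.ι k A j))
      (g.comp (FreeProduct.ι k A j)) with hh
  have hι : ∀ j a, h (FreeProduct.ι k A j a) = triangularHom (if j = i then 1 else 0)
      (f.comp (FreeProduct.ι k A j)) (g.comp (FreeProduct.ι k A j)) a := fun j a =>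
    lift_ι_apply _ j a
  have hmem : ∀ x, h x 1 0 = 0 ∧ h x 0 0 = f x ∧ h x 1 1 = g x := by
    let S : Subalgebra k (FreeProduct k A) :=
      { carrier := {x | h x 1 0 = 0 ∧ h x 0 0 = f x ∧ h x 1 1 = g x}
        mul_mem' := by
          rintro x y ⟨h1, h2, h3⟩ ⟨h1', h2', h3'⟩
          simp [Matrix.mul_apply, h1, h2, h3, h1', h2', h3']
        add_mem' := by
          rintro x y ⟨h1, h2, h3⟩ ⟨h1', h2', h3'⟩
          simp [h1, h2, h3, h1', h2', h3']
        algebraMap_mem' := by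
          intro c
          simp [AlgHom.commutes, Matrix.algebraMap_matrix_apply] }
    intro x
    have hx : x ∈ S := freeProduct_mem_subalgebra (fun j a => by
      change _ ∧ _ ∧ _
      rw [hι]
      simp [triangularHom]) x
    exact hx
  refine ⟨(Matrix.entryLinearMap k R 0 1).comp h.toLinearMap, fun x y => ?_, fun a => ?_,
    fun j hj a => ?_⟩
  · simp [Matrix.mul_apply, (hmem x).2.1, (hmem y).2.2]
  · simp [hι, triangularHom]
  · simp [hι, triangularHom, hj]

variable {𝒜 : ∀ i, ℕ → Submodule k (A i)} [∀ i, GradedAlgebra (𝒜 i)]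

/-- The augmentation of the free product of connected algebras. -/
def freeProductAugmentation (hconn : ∀ i, Connected (𝒜 i)) : FreeProduct k A →ₐ[k] k :=
  FreeProduct.lift k A fun {i} => (hconn i).augmentation

/-- The projection of the free product onto the factor `A i`. -/
def freeProductProj (hconn : ∀ i, Connected (𝒜 i)) (i : I) : FreeProduct k A →ₐ[k] A i :=
  FreeProduct.lift k A fun {j} =>
    if h : j = i then h ▸ AlgHom.id k (A j) else (Algebra.ofId k (A i)).comp (hconn j).augmentation

theorem freeProductProj_ι (hconn : ∀ i, Connected (𝒜 i)) (i : I) (a : A i) :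
    freeProductProj hconn i (FreeProduct.ι k A i a) = a := by
  rw [freeProductProj, lift_ι_apply]
  simp

theorem freeProductProj_ι_ne (hconn : ∀ i, Connected (𝒜 i)) {i j : I} (h : j ≠ i) {n : ℕ}
    (hn : 0 < n) {a : A j} (ha : a ∈ 𝒜 j n) :
    freeProductProj hconn i (FreeProduct.ι k A j a) = 0 := by
  rw [freeProductProj, lift_ι_apply]
  simp [h, (hconn j).augmentation_eq_zero hn ha]

/-- The homogeneous elements of positive degree of the free product are sums of products ending in
a homogeneous element of positive degree of a factor, and those of degree zero are scalars. -/
theorem isProductOfDegree_mem (hconn : ∀ i, Connected (𝒜 i)) {n : ℕ} {x : FreeProduct k A}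
    (hx : IsProductOfDegree 𝒜 n x) : (n = 0 ∧ ∃ c : k, x = algebraMap k _ c) ∨
      (0 < n ∧ ∃ i p q, 0 < q ∧ p + q = n ∧ ∃ y ∈ freeProductGrading 𝒜 p, ∃ a ∈ 𝒜 i q,
        x = y * FreeProduct.ι k A i a) := by
  induction hx with
  | one => exact Or.inl ⟨rfl, 1, (map_one _).symm⟩
  | @mul i m n a x ha hx ih =>
    rcases ih with ⟨rfl, c, rfl⟩ | ⟨hn, j, p, q, hq, hpq, y, hy, b, hb, rfl⟩
    · rcases Nat.eq_zero_or_pos m with rfl | hm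
      · left
        obtain ⟨c', hc', -⟩ := hconn i a ha
        refine ⟨rfl, c' * c, ?_⟩
        rw [← hc', AlgHom.commutes, map_mul]
      · right
        refine ⟨by omega, i, 0, m, hm, by omega, algebraMap k _ c,
          SetLike.algebraMap_mem_graded _ c, a, ha, (Algebra.commutes _ _).symm⟩
    · right
      exact ⟨by omega, j, m + p, q, hq, by omega, _,
        SetLike.GradedMul.mul_mem (ι_mem_freeProductGrading 𝒜 ha) hy, b, hb,
        (mul_assoc _ _ _).symm⟩

/-- Spanning comes from the last letter of a product of homogeneous elements; directness and
freeness come from derivations that are inner on one factor and vanish on the others. -/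
theorem isGradedCoproduct_freeProduct (hconn : ∀ i, Connected (𝒜 i)) :
    IsGradedCoproduct 𝒜 (freeProductGrading 𝒜) (fun i => FreeProduct.ι k A i) where
  connected := by
    intro x hx
    obtain ⟨c, rfl⟩ : ∃ c : k, algebraMap k _ c = x := by
      induction hx using Submodule.span_induction with
      | mem x hx =>
        rcases isProductOfDegree_mem hconn hx with ⟨-, c, rfl⟩ | ⟨h, -⟩
        · exact ⟨c, rfl⟩
        · exact absurd h (lt_irrefl 0)
      | zero => exact ⟨0, map_zero _⟩
      | add x y _ _ hx hy =>
        obtain ⟨c, rfl⟩ := hx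
        obtain ⟨d, rfl⟩ := hy
        exact ⟨c + d, map_add _ _ _⟩
      | smul a x _ hx =>
        obtain ⟨c, rfl⟩ := hx
        exact ⟨a * c, by rw [map_mul, Algebra.smul_def]⟩
    refine ⟨c, rfl, fun d hd => ?_⟩
    have h := congrArg (freeProductAugmentation hconn) hd
    rwa [AlgHom.commutes, AlgHom.commutes] at h
  map_mem i n a ha := ι_mem_freeProductGrading 𝒜 ha
  le_span n hn := by
    refine Submodule.span_mono fun x hx => ?_
    rcases isProductOfDegree_mem hconn hx with ⟨h, -⟩ | ⟨-, h⟩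
    · omega
    · exact h
  exists_projection i := by
    -- On `A i` this is `a ↦ ε(a) - a`, so `-D` fixes `x a` for `a` of positive degree in `A i`.
    obtain ⟨D, hD, hDi, hDj⟩ := exists_derivation (AlgHom.id k (FreeProduct k A))
      ((Algebra.ofId k (FreeProduct k A)).comp (freeProductAugmentation hconn)) i
    have haug : ∀ j n, 0 < n → ∀ a ∈ 𝒜 j n, ((Algebra.ofId k (FreeProduct k A)).comp
        (freeProductAugmentation hconn)) (FreeProduct.ι k A j a) = 0 := fun j n hn a ha => by
      rw [AlgHom.comp_apply, freeProductAugmentation, lift_ι_apply,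
        (hconn j).augmentation_eq_zero hn ha, map_zero]
    have h := exists_projection_of_derivation (f := FreeProduct.ι k A i) hD hDi
    exact ⟨-D, fun x n hn a ha => h.1 x a (haug i n hn a ha),
      fun j hj x n hn a ha => h.2 x _ (hDj j hj a) (haug j n hn a ha)⟩
  exists_functional i φ := by
    -- Here `D` is `a ↦ 1 ⊗ a - a ⊗ 1` on `A i`, with values in `E ⊗ A i`; the right action goes
    -- through the projection onto `A i`.
    obtain ⟨D, hD, hDi, hDj⟩ := exists_derivation (R := FreeProduct k A ⊗[k] A i)
      (Algebra.TensorProduct.includeLeft : FreeProduct k A →ₐ[k] FreeProduct k A ⊗[k] A i)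
      (Algebra.TensorProduct.includeRight.comp (freeProductProj hconn i)) i
    obtain ⟨T, h1, h2, h3⟩ := exists_functional_of_derivation (f := FreeProduct.ι k A i)
      (ρ := freeProductProj hconn i) (D := D) hD
      (fun a => by
        rw [hDi, AlgHom.comp_apply, freeProductProj_ι]
        rfl)
      (freeProductProj_ι hconn i) φ
    exact ⟨T, h1, h2, fun j hj x n hn a ha => h3 x _ (hDj j hj a)
      (freeProductProj_ι_ne hconn hj hn ha)⟩

end FreeProduct

/-! ### Free summands, reindexing and irredundant subfamilies -/

section FreeExtension

variable {k : Type*} [Field k] {A : Type*} [Ring A] [Algebra k A]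
  {V : Type*} [AddCommGroup V] [Module k V] [Module Aᵐᵒᵖ V]
  {𝒜 : ℕ → Submodule k A} {ι κ : Type*} [GradedAlgebra 𝒜]

theorem relMap_apply_apply_eq (σ : κ → ι) (hσ : Function.Injective σ) (x : κ →₀ A) (j : κ) :
    relMap A (fun j => Finsupp.single (σ j) (1 : A)) x (σ j) = x j := by
  classical
  induction x using Finsupp.induction_linear with
  | zero => simp
  | add x y hx hy => simp [hx, hy]
  | single l a => simp [Finsupp.single_apply, hσ.eq_iff]

theorem relMap_smul_scalar [IsScalarTower k Aᵐᵒᵖ V] (s : ι → V) (c : k) (x : ι →₀ A) :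
    relMap A s (c • x) = c • relMap A s x := by
  rw [← op_algebraMap_smul (A := A) c x, map_smul, op_algebraMap_smul]

/-- Adding free generators does not change the Tor. -/
theorem TorBound.sum_elim {N : ℕ∞} {c : Prop} {t : κ → V} {e : κ → ℕ} {v : ι → V} {g : ι → ℕ}
    (hfree : ∀ m ∈ Submodule.span Aᵐᵒᵖ (Set.range t), ∀ β : ι →₀ A, m + relMap A v β = 0 → β = 0)
    (h : TorBound 𝒜 N c t e) : TorBound 𝒜 N c (Sum.elim t v) (Sum.elim e g) := by
  obtain ⟨Φ, hΦ, hfin, hgen⟩ := h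
  set q : κ → (κ ⊕ ι →₀ A) := fun j => Finsupp.single (Sum.inl j) 1
  set q' : ι → (κ ⊕ ι →₀ A) := fun j => Finsupp.single (Sum.inr j) 1
  have hq : ∀ j, q j ∈ freeGrading 𝒜 (Sum.elim e g) (e j) := fun j =>
    single_mem_freeGrading 𝒜 SetLike.GradedOne.one_mem rfl
  have hqt : ∀ x, relMap A (Sum.elim t v) (relMap A q x) = relMap A t x := fun x => by
    rw [relMap_relMap]; simp [q]
  have hqv : ∀ x, relMap A (Sum.elim t v) (relMap A q' x) = relMap A v x := fun x => by
    rw [relMap_relMap]; simp [q']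
  have hsplit : ∀ x : κ ⊕ ι →₀ A, ∃ y z, x = relMap A q y + relMap A q' z := by
    intro x
    induction x using Finsupp.induction_linear with
    | zero => exact ⟨0, 0, by simp⟩
    | add x x' hx hx' =>
      obtain ⟨y, z, rfl⟩ := hx
      obtain ⟨y', z', rfl⟩ := hx'
      exact ⟨y + y', z + z', by rw [map_add, map_add]; abel⟩
    | single j a =>
      rcases j with j | j
      · exact ⟨Finsupp.single j a, 0, by simp [q]⟩
      · exact ⟨0, Finsupp.single j a, by simp [q']⟩
  refine ⟨relMap A q '' Φ, ?_, fun hc => (hfin hc).image _, ?_⟩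
  · rintro _ ⟨φ, hφ, rfl⟩
    obtain ⟨n, hn, hpos, hrel⟩ := hΦ φ hφ
    exact ⟨n, hn, hpos.relMap hq, by rw [hqt, hrel]⟩
  · intro n x hpos hrel
    obtain ⟨y, z, rfl⟩ := hsplit x
    rw [map_add, hqt, hqv] at hrel
    -- By freeness every relation is supported on the family `t`.
    obtain rfl : z = 0 := hfree _ (by rw [← range_relMap]; exact ⟨y, rfl⟩) z hrel
    rw [map_zero, add_zero] at hrel hpos ⊢
    have hy : HasPositiveCoeffs 𝒜 e n y := by
      intro j
      have := hpos (Sum.inl j)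
      rwa [relMap_apply_apply_eq Sum.inl Sum.inl_injective] at this
    have h3 := Submodule.mem_map_of_mem (f := relMap A q) (hgen n y hy hrel)
    rw [Submodule.map_span, Set.image_union] at h3
    refine Submodule.span_mono (Set.union_subset_union_right _ ?_) h3
    rintro _ ⟨_, ⟨m, j, hj, hmj, y, ⟨hy, hy'⟩, a, ha, rfl⟩, rfl⟩
    exact ⟨m, j, hj, hmj, relMap A q y, ⟨relMap_mem hq hy, by rw [hqt, hy']⟩, a, ha,
      by rw [map_smul]⟩

/-- Reindexing moves a family into the universe over which `UniformlyCoherent` quantifies. -/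
theorem RelationBound.of_equiv (σ : κ ≃ ι) {s : ι → V} {e : ι → ℕ} {N : ℕ∞} {c : Prop}
    (h : RelationBound 𝒜 N c (fun j => s (σ j)) fun j => e (σ j)) : RelationBound 𝒜 N c s e := by
  obtain ⟨Φ, hΦ, hfin, hspan⟩ := h
  set q : κ → (ι →₀ A) := fun j => Finsupp.single (σ j) 1
  set p : ι → (κ →₀ A) := fun i => Finsupp.single (σ.symm i) 1
  have hq : ∀ j, q j ∈ freeGrading 𝒜 e (e (σ j)) := fun j =>
    single_mem_freeGrading 𝒜 SetLike.GradedOne.one_mem rfl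
  have hqs : ∀ x, relMap A s (relMap A q x) = relMap A (fun j => s (σ j)) x := fun x => by
    rw [relMap_relMap]; simp [q]
  have hqp : ∀ x, relMap A q (relMap A p x) = x := fun x => by
    rw [relMap_relMap]
    simp only [q, p, relMap_single, Equiv.apply_symm_apply, op_one, one_smul]
    rw [relMap_apply]
    simp only [op_smul_single, one_mul]
    exact Finsupp.sum_single x
  refine ⟨relMap A q '' Φ, ?_, fun hc => (hfin hc).image _, ?_⟩
  · rintro _ ⟨φ, hφ, rfl⟩
    obtain ⟨n, hn, hφn⟩ := hΦ φ hφ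
    exact ⟨n, hn, relMap_mem hq hφn⟩
  · rw [← Submodule.map_span, hspan]
    refine le_antisymm ?_ fun x hx => ⟨relMap A p x, ?_, hqp x⟩
    · rintro _ ⟨y, hy, rfl⟩
      rw [LinearMap.mem_ker, hqs]
      exact hy
    · rw [SetLike.mem_coe, LinearMap.mem_ker, ← hqs, hqp]
      exact hx

theorem TorBound.mono {s : ι → V} {e : ι → ℕ} {N N' : ℕ∞} {c : Prop} (hN : N ≤ N')
    (h : TorBound 𝒜 N c s e) : TorBound 𝒜 N' c s e := by
  obtain ⟨Φ, hΦ, h⟩ := h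
  refine ⟨Φ, fun φ hφ => ?_, h⟩
  obtain ⟨n, hn, h'⟩ := hΦ φ hφ
  exact ⟨n, hn.trans hN, h'⟩

/-- The Tor of a family is bounded if the relations of its irredundant subfamilies are. -/
theorem torBound_of_forall_relationBound [IsScalarTower k Aᵐᵒᵖ V] (hconn : Connected 𝒜)
    {𝒱 : ℕ → Submodule k V} [DirectSum.Decomposition 𝒱] [GradedRightModule 𝒜 𝒱]
    {s : ι → V} {e : ι → ℕ} (hs : ∀ i, s i ∈ 𝒱 (e i)) {N : ℕ∞} {c : Prop}
    (h : ∀ (S : Set V) (σ : S → ι), (∀ x, s (σ x) = x) →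
      RelationBound 𝒜 N c (Subtype.val : S → V) fun x => e (σ x)) : TorBound 𝒜 N c s e := by
  obtain ⟨S, _, hS, hmin⟩ := exists_isMinimalGenerating (𝒱 := 𝒱) hconn (Set.range s)
    (by rintro _ ⟨i, rfl⟩; exact ⟨_, hs i⟩)
  choose σ hσ using fun x : S => hS x.2
  -- The degrees of the subfamily are taken from `e`, so that bounds on `e` apply to it.
  have hmin' : IsMinimalGenerating 𝒱 (Submodule.span Aᵐᵒᵖ (Set.range s)) S fun x => e (σ x) :=
    ⟨fun x => by rw [← hσ x]; exact hs _, hmin.span_eq, hmin.minimal⟩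
  refine TorBound.of_span_eq hmin'.homogeneous hs (by rw [Subtype.range_coe, hmin.span_eq]) ?_
  exact RelationBound.torBound_of_minimal hconn hmin' (h S σ hσ)

end FreeExtension

/-! ### Tor over a coproduct from Tor over the factors -/

section CoproductTor

variable {k : Type*} [Field k] {I : Type*} {A : I → Type*} [∀ i, Ring (A i)]
  [∀ i, Algebra k (A i)] {E : Type*} [Ring E] [Algebra k E]
  {𝒜 : ∀ i, ℕ → Submodule k (A i)} [∀ i, GradedAlgebra (𝒜 i)]
  {ℰ : ℕ → Submodule k E} [GradedAlgebra ℰ] {f : ∀ i, A i →ₐ[k] E}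
  [∀ i, Module (A i)ᵐᵒᵖ E]

/-- The index type of the family of all homogeneous elements of a right ideal. -/
abbrev HomogeneousElements (ℰ : ℕ → Submodule k E) (L : Submodule Eᵐᵒᵖ E) : Type _ :=
  {x : ℕ × E // x.2 ∈ L ∧ x.2 ∈ ℰ x.1}

/-- The projection to a factor splits a relation over the coproduct into relations with
coefficients in the left ideals generated by the factors, which come from relations over the
factors. -/
theorem IsGradedCoproduct.torBound (H : IsGradedCoproduct 𝒜 ℰ f)
    (hact : ∀ i (a : A i) (x : E), op a • x = x * f i a) {L : Submodule Eᵐᵒᵖ E} {N : ℕ∞}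
    {c : Prop} (hc : c → Finite I)
    (h : ∀ i, TorBound (𝒜 i) N c (fun x : HomogeneousElements ℰ L => x.1.2) fun x => x.1.1) :
    TorBound ℰ N c (fun x : HomogeneousElements ℰ L => x.1.2) fun x => x.1.1 := by
  classical
  set s : HomogeneousElements ℰ L → E := fun x => x.1.2 with hs
  set e : HomogeneousElements ℰ L → ℕ := fun x => x.1.1 with he
  choose Φ hΦ hfin hgen using h
  let push : ∀ i, (HomogeneousElements ℰ L →₀ A i) →ₗ[k] (HomogeneousElements ℰ L →₀ E) :=
    fun i => Finsupp.mapRange.linearMap (f i).toLinearMap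
  have hpush : ∀ i x l, push i x l = f i (x l) := fun i x l => rfl
  have hpushs : ∀ i l a, push i (Finsupp.single l a) = Finsupp.single l (f i a) := fun i l a => by
    simp [push]
  have hpushrel : ∀ i x, relMap E s (push i x) = relMap (A i) s x := by
    intro i x
    induction x using Finsupp.induction_linear with
    | zero => simp
    | add x y hx hy => simp only [map_add, hx, hy]
    | single l a =>
      rw [hpushs, relMap_single, relMap_single, hact]
      rfl
  have hpushsmul : ∀ i (a : A i) x, push i (op a • x) = op (f i a) • push i x := by
    intro i a x
    ext l
    rw [hpush, Finsupp.smul_apply, Finsupp.smul_apply, hpush, op_smul_eq_mul, map_mul,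
      op_smul_eq_mul]
  have hpushmem : ∀ i n x, x ∈ freeGrading (𝒜 i) e n → push i x ∈ freeGrading ℰ e n := by
    intro i n x hx
    rw [mem_freeGrading] at hx ⊢
    intro l
    rcases hx l with h0 | ⟨j, hj, h0⟩
    · left; rw [hpush, h0, map_zero]
    · exact Or.inr ⟨j, hj, H.map_mem i j _ h0⟩
  have hpushpos : ∀ i n x, HasPositiveCoeffs (𝒜 i) e n x → HasPositiveCoeffs ℰ e n (push i x) := by
    intro i n x hx l
    rcases hx l with h0 | ⟨j, hj, hn, h0⟩
    · left; rw [hpush, h0, map_zero]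
    · exact Or.inr ⟨j, hj, hn, H.map_mem i j _ h0⟩
  have hpushspan : ∀ i (Y : Set (HomogeneousElements ℰ L →₀ A i)) (P : Submodule Eᵐᵒᵖ _),
      (∀ y ∈ Y, push i y ∈ P) → ∀ x ∈ Submodule.span (A i)ᵐᵒᵖ Y, push i x ∈ P := by
    intro i Y P hY x hx
    induction hx using Submodule.span_induction with
    | mem y hy => exact hY y hy
    | zero => rw [map_zero]; exact zero_mem _
    | add x y _ _ hx hy => rw [map_add]; exact add_mem hx hy
    | smul a x _ hx =>
      induction a using MulOpposite.rec' with | _ a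
      rw [hpushsmul]
      exact P.smul_mem _ hx
  refine ⟨⋃ i, push i '' Φ i, ?_, fun h => ?_, fun n x hpos hrel => ?_⟩
  · rintro _ ⟨_, ⟨i, rfl⟩, φ, hφ, rfl⟩
    obtain ⟨n, hn, hpos, hrel⟩ := hΦ i φ hφ
    exact ⟨n, hn, hpushpos i n φ hpos, by rw [hpushrel, hrel]⟩
  · have := hc h
    exact Set.finite_iUnion fun i => (hfin i h).image _
  set P := Submodule.span Eᵐᵒᵖ ((⋃ i, push i '' Φ i) ∪ decomposableRelations ℰ s e n) with hP
  -- vectors whose coefficients end in the factor `A i`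
  let ends : I → Submodule k (HomogeneousElements ℰ L →₀ E) := fun i =>
    Submodule.span k {z | ∃ l p q, 0 < q ∧ e l + p + q = n ∧ ∃ y ∈ ℰ p, ∃ a ∈ 𝒜 i q,
      z = Finsupp.single l (y * f i a)}
  have hends : ∀ i, ∀ z ∈ ends i, relMap E s z = 0 → z ∈ P := by
    intro i z hz hzrel
    -- The term `y a` at `s l` is replaced by `a` at the element `s l * y`, which belongs to the
    -- family because `L` is a right ideal. The two vectors differ by a relation times `a`, that is,
    -- by a decomposable relation, and the new coefficients lie in `A i`.
    have hζ : ∃ ζ, HasPositiveCoeffs (𝒜 i) e n ζ ∧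
        z - push i ζ ∈ Submodule.span k (decomposableRelations ℰ s e n) := by
      clear hzrel
      induction hz using Submodule.span_induction with
      | mem z hz =>
        obtain ⟨l, p, q, hq, hn, y, hy, a, ha, rfl⟩ := hz
        have hly : op y • s l ∈ ℰ (e l + p) := GradedRightModule.smul_mem hy l.2.2
        let l' : HomogeneousElements ℰ L := ⟨(e l + p, op y • s l), L.smul_mem _ l.2.1, hly⟩
        refine ⟨Finsupp.single l' a, hasPositiveCoeffs_single (𝒜 i) ha hq hn,
          Submodule.subset_span ⟨e l + p, q, hq, hn,
            Finsupp.single l y - Finsupp.single l' 1, ⟨?_, ?_⟩, f i a, H.map_mem i q a ha, ?_⟩⟩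
        · exact sub_mem (single_mem_freeGrading ℰ hy rfl)
            (single_mem_freeGrading ℰ SetLike.GradedOne.one_mem rfl)
        · rw [map_sub, relMap_single, relMap_single, op_one, one_smul, sub_self]
        · rw [hpushs, smul_sub, op_smul_single, op_smul_single, one_mul]
      | zero => exact ⟨0, fun _ => Or.inl rfl, by simp⟩
      | add z z' _ _ hz hz' =>
        obtain ⟨ζ, h1, h2⟩ := hz
        obtain ⟨ζ', h1', h2'⟩ := hz'
        refine ⟨ζ + ζ', (positiveVectors (𝒜 i) e n).add_mem h1 h1', ?_⟩
        rw [map_add, add_sub_add_comm]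
        exact add_mem h2 h2'
      | smul a z _ hz =>
        obtain ⟨ζ, h1, h2⟩ := hz
        refine ⟨a • ζ, (positiveVectors (𝒜 i) e n).smul_mem a h1, ?_⟩
        rw [map_smul, ← smul_sub]
        exact Submodule.smul_mem _ _ h2
    obtain ⟨ζ, hζpos, hζ⟩ := hζ
    have hdec : Submodule.span k (decomposableRelations ℰ s e n) ≤
        (P ⊓ LinearMap.ker (relMap E s)).restrictScalars k := by
      rw [Submodule.span_le]
      rintro _ ⟨m, j, hj, hmj, y, hy, a, ha, rfl⟩
      refine ⟨Submodule.subset_span (Or.inr ⟨m, j, hj, hmj, y, hy, a, ha, rfl⟩), ?_⟩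
      rw [SetLike.mem_coe, LinearMap.mem_ker, map_smul, hy.2, smul_zero]
    obtain ⟨h1, h2⟩ := hdec hζ
    rw [SetLike.mem_coe, LinearMap.mem_ker, map_sub, hzrel, zero_sub, neg_eq_zero, hpushrel] at h2
    have h3 := hpushspan i _ P ?_ ζ (hgen i n ζ hζpos h2)
    · rw [← sub_add_cancel z (push i ζ)]
      exact add_mem h1 h3
    · rintro y (hy | ⟨m, j, hj, hmj, y, hy, a, ha, rfl⟩)
      · exact Submodule.subset_span (Or.inl (Set.mem_iUnion.2 ⟨i, y, hy, rfl⟩))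
      · rw [hpushsmul]
        exact Submodule.subset_span (Or.inr ⟨m, j, hj, hmj, push i y,
          ⟨hpushmem i m y hy.1, by rw [hpushrel, hy.2]⟩, f i a, H.map_mem i j a ha, rfl⟩)
  choose Q hQi hQj using H.exists_projection
  -- decompose the relation
  have hx : x ∈ ⨆ i, ends i := by
    rw [← Finsupp.sum_single x]
    refine Submodule.sum_mem _ fun l _ => ?_
    rcases hpos l with h0 | ⟨j, hj, hn, h0⟩
    · rw [h0, Finsupp.single_zero]; exact zero_mem _
    · have h1 := H.le_span j hj h0
      clear h0
      generalize x l = y at h1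
      induction h1 using Submodule.span_induction with
      | mem y hy =>
        obtain ⟨i, p, q, hq, hpq, y, hy, a, ha, rfl⟩ := hy
        exact Submodule.mem_iSup_of_mem i
          (Submodule.subset_span ⟨l, p, q, hq, by omega, y, hy, a, ha, rfl⟩)
      | zero => rw [Finsupp.single_zero]; exact zero_mem _
      | add y z _ _ hy hz => rw [Finsupp.single_add]; exact add_mem hy hz
      | smul b y _ hy => rw [← Finsupp.smul_single]; exact Submodule.smul_mem _ _ hy
  have hproj_same : ∀ i, ∀ z ∈ ends i, Q i (relMap E s z) = relMap E s z := by
    intro i z hz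
    induction hz using Submodule.span_induction with
    | mem z hz =>
      obtain ⟨l, p, q, hq, -, y, -, a, ha, rfl⟩ := hz
      rw [relMap_single, op_smul_eq_mul, ← mul_assoc, hQi i _ q hq a ha]
    | zero => simp
    | add z z' _ _ hz hz' => simp only [map_add, hz, hz']
    | smul b z _ hz =>
      simp only [relMap_smul_scalar, map_smul, hz]
  have hproj_ne : ∀ i j, j ≠ i → ∀ z ∈ ends j, Q i (relMap E s z) = 0 := by
    intro i j hji z hz
    induction hz using Submodule.span_induction with
    | mem z hz =>
      obtain ⟨l, p, q, hq, -, y, -, a, ha, rfl⟩ := hz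
      rw [relMap_single, op_smul_eq_mul, ← mul_assoc, hQj i j hji _ q hq a ha]
    | zero => simp
    | add z z' _ _ hz hz' => simp only [map_add, hz, hz', add_zero]
    | smul b z _ hz =>
      simp only [relMap_smul_scalar, map_smul, hz, smul_zero]
  rw [Submodule.mem_iSup_iff_exists_finsupp] at hx
  obtain ⟨z, hz, rfl⟩ := hx
  refine Submodule.sum_mem _ fun i hi => hends i _ (hz i) ?_
  -- `Q i` retains exactly the value of the part ending in `A i`, so each part is a relation by
  -- itself.
  have h1 := congrArg (Q i) hrel
  rw [Finsupp.sum, map_sum, map_sum, map_zero, Finset.sum_eq_single_of_mem i hi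
    fun j _ hji => hproj_ne i j hji _ (hz j), hproj_same i _ (hz i)] at h1
  exact h1

end CoproductTor

/-! ### Dual functionals modulo a subspace -/

section DualFunctionals

variable {k : Type*} [Field k] {V J : Type*} [AddCommGroup V] [Module k V]

/-- A family that is linearly independent modulo `W` has dual functionals that vanish on `W`. -/
theorem exists_dual_functionals (W : Submodule k V) {v : J → V}
    (hv : LinearIndependent k fun j => W.mkQ (v j)) (j : J) :
    ∃ φ : V →ₗ[k] k, (∀ w ∈ W, φ w = 0) ∧ φ (v j) = 1 ∧ ∀ j', j' ≠ j → φ (v j') = 0 := by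
  classical
  obtain ⟨g, hg⟩ := LinearMap.exists_leftInverse_of_injective
    (Finsupp.linearCombination k fun j => W.mkQ (v j)) (LinearMap.ker_eq_bot.2 hv)
  have h1 : ∀ j, g (W.mkQ (v j)) = Finsupp.single j 1 := fun j => by
    have h := LinearMap.congr_fun hg (Finsupp.single j 1)
    simpa using h
  refine ⟨Finsupp.lapply j ∘ₗ g ∘ₗ W.mkQ, fun w hw => ?_, ?_, fun j' hj' => ?_⟩
  · simp [(Submodule.Quotient.mk_eq_zero W).2 hw]
  · simp only [LinearMap.comp_apply, h1]
    simp
  · simp only [LinearMap.comp_apply, h1]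
    simp [hj'.symm]

end DualFunctionals

/-! ### The coproduct and its right ideals as modules over a factor -/

section CoproductModule

universe u v w y

variable {k : Type u} [Field k] {I : Type w} {A : I → Type v} [∀ i, Ring (A i)]
  [∀ i, Algebra k (A i)] {E : Type y} [Ring E] [Algebra k E]
  {𝒜 : ∀ i, ℕ → Submodule k (A i)} [∀ i, GradedAlgebra (𝒜 i)]
  {ℰ : ℕ → Submodule k E} [GradedAlgebra ℰ] {f : ∀ i, A i →ₐ[k] E}

variable (𝒜 ℰ f) in
/-- The products of degree `n` of homogeneous elements of the right ideal `L` with homogeneous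
elements of positive degree of factors other than `A i`. -/
def outerProducts (L : Submodule Eᵐᵒᵖ E) (i : I) (n : ℕ) : Set E :=
  {y | ∃ j, j ≠ i ∧ ∃ p q, 0 < q ∧ p + q = n ∧ ∃ x ∈ L, x ∈ ℰ p ∧ ∃ a ∈ 𝒜 j q, y = x * f j a}

variable (𝒜 ℰ f) in
/-- The homogeneous elements of degree `n` of the span of `1` and of the products ending in a
factor other than `A i`. -/
def heads (i : I) (n : ℕ) : Submodule k E :=
  Submodule.span k ({x | n = 0 ∧ x = 1} ∪ outerProducts 𝒜 ℰ f ⊤ i n)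

theorem outerProducts_subset_heads {L : Submodule Eᵐᵒᵖ E} {i : I} {n : ℕ} :
    outerProducts 𝒜 ℰ f L i n ⊆ heads 𝒜 ℰ f i n := by
  rintro _ ⟨j, hj, p, q, hq, hn, x, -, hx, a, ha, rfl⟩
  exact Submodule.subset_span (Or.inr ⟨j, hj, p, q, hq, hn, x, trivial, hx, a, ha, rfl⟩)

theorem outerProducts_subset_ideal {L : Submodule Eᵐᵒᵖ E} {i : I} {n : ℕ} :
    outerProducts 𝒜 ℰ f L i n ⊆ L := by
  rintro _ ⟨j, -, p, q, -, -, x, hx, -, a, -, rfl⟩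
  exact L.smul_mem (op (f j a)) hx

namespace IsGradedCoproduct

theorem heads_le (H : IsGradedCoproduct 𝒜 ℰ f) (i : I) (n : ℕ) : heads 𝒜 ℰ f i n ≤ ℰ n := by
  rw [heads, Submodule.span_le]
  rintro _ (⟨rfl, rfl⟩ | ⟨j, -, p, q, -, rfl, x, -, hx, a, ha, rfl⟩)
  · exact SetLike.GradedOne.one_mem
  · exact SetLike.GradedMul.mul_mem hx (H.map_mem j q a ha)

/-- Last letters from `A i` are peeled off and collected on the right until `1` or a product ending
in another factor remains. -/
theorem le_span_heads (H : IsGradedCoproduct 𝒜 ℰ f) (i : I) (n : ℕ) :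
    ℰ n ≤ Submodule.span k {y | ∃ p q, p + q = n ∧
    ∃ v ∈ heads 𝒜 ℰ f i p, ∃ a ∈ 𝒜 i q, y = v * f i a} := by
  induction n using Nat.strong_induction_on with
  | _ n ih =>
    have hheads : ∀ v ∈ heads 𝒜 ℰ f i n, v ∈ Submodule.span k {y | ∃ p q, p + q = n ∧
        ∃ v ∈ heads 𝒜 ℰ f i p, ∃ a ∈ 𝒜 i q, y = v * f i a} := fun v hv =>
      Submodule.subset_span ⟨n, 0, rfl, v, hv, 1, SetLike.GradedOne.one_mem, by simp⟩
    rcases Nat.eq_zero_or_pos n with rfl | hn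
    · intro x hx
      obtain ⟨c, rfl, -⟩ := H.connected x hx
      rw [Algebra.algebraMap_eq_smul_one]
      exact Submodule.smul_mem _ _ (hheads 1 (Submodule.subset_span (Or.inl ⟨rfl, rfl⟩)))
    · refine (H.le_span n hn).trans (Submodule.span_le.2 ?_)
      rintro _ ⟨j, p, q, hq, hpq, x, hx, a, ha, rfl⟩
      by_cases hj : j = i
      · subst hj
        have h1 := ih p (by omega) hx
        clear hx
        induction h1 using Submodule.span_induction with
        | mem z hz =>
          obtain ⟨p', q', hp, v, hv, b, hb, rfl⟩ := hz
          refine Submodule.subset_span ⟨p', q' + q, by omega, v, hv, b * a,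
            SetLike.GradedMul.mul_mem hb ha, by rw [map_mul, mul_assoc]⟩
        | zero => rw [zero_mul]; exact zero_mem _
        | add z z' _ _ hz hz' => rw [add_mul]; exact add_mem hz hz'
        | smul c z _ hz => rw [smul_mul_assoc]; exact Submodule.smul_mem _ _ hz
      · exact hheads _ (outerProducts_subset_heads (L := ⊤)
          ⟨j, hj, p, q, hq, hpq, x, trivial, hx, a, ha, rfl⟩)

/-- Functionals dual to independent heads become `A i`-linear coordinates: this is how the freeness
of `E` over `A i` is used. -/
theorem exists_linearMap (H : IsGradedCoproduct 𝒜 ℰ f) {i : I} [Module (A i)ᵐᵒᵖ E]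
    (hact : ∀ (a : A i) (x : E), op a • x = x * f i a) (φ : E →ₗ[k] k) :
    ∃ T : E →ₗ[(A i)ᵐᵒᵖ] A i, (∀ n, ∀ v ∈ heads 𝒜 ℰ f i n, T v = algebraMap k (A i) (φ v)) ∧
      ∀ (c : k) x, T (c • x) = c • T x := by
  obtain ⟨T, h1, h2, h3⟩ := H.exists_functional i φ
  refine ⟨{ toFun := T, map_add' := map_add T, map_smul' := fun a x => ?_ }, fun n v hv => ?_,
    map_smul T⟩
  · induction a using MulOpposite.rec' with | _ a
    rw [hact, h1]
    rfl
  · change T v = _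
    induction hv using Submodule.span_induction with
    | mem v hv =>
      rcases hv with ⟨-, rfl⟩ | ⟨j, hj, p, q, hq, -, x, -, -, a, ha, rfl⟩
      · exact h2
      · exact h3 j hj x q hq a ha
    | zero => simp
    | add x y _ _ hx hy => rw [map_add, map_add, map_add, hx, hy]
    | smul c x _ hx => rw [map_smul, map_smul, hx, smul_eq_mul, map_mul, Algebra.smul_def]

variable {i : I} [Module (A i)ᵐᵒᵖ E] [IsScalarTower k (A i)ᵐᵒᵖ E]

/-- A right ideal `L` of the coproduct is, as an `A i`-module, the sum of the module generated by
the family `t` and of a free module, provided that `t` generates enough and lies in the module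
generated by the heads in `W`. -/
theorem torBound_homogeneousElements (H : IsGradedCoproduct 𝒜 ℰ f) [GradedRightModule (𝒜 i) ℰ]
    (hact : ∀ (a : A i) (x : E), op a • x = x * f i a)
    {L : Submodule Eᵐᵒᵖ E} {S : Set E} (hS : ∀ x ∈ S, ∃ n, x ∈ ℰ n)
    (hL : Submodule.span Eᵐᵒᵖ S = L) (W : Submodule k E) {κ : Type*} {t : κ → E} {e : κ → ℕ}
    (ht : ∀ j, t j ∈ ℰ (e j)) (htL : ∀ j, t j ∈ L)
    (hSt : S ⊆ Submodule.span (A i)ᵐᵒᵖ (Set.range t))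
    (hWt : ∀ w ∈ W, w ∈ Submodule.span k (⋃ n, outerProducts 𝒜 ℰ f L i n) →
      w ∈ Submodule.span (A i)ᵐᵒᵖ (Set.range t))
    (htW : ∀ j, t j ∈ Submodule.span (A i)ᵐᵒᵖ {v | v ∈ W ∧ ∃ n, v ∈ heads 𝒜 ℰ f i n})
    {N : ℕ∞} {c : Prop} (hT : TorBound (𝒜 i) N c t e) :
    TorBound (𝒜 i) N c (fun x : HomogeneousElements ℰ L => x.1.2) fun x => x.1.1 := by
  set D : Set E := ⋃ n, outerProducts 𝒜 ℰ f L i n with hD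
  -- The outer products of `L` that are independent modulo `W` will be the basis of the free
  -- summand.
  obtain ⟨J, σ, hσ, hspan, hli⟩ := exists_linearIndependent' k (fun x : D => W.mkQ (x : E))
  set v : J → E := fun j => (σ j : E) with hv
  have hvD : ∀ j, ∃ n, v j ∈ outerProducts 𝒜 ℰ f L i n := fun j => Set.mem_iUnion.1 (σ j).2
  choose g hg using hvD
  have hfree : ∀ m ∈ Submodule.span (A i)ᵐᵒᵖ (Set.range t), ∀ β : J →₀ A i,
      m + relMap (A i) v β = 0 → β = 0 := by
    intro m hm β hβ
    ext j
    -- The functional induced by `φ` kills the span of `t`, since `φ` vanishes on `W`, and reads off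
    -- the coefficient `β j`.
    obtain ⟨φ, hφW, hφj, hφj'⟩ := exists_dual_functionals W hli j
    obtain ⟨T, hT, -⟩ := H.exists_linearMap hact φ
    have hTm : T m = 0 := by
      refine SetLike.le_def.1 (Submodule.span_le (p := LinearMap.ker T).2 ?_) hm
      rintro _ ⟨l, rfl⟩
      refine SetLike.le_def.1 (Submodule.span_le (p := LinearMap.ker T).2 ?_) (htW l)
      rintro x ⟨hxW, n, hx⟩
      rw [SetLike.mem_coe, LinearMap.mem_ker, hT n x hx, hφW x hxW, map_zero]
    have hTv : ∀ j', T (v j') = algebraMap k (A i) (φ (v j')) := fun j' =>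
      hT _ _ (outerProducts_subset_heads (hg j'))
    have h1 := congrArg T hβ
    rw [map_add, hTm, zero_add, map_zero, relMap_apply, Finsupp.sum, map_sum,
      Finset.sum_eq_single j] at h1
    · rw [map_smul, hTv, hφj, map_one, op_smul_eq_mul, one_mul] at h1
      exact h1
    · intro j' _ hj'
      rw [map_smul, hTv, hφj' j' hj', map_zero, smul_zero]
    · intro hj
      rw [Finsupp.notMem_support_iff.1 hj, op_zero, zero_smul, map_zero]
  have hvdeg : ∀ j, v j ∈ ℰ (g j) := fun j => H.heads_le i _ (outerProducts_subset_heads (hg j))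
  have hvL : ∀ j, v j ∈ L := fun j => outerProducts_subset_ideal (hg j)
  set P := Submodule.span (A i)ᵐᵒᵖ (Set.range (Sum.elim t v)) with hP
  have htP : Submodule.span (A i)ᵐᵒᵖ (Set.range t) ≤ P := Submodule.span_mono (by
    rintro _ ⟨j, rfl⟩
    exact ⟨Sum.inl j, rfl⟩)
  have hDP : ∀ x ∈ D, x ∈ P := by
    intro x hx
    have h1 : W.mkQ x ∈ Submodule.span k (Set.range fun x : D => W.mkQ (x : E)) :=
      Submodule.subset_span ⟨⟨x, hx⟩, rfl⟩
    have h2 : Set.range ((fun x : D => W.mkQ (x : E)) ∘ σ) = W.mkQ '' Set.range v := by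
      rw [← Set.range_comp]; rfl
    rw [← hspan, h2, Submodule.span_image] at h1
    obtain ⟨z, hz, hzx⟩ := h1
    -- What the chosen outer products miss lies both in `W` and in the span of outer products, hence
    -- in the module generated by `t`.
    have hw : x - z ∈ W := by
      rw [← Submodule.Quotient.mk_eq_zero, Submodule.Quotient.mk_sub, sub_eq_zero]
      exact hzx.symm
    have hzD : z ∈ Submodule.span k D := Submodule.span_mono (by
      rintro _ ⟨j, rfl⟩
      exact (σ j).2) hz
    have hzP : z ∈ P := by
      refine (Submodule.span_le (p := P.restrictScalars k)).2 ?_ hz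
      rintro _ ⟨j, rfl⟩
      exact Submodule.subset_span ⟨Sum.inr j, rfl⟩
    have h3 := htP (hWt _ hw (sub_mem (Submodule.subset_span hx) hzD))
    rw [← sub_add_cancel x z]
    exact add_mem h3 hzP
  choose d hd using hS
  -- In a product `s y a` with `s` in `S` and `a` of positive degree in `A j`, either `j = i` and `s
  -- y` has smaller degree, or `s y a` is an outer product. Scalar multiples of `s` are covered by
  -- `t`.
  have hLP : ∀ n, ∀ l ∈ L, l ∈ ℰ n → l ∈ P := by
    intro n
    induction n using Nat.strong_induction_on with
    | _ n ih =>
      intro l hl hln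
      obtain ⟨x, hx, rfl⟩ := exists_relMap_eq (𝒜 := ℰ) (s := (Subtype.val : S → E))
        (e := fun x => d x x.2) (fun x => hd x x.2) (by rwa [Subtype.range_coe, hL]) hln
      rw [relMap_apply]
      refine Submodule.sum_mem _ fun s hs => ?_
      rcases (mem_freeGrading ℰ).1 hx s with h0 | ⟨m, hm, h0⟩
      · exact absurd h0 (Finsupp.mem_support_iff.1 hs)
      · have hsL : (s : E) ∈ L := by rw [← hL]; exact Submodule.subset_span s.2
        rcases Nat.eq_zero_or_pos m with rfl | hmpos
        · obtain ⟨c, hc, -⟩ := H.connected _ h0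
          change op (x s) • (s : E) ∈ P.restrictScalars k
          rw [← hc, op_algebraMap_smul]
          exact Submodule.smul_mem _ _ (htP (hSt s.2))
        · have h1 := H.le_span m hmpos h0
          clear h0
          change op (x s) • (s : E) ∈ P
          generalize x s = y at h1 ⊢
          induction h1 using Submodule.span_induction with
          | mem y hy =>
            obtain ⟨j, p, q, hq, hpq, y, hy, a, ha, rfl⟩ := hy
            have hsy : op y • (s : E) ∈ ℰ (d s s.2 + p) :=
              GradedRightModule.smul_mem hy (hd s s.2)
            have hsyL : op y • (s : E) ∈ L := L.smul_mem _ hsL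
            rw [op_mul, mul_smul]
            change (op y • (s : E)) * f j a ∈ P
            by_cases hj : j = i
            · subst hj
              rw [← hact]
              exact P.smul_mem _ (ih _ (by omega) _ hsyL hsy)
            · exact hDP _ (Set.mem_iUnion.2
                ⟨_, j, hj, _, q, hq, rfl, _, hsyL, hsy, a, ha, rfl⟩)
          | zero => rw [op_zero, zero_smul]; exact zero_mem _
          | add y z _ _ hy hz => rw [op_add, add_smul]; exact add_mem hy hz
          | smul b y _ hy =>
            rw [op_smul, smul_assoc]
            exact Submodule.smul_mem (P.restrictScalars k) _ hy
  refine (hT.sum_elim (g := g) hfree).of_span_eq (𝒱 := ℰ) ?_ (fun x => x.2.2) ?_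
  · rintro (j | j)
    · exact ht j
    · exact hvdeg j
  · refine le_antisymm (Submodule.span_le.2 ?_) (Submodule.span_le.2 ?_)
    · rintro _ ⟨(j | j), rfl⟩
      · exact Submodule.subset_span ⟨⟨(e j, t j), htL j, ht j⟩, rfl⟩
      · exact Submodule.subset_span ⟨⟨(g j, v j), hvL j, hvdeg j⟩, rfl⟩
    · rintro _ ⟨x, rfl⟩
      exact hLP _ _ x.2.1 x.2.2

/-- Jointly injective homogeneous functionals on the module generated by finitely many heads. -/
theorem exists_functionals (H : IsGradedCoproduct 𝒜 ℰ f)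
    (hact : ∀ (a : A i) (x : E), op a • x = x * f i a) {Y : Set E}
    (hfin : Y.Finite) (hY : ∀ x ∈ Y, ∃ n, x ∈ heads 𝒜 ℰ f i n) :
    ∃ (r : ℕ) (T : Fin r → E →ₗ[(A i)ᵐᵒᵖ] A i) (g : Fin r → ℕ),
      (∀ l n, ∀ x ∈ ℰ n, T l x = 0 ∨ ∃ m, g l + m = n ∧ T l x ∈ 𝒜 i m) ∧
      ∀ x ∈ Submodule.span (A i)ᵐᵒᵖ Y, (∀ l, T l x = 0) → x = 0 := by
  classical
  obtain ⟨J, σ, hσ, hspan, hli⟩ :=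
    exists_linearIndependent' k (fun x : Y => (⊥ : Submodule k E).mkQ (x : E))
  have := hfin.to_subtype
  have hJ : Finite J := Finite.of_injective σ hσ
  obtain ⟨r, ⟨τ⟩⟩ := Finite.exists_equiv_fin J
  have hli' := hli.comp _ τ.symm.injective
  set b : Fin r → E := fun l => (σ (τ.symm l) : E) with hb
  choose g hg using fun l => hY (b l) (σ (τ.symm l)).2
  have hφ : ∀ l, ∃ φ : E →ₗ[k] k, φ (b l) = 1 ∧ (∀ l', l' ≠ l → φ (b l') = 0) ∧
      ∀ n, n ≠ g l → ∀ x ∈ ℰ n, φ x = 0 := by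
    intro l
    obtain ⟨φ, -, h1, h2⟩ := exists_dual_functionals (⊥ : Submodule k E) (v := b) hli' l
    -- Composing with a homogeneous component makes the functional homogeneous without changing its
    -- values on the `b l'`.
    refine ⟨φ ∘ₗ component ℰ (g l), ?_, fun l' hl' => ?_, fun n hn x hx => ?_⟩
    · rw [LinearMap.comp_apply, component_same (H.heads_le i _ (hg l)), h1]
    · rw [LinearMap.comp_apply]
      by_cases hgl : g l' = g l
      · rw [← hgl, component_same (H.heads_le i _ (hg l')), h2 l' hl']
      · rw [component_ne (H.heads_le i _ (hg l')) hgl, map_zero]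
    · rw [LinearMap.comp_apply, component_ne hx hn, map_zero]
  choose φ hφ1 hφ2 hφ3 using hφ
  choose T hT hTk using fun l => H.exists_linearMap hact (φ l)
  refine ⟨r, T, g, fun l n x hx => ?_, fun x hx hx0 => ?_⟩
  · have key : T l x ∈ (if g l ≤ n then 𝒜 i (n - g l) else ⊥ : Submodule k (A i)) := by
      have h1 := H.le_span_heads i n hx
      clear hx
      induction h1 using Submodule.span_induction with
      | mem z hz =>
        obtain ⟨p, q, hpq, v, hv, a, ha, rfl⟩ := hz
        rw [← hact, map_smul, hT l p v hv, op_smul_eq_mul]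
        by_cases hp : p = g l
        · rw [if_pos (by omega), ← Algebra.smul_def]
          have hq : n - g l = q := by omega
          rw [hq]
          exact Submodule.smul_mem _ _ ha
        · rw [hφ3 l p hp v (H.heads_le i p hv), map_zero, zero_mul]
          exact zero_mem _
      | zero => rw [map_zero]; exact zero_mem _
      | add z z' _ _ hz hz' => rw [map_add]; exact add_mem hz hz'
      | smul c z _ hz => rw [hTk]; exact Submodule.smul_mem _ _ hz
    split_ifs at key with h
    · exact Or.inr ⟨n - g l, by omega, key⟩
    · exact Or.inl key
  -- The independent heads `b` span all of `Y`, and the functionals read off the coefficients at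
  -- `b`.
  · have hYb : Submodule.span (A i)ᵐᵒᵖ Y ≤ Submodule.span (A i)ᵐᵒᵖ (Set.range b) := by
      rw [Submodule.span_le]
      intro y hy
      have h1 : (⊥ : Submodule k E).mkQ y ∈
          Submodule.span k (Set.range fun x : Y => (⊥ : Submodule k E).mkQ (x : E)) :=
        Submodule.subset_span ⟨⟨y, hy⟩, rfl⟩
      have h2 : Set.range ((fun x : Y => (⊥ : Submodule k E).mkQ (x : E)) ∘ σ) =
          (⊥ : Submodule k E).mkQ '' Set.range b := by
        rw [← Set.range_comp, ← τ.symm.surjective.range_comp]; rfl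
      rw [← hspan, h2, Submodule.span_image, ← Submodule.mem_comap, Submodule.comap_map_mkQ,
        bot_sup_eq] at h1
      refine (Submodule.span_le
        (p := (Submodule.span (A i)ᵐᵒᵖ (Set.range b)).restrictScalars k)).2 ?_ h1
      exact Submodule.subset_span
    have hx' := hYb hx
    rw [← range_relMap] at hx'
    obtain ⟨z, rfl⟩ := hx'
    suffices z = 0 by rw [this, map_zero]
    ext l
    have h1 := hx0 l
    rw [relMap_apply, Finsupp.sum, map_sum, Finset.sum_eq_single l] at h1
    · rw [map_smul, hT l _ _ (hg l), hφ1, map_one, op_smul_eq_mul, one_mul] at h1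
      exact h1
    · intro l' _ hl'
      rw [map_smul, hT l _ _ (hg l'), hφ2 l l' hl', map_zero, smul_zero]
    · intro hl
      rw [Finsupp.notMem_support_iff.1 hl, op_zero, zero_smul, map_zero]

/-- (Effective) coherence of the factor bounds the Tor of the families in the module generated by
finitely many heads. -/
theorem exists_torBound (H : IsGradedCoproduct 𝒜 ℰ f) [GradedRightModule (𝒜 i) ℰ]
    (hconn : Connected (𝒜 i))
    (hact : ∀ (a : A i) (x : E), op a • x = x * f i a) {c : Prop}
    (hA : UniformlyCoherent.{u, v, max v y} (𝒜 i) c) {Y : Set E}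
    (hfin : Y.Finite) (hY : ∀ x ∈ Y, ∃ n, x ∈ heads 𝒜 ℰ f i n) {N : ℕ∞} (hN : c ∨ N ≠ ⊤) :
    ∃ N' : ℕ∞, (c ∨ N' ≠ ⊤) ∧ ∀ {κ : Type y} {t : κ → E} {e : κ → ℕ},
      (∀ j, t j ∈ ℰ (e j)) → (∀ j, (e j : ℕ∞) ≤ N) → (c → Finite κ) →
      (∀ j, t j ∈ Submodule.span (A i)ᵐᵒᵖ Y) → TorBound (𝒜 i) N' c t e := by
  obtain ⟨r, T, g, hT, hinj⟩ := H.exists_functionals hact hfin hY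
  obtain ⟨N', hN', hb⟩ := UniformlyCoherent.of_functionals.{u, v, y, y} (𝒱 := ℰ) hA r T g hT N hN
  refine ⟨N', hN', fun {κ t e} ht hd hκ htY => ?_⟩
  refine torBound_of_forall_relationBound (𝒱 := ℰ) hconn ht fun S σ hσ => ?_
  -- The subfamily is lifted to the universe required by the transfer lemma.
  refine RelationBound.of_equiv (Equiv.ulift.{v}) ?_
  refine hb (ULift.{v} S) _ _ (fun x => ?_) (fun x => hd _) (fun h => ?_) fun x hx => hinj x ?_
  · have h := ht (σ x.down)
    rwa [hσ] at h
  · have := hκ h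
    have hσinj : Function.Injective σ := fun x y hxy => Subtype.ext (by rw [← hσ, hxy, hσ])
    have := Finite.of_injective σ hσinj
    infer_instance
  · refine SetLike.le_def.1 (Submodule.span_le.2 ?_) hx
    rintro _ ⟨x, rfl⟩
    change ((x.down : S) : E) ∈ _
    rw [← hσ]
    exact htY _

end IsGradedCoproduct

end CoproductModule

/-! ### Degree bounds and coherence of a coproduct -/

section CoproductCoherence

universe u v w y

variable {k : Type u} [Field k] {I : Type w} {A : I → Type v} [∀ i, Ring (A i)]
  [∀ i, Algebra k (A i)] {E : Type y} [Ring E] [Algebra k E]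
  {𝒜 : ∀ i, ℕ → Submodule k (A i)} [∀ i, GradedAlgebra (𝒜 i)]
  {ℰ : ℕ → Submodule k E} [GradedAlgebra ℰ] {f : ∀ i, A i →ₐ[k] E}

namespace IsGradedCoproduct

variable [∀ i, Module (A i)ᵐᵒᵖ E]

theorem isScalarTower (hact : ∀ i (a : A i) (x : E), op a • x = x * f i a) (i : I) : IsScalarTower k (A i)ᵐᵒᵖ E where
  smul_assoc c a x := by
    induction a using MulOpposite.rec' with | _ a
    rw [← op_smul, hact, hact, map_smul, mul_smul_comm]

theorem gradedRightModule (H : IsGradedCoproduct 𝒜 ℰ f)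
    (hact : ∀ i (a : A i) (x : E), op a • x = x * f i a) (i : I) : GradedRightModule (𝒜 i) ℰ where
  smul_mem ha hx := by
    rw [hact]
    exact SetLike.GradedMul.mul_mem hx (H.map_mem i _ _ ha)

theorem mem_span_of_heads (H : IsGradedCoproduct 𝒜 ℰ f)
    (hact : ∀ i (a : A i) (x : E), op a • x = x * f i a) (i : I) [IsScalarTower k (A i)ᵐᵒᵖ E] {n : ℕ} {x : E} (hx : x ∈ ℰ n)
    {P : Submodule (A i)ᵐᵒᵖ E} (hP : ∀ p ≤ n, ∀ v ∈ heads 𝒜 ℰ f i p, v ∈ P) : x ∈ P := by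
  refine (Submodule.span_le (p := P.restrictScalars k)).2 ?_ (H.le_span_heads i n hx)
  rintro _ ⟨p, q, hpq, v, hv, a, -, rfl⟩
  rw [← hact]
  exact P.smul_mem _ (hP p (by omega) v hv)

/-- The Tor of a family of elements of degree at most `d` of the coproduct is bounded by the
functions of the modules over the factors generated by the elements of degree at most `d`. -/
theorem torBound_of_degreeBound_factors (H : IsGradedCoproduct 𝒜 ℰ f)
    (hconn : ∀ i, Connected (𝒜 i))
    (hact : ∀ i (a : A i) (x : E), op a • x = x * f i a) {d : ℕ} {N : ℕ∞}
    (hN : ∀ i, degreeBound (𝒜 i) ℰ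
      (Submodule.span (A i)ᵐᵒᵖ {x : E | ∃ n ≤ d, x ∈ ℰ n}) d ≤ N)
    {S : Set E} {e : S → ℕ} (hS : ∀ s : S, (s : E) ∈ ℰ (e s)) (hd : ∀ s, e s ≤ d) :
    TorBound ℰ N False (Subtype.val : S → E) e := by
  set L := Submodule.span Eᵐᵒᵖ S with hL
  refine TorBound.of_span_eq (𝒱 := ℰ) (fun x => x.2.2) hS ?_
    (H.torBound hact (L := L) False.elim fun i => ?_)
  · rw [Subtype.range_coe]
    refine le_antisymm (Submodule.span_le.2 ?_) (Submodule.span_le.2 fun s hs => ?_)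
    · rintro _ ⟨x, rfl⟩
      exact x.2.1
    · exact Submodule.subset_span ⟨⟨(e ⟨s, hs⟩, s), Submodule.subset_span hs, hS ⟨s, hs⟩⟩, rfl⟩
  have := isScalarTower hact i
  have := gradedRightModule H hact i
  -- The small part: `W` is `E` in degrees at most `d`, and `t` lists all homogeneous elements of
  -- `L` of degree at most `d`. An element of `W` spanned by outer products of `L` has its nonzero
  -- components among them.
  set W : Submodule k E := Submodule.span k {x : E | ∃ n ≤ d, x ∈ ℰ n} with hW
  refine H.torBound_homogeneousElements (hact i) (S := S) (fun x hx => ⟨_, hS ⟨x, hx⟩⟩) rfl W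
    (t := fun x : {x : HomogeneousElements ℰ L // x.1.1 ≤ d} => x.1.1.2) (e := fun x => x.1.1.1)
    (fun x => x.1.2.2) (fun x => x.1.2.1) ?_ ?_ ?_ ?_
  · intro s hs
    exact Submodule.subset_span
      ⟨⟨⟨(e ⟨s, hs⟩, s), Submodule.subset_span hs, hS ⟨s, hs⟩⟩, hd ⟨s, hs⟩⟩, rfl⟩
  · intro w hw hwD
    refine mem_of_component_mem (𝒱 := ℰ) fun n => ?_
    by_cases hn : n ≤ d
    · refine Submodule.subset_span ⟨⟨⟨(n, component ℰ n w), ?_, component_mem ℰ n w⟩, hn⟩, rfl⟩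
      have h1 := component_mem_span (𝒱 := ℰ) ?_ hwD n
      · refine (Submodule.span_le (p := L.restrictScalars k)).2 ?_ h1
        rintro y ⟨hy, -⟩
        obtain ⟨m, hm⟩ := Set.mem_iUnion.1 hy
        exact outerProducts_subset_ideal hm
      · intro y hy
        obtain ⟨m, hm⟩ := Set.mem_iUnion.1 hy
        exact ⟨m, H.heads_le i m (outerProducts_subset_heads hm)⟩
    · have h1 : W ≤ LinearMap.ker (component ℰ n) := by
        rw [hW, Submodule.span_le]
        rintro x ⟨m, hm, hx⟩
        exact component_ne hx (by omega)
      rw [LinearMap.mem_ker.1 (h1 hw)]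
      exact zero_mem _
  · intro x
    refine mem_span_of_heads H hact i x.1.2.2 fun p hp v hv => Submodule.subset_span
      ⟨Submodule.subset_span ⟨p, hp.trans x.2, H.heads_le i p hv⟩, p, hv⟩
  · exact torBound_of_degreeBound_le (hconn i) (hN i) (fun x => x.1.2.2) (fun x => x.2)
      fun x => Submodule.subset_span ⟨_, x.2, x.1.2.2⟩

theorem algebraDegreeBound_le (H : IsGradedCoproduct 𝒜 ℰ f)
    (hconn : ∀ i, Connected (𝒜 i))
    (hact : ∀ i (a : A i) (x : E), op a • x = x * f i a) {d : ℕ} {N : ℕ∞}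
    (hN : ∀ i, degreeBound (𝒜 i) ℰ
      (Submodule.span (A i)ᵐᵒᵖ {x : E | ∃ n ≤ d, x ∈ ℰ n}) d ≤ N) :
    algebraDegreeBound ℰ d ≤ N :=
  degreeBound_le_of_torBound H.connected fun _ _ hS hd _ =>
    H.torBound_of_degreeBound_factors hconn hact hN hS hd

/-- With finite-dimensional components, finitely many heads generate `E_{≤d}` over `A i`, so
coherence transfers from `A i`. -/
theorem degreeBound_ne_top (H : IsGradedCoproduct 𝒜 ℰ f)
    (hconn : ∀ i, Connected (𝒜 i))
    (hact : ∀ i (a : A i) (x : E), op a • x = x * f i a) (hE : ∀ n, FiniteDimensional k (ℰ n)) {i : I}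
    (hA : EffectivelyCoherent (𝒜 i)) (d : ℕ) :
    degreeBound (𝒜 i) ℰ (Submodule.span (A i)ᵐᵒᵖ {x : E | ∃ n ≤ d, x ∈ ℰ n}) d ≠ ⊤ := by
  have := isScalarTower hact i
  have := gradedRightModule H hact i
  have hfg : ∀ p, ∃ Y : Finset E, Submodule.span k (Y : Set E) = heads 𝒜 ℰ f i p := fun p =>
    Submodule.fg_def.1 (Module.Finite.iff_fg.1
      (Submodule.finiteDimensional_of_le (H.heads_le i p))) |>.elim fun Y hY =>
        ⟨hY.1.toFinset, by simpa using hY.2⟩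
  choose Y hY using hfg
  obtain ⟨N', hN', hb⟩ := H.exists_torBound (hconn i) (hact i)
    (hA.uniformlyCoherent (hconn i)) (Y := ⋃ p ∈ Finset.range (d + 1), (Y p : Set E))
    (Set.Finite.biUnion (Finset.finite_toSet _) fun p _ => (Y p).finite_toSet)
    (fun x hx => by
      simp only [Set.mem_iUnion] at hx
      obtain ⟨p, -, hx⟩ := hx
      exact ⟨p, by rw [← hY p]; exact Submodule.subset_span hx⟩)
    (N := d) (Or.inr (ENat.natCast_ne_top d))
  refine ne_top_of_le_ne_top (hN'.resolve_left id) (degreeBound_le_of_torBound (hconn i)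
    fun S e hS hd hSM => hb hS (fun s => by exact_mod_cast hd s) False.elim fun s => ?_)
  refine SetLike.le_def.1 (Submodule.span_le.2 ?_) (hSM s.2)
  rintro x ⟨n, hn, hx⟩
  refine mem_span_of_heads H hact i hx fun p hp v hv => ?_
  rw [← hY p] at hv
  refine (Submodule.span_le (p := Submodule.restrictScalars k (Submodule.span (A i)ᵐᵒᵖ
    (⋃ p ∈ Finset.range (d + 1), (Y p : Set E))))).2 (fun y hy => Submodule.subset_span ?_) hv
  exact Set.mem_biUnion (Finset.mem_range.2 (by omega)) hy

theorem effectivelyCoherent (H : IsGradedCoproduct 𝒜 ℰ f)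
    (hconn : ∀ i, Connected (𝒜 i))
    (hact : ∀ i (a : A i) (x : E), op a • x = x * f i a) [Finite I] (hE : ∀ n, FiniteDimensional k (ℰ n))
    (hA : ∀ i, EffectivelyCoherent (𝒜 i)) : EffectivelyCoherent ℰ := by
  intro d _
  have h := fun i => H.degreeBound_ne_top hconn hact hE (hA i) d
  have := Fintype.ofFinite I
  refine ne_top_of_le_ne_top ?_ (H.algebraDegreeBound_le hconn hact
    (N := Finset.univ.sup fun i => degreeBound (𝒜 i) ℰ
      (Submodule.span (A i)ᵐᵒᵖ {x : E | ∃ n ≤ d, x ∈ ℰ n}) d) fun i =>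
        Finset.le_sup (f := fun i => degreeBound (𝒜 i) ℰ
      (Submodule.span (A i)ᵐᵒᵖ {x : E | ∃ n ≤ d, x ∈ ℰ n}) d) (Finset.mem_univ i))
  refine ne_of_lt ((Finset.sup_lt_iff (by simp)).2 fun i _ => lt_top_iff_ne_top.2 (h i))

/-- The components of `E` may be infinite-dimensional here, so the small part is built not from a
degree bound but from finitely many heads that express the given generators. -/
theorem coherent (H : IsGradedCoproduct 𝒜 ℰ f)
    (hconn : ∀ i, Connected (𝒜 i))
    (hact : ∀ i (a : A i) (x : E), op a • x = x * f i a) [Finite I] (hA : ∀ i, Coherent (𝒜 i)) : Coherent ℰ := by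
  classical
  refine coherent_of_torBound H.connected fun S e hS => ?_
  set L := Submodule.span Eᵐᵒᵖ (S : Set E) with hL
  have hcanon : TorBound ℰ ⊤ True (fun x : HomogeneousElements ℰ L => x.1.2) fun x => x.1.1 := by
    refine H.torBound hact (fun _ => inferInstance) fun i => ?_
    have := isScalarTower hact i
    have := gradedRightModule H hact i
    set D : Set E := ⋃ n, outerProducts 𝒜 ℰ f L i n with hD
    have hDhom : ∀ x ∈ D, ∃ n, x ∈ ℰ n := fun x hx => by
      obtain ⟨m, hm⟩ := Set.mem_iUnion.1 hx
      exact ⟨m, H.heads_le i m (outerProducts_subset_heads hm)⟩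
    have hY : ∀ s : S, ∃ Y : Finset E, (Y : Set E) ⊆ {v | ∃ n, v ∈ heads 𝒜 ℰ f i n} ∧
        (s : E) ∈ Submodule.span (A i)ᵐᵒᵖ (Y : Set E) := fun s =>
      Submodule.mem_span_finite_of_mem_span
        (mem_span_of_heads H hact i (hS s) fun p _ v hv => Submodule.subset_span ⟨p, hv⟩)
    choose Y hYheads hYspan using hY
    set Z : Set E := ⋃ s, (Y s : Set E) with hZ
    have hZfin : Z.Finite := Set.finite_iUnion fun s => (Y s).finite_toSet
    have hZheads : ∀ x ∈ Z, ∃ n, x ∈ heads 𝒜 ℰ f i n := fun x hx => by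
      obtain ⟨s, hs⟩ := Set.mem_iUnion.1 hx
      exact hYheads s hs
    set W : Submodule k E := Submodule.span k Z with hW
    -- The part of `W` hit by outer products of `L`. Being finite-dimensional and graded, it is
    -- spanned by a finite homogeneous set `G`; the small part of `L` is generated by `S ∪ G`.
    set X : Submodule k E := W ⊓ Submodule.span k D with hX
    have hXhom : Submodule.span k {x | x ∈ X ∧ ∃ n, x ∈ ℰ n} = X := by
      refine le_antisymm (Submodule.span_le.2 fun x hx => hx.1) fun x hx => ?_
      refine mem_of_component_mem (𝒱 := ℰ) fun n => Submodule.subset_span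
        ⟨⟨?_, ?_⟩, n, component_mem ℰ n x⟩
      · refine Submodule.span_mono (fun y hy => hy.1) (component_mem_span (𝒱 := ℰ) ?_ hx.1 n)
        exact fun y hy => (hZheads y hy).imp fun n hn => H.heads_le i n hn
      · exact Submodule.span_mono (fun y hy => hy.1) (component_mem_span (𝒱 := ℰ) hDhom hx.2 n)
    have hXfg : X.FG := by
      have : FiniteDimensional k W := FiniteDimensional.span_of_finite k hZfin
      exact Module.Finite.iff_fg.1 (Submodule.finiteDimensional_of_le inf_le_left)
    rw [← hXhom, Submodule.fg_span_iff_fg_span_finset_subset, hXhom] at hXfg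
    obtain ⟨G, hG, hGX⟩ := hXfg
    have hthom : ∀ x : ((S : Set E) ∪ (G : Set E) : Set E), ∃ n, (x : E) ∈ ℰ n := by
      rintro ⟨x, hx | hx⟩
      · exact ⟨_, hS ⟨x, hx⟩⟩
      · exact (hG hx).2
    choose g hg using hthom
    have hZspan : ∀ x : ((S : Set E) ∪ (G : Set E) : Set E),
        (x : E) ∈ Submodule.span (A i)ᵐᵒᵖ Z := by
      rintro ⟨x, hx | hx⟩
      · exact Submodule.span_mono (Set.subset_iUnion (fun s => (Y s : Set E)) ⟨x, hx⟩)
          (hYspan ⟨x, hx⟩)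
      · exact (Submodule.span_le (p := (Submodule.span (A i)ᵐᵒᵖ Z).restrictScalars k)).2
          Submodule.subset_span (hG hx).1.1
    refine H.torBound_homogeneousElements (hact i) (S := (S : Set E))
      (fun x hx => ⟨_, hS ⟨x, hx⟩⟩) rfl W
      (t := (Subtype.val : ((S : Set E) ∪ (G : Set E) : Set E) → E)) (e := g) hg ?_ ?_ ?_ ?_ ?_
    · rintro ⟨x, hx | hx⟩
      · exact Submodule.subset_span hx
      · refine (Submodule.span_le (p := L.restrictScalars k)).2 ?_ (hG hx).1.2
        intro y hy
        obtain ⟨m, hm⟩ := Set.mem_iUnion.1 hy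
        exact outerProducts_subset_ideal hm
    · rw [Subtype.range_coe]
      exact Set.subset_union_left.trans Submodule.subset_span
    · intro w hw hwD
      have h1 : w ∈ X := ⟨hw, hwD⟩
      rw [hGX] at h1
      rw [Subtype.range_coe]
      refine (Submodule.span_le (p := (Submodule.span (A i)ᵐᵒᵖ
        ((S : Set E) ∪ (G : Set E))).restrictScalars k)).2 (fun y hy => ?_) h1
      exact Submodule.subset_span (Or.inr hy)
    · intro x
      have hZW : Z ⊆ {v | v ∈ W ∧ ∃ n, v ∈ heads 𝒜 ℰ f i n} := fun v hv =>
        ⟨Submodule.subset_span hv, hZheads v hv⟩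
      exact Submodule.span_mono hZW (hZspan x)
    · obtain ⟨N', -, hb⟩ := H.exists_torBound (hconn i) (hact i) (hA i).uniformlyCoherent hZfin
        hZheads (N := ⊤) (Or.inl trivial)
      have h1 := hb hg (fun _ => le_top)
        (fun _ => (S.finite_toSet.union G.finite_toSet).to_subtype) hZspan
      exact h1.mono le_top
  refine hcanon.of_span_eq (𝒱 := ℰ) (fun x => x.2.2) hS ?_
  rw [Subtype.range_coe]
  refine le_antisymm (Submodule.span_le.2 ?_) (Submodule.span_le.2 fun s hs => ?_)
  · rintro _ ⟨x, rfl⟩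
    exact x.2.1
  · exact Submodule.subset_span ⟨⟨(e ⟨s, hs⟩, s), Submodule.subset_span hs, hS ⟨s, hs⟩⟩, rfl⟩

end IsGradedCoproduct

end CoproductCoherence

/-! ### Finitely generated connected algebras -/

section FiniteType

variable {k : Type*} [Field k] {A : Type*} [Ring A] [Algebra k A] {𝒜 : ℕ → Submodule k A}
  [GradedAlgebra 𝒜]

theorem mul_mem_positiveIdeal {a b : A} (ha : a ∈ positiveIdeal 𝒜) : b * a ∈ positiveIdeal 𝒜 := by
  induction ha using Submodule.span_induction with
  | mem a ha =>
    obtain ⟨n, hn, ha⟩ := ha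
    induction b using DirectSum.Decomposition.inductionOn 𝒜 with
    | zero => rw [zero_mul]; exact zero_mem _
    | @homogeneous m b =>
      exact Submodule.subset_span ⟨m + n, by omega, SetLike.GradedMul.mul_mem b.2 ha⟩
    | add b b' hb hb' => rw [add_mul]; exact add_mem hb hb'
  | zero => rw [mul_zero]; exact zero_mem _
  | add x y _ _ hx hy => rw [mul_add]; exact add_mem hx hy
  | smul c x _ hx => rw [mul_smul_comm]; exact Submodule.smul_mem _ _ hx

theorem Connected.positiveIdeal_augmentation (hconn : Connected 𝒜) {a : A}
    (ha : a ∈ positiveIdeal 𝒜) : hconn.augmentation a = 0 := by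
  induction ha using Submodule.span_induction with
  | mem a ha =>
    obtain ⟨n, hn, ha⟩ := ha
    exact hconn.augmentation_eq_zero hn ha
  | zero => exact map_zero _
  | add x y _ _ hx hy => rw [map_add, hx, hy, add_zero]
  | smul c x _ hx =>
    induction c using MulOpposite.rec' with | _ c
    rw [op_smul_eq_mul, map_mul, hx, zero_mul]

/-- The positive ideal is generated by elements of positive degree at most the generator degree. -/
theorem Connected.exists_generators (hconn : Connected 𝒜) : ∃ G : Set A,
    (∀ g ∈ G, ∃ j : ℕ, 0 < j ∧ (j : ℕ∞) ≤ generatorDegree 𝒜 ∧ g ∈ 𝒜 j) ∧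
    Submodule.span Aᵐᵒᵖ G = positiveIdeal 𝒜 := by
  refine ⟨{g | ∃ j : ℕ, 0 < j ∧ (j : ℕ∞) ≤ generatorDegree 𝒜 ∧ g ∈ 𝒜 j}, fun g hg => hg,
    le_antisymm (Submodule.span_mono fun g hg => ?_) ?_⟩
  · obtain ⟨j, hj, -, hg⟩ := hg
    exact ⟨j, hj, hg⟩
  · generalize h : generatorDegree 𝒜 = N
    induction N using ENat.recTopCoe with
    | top =>
      refine Submodule.span_mono fun g hg => ?_
      obtain ⟨j, hj, hg⟩ := hg
      exact ⟨j, hj, le_top, hg⟩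
    | coe d =>
      have hgen : GeneratedInDegreeLE 𝒜 (positiveIdeal 𝒜) d := m₀_le_iff.1 h.le
      rw [← hgen, Submodule.span_le]
      rintro x ⟨hx, n, hn, hxn⟩
      -- In degree zero the ideal contains only `0`: its elements are scalars with zero
      -- augmentation.
      rcases Nat.eq_zero_or_pos n with rfl | hpos
      · have h1 := hconn.algebraMap_augmentation x
        rw [hconn.positiveIdeal_augmentation hx, map_zero, component_same hxn] at h1
        rw [← h1]
        exact zero_mem _
      · exact Submodule.subset_span ⟨n, hpos, by exact_mod_cast hn, hxn⟩

/-- A finitely generated connected algebra has finitely many homogeneous generators of positive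
degree, which also generate the positive ideal. -/
theorem Connected.exists_finite_generators (hconn : Connected 𝒜) (h : Algebra.FiniteType k A) :
    ∃ G : Set A, G.Finite ∧ (∀ g ∈ G, ∃ j : ℕ, 0 < j ∧ g ∈ 𝒜 j) ∧
      Submodule.span Aᵐᵒᵖ G = positiveIdeal 𝒜 := by
  classical
  obtain ⟨X, hX⟩ := h.out
  set G : Set A := ⋃ x ∈ X, (fun n => component 𝒜 n x) ''
    ((DirectSum.decompose 𝒜 x).support.erase 0 : Finset ℕ) with hG
  have hGpos : ∀ g ∈ G, ∃ j : ℕ, 0 < j ∧ g ∈ 𝒜 j := by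
    intro g hg
    simp only [hG, Set.mem_iUnion] at hg
    obtain ⟨x, -, n, hn, rfl⟩ := hg
    exact ⟨n, Nat.pos_of_ne_zero (Finset.ne_of_mem_erase hn), component_mem 𝒜 n x⟩
  refine ⟨G, Set.Finite.biUnion X.finite_toSet fun x _ => (Finset.finite_toSet _).image _, hGpos,
    le_antisymm (Submodule.span_mono hGpos) ?_⟩
  have key : ∀ a, a - algebraMap k A (hconn.augmentation a) ∈ Submodule.span Aᵐᵒᵖ G := by
    intro a
    have ha : a ∈ Algebra.adjoin k (X : Set A) := by rw [hX]; exact Algebra.mem_top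
    induction ha using Algebra.adjoin_induction with
    | mem x hx =>
      have h1 : x - algebraMap k A (hconn.augmentation x) =
          ∑ n ∈ (DirectSum.decompose 𝒜 x).support.erase 0, component 𝒜 n x := by
        rw [hconn.algebraMap_augmentation, sub_eq_iff_eq_add]
        by_cases h0 : 0 ∈ (DirectSum.decompose 𝒜 x).support
        · rw [Finset.sum_erase_add _ _ h0]
          exact (DirectSum.sum_support_decompose 𝒜 x).symm
        · rw [Finset.erase_eq_of_notMem h0, component_apply]
          rw [DFinsupp.notMem_support_iff] at h0
          rw [h0, ZeroMemClass.coe_zero, add_zero]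
          exact (DirectSum.sum_support_decompose 𝒜 x).symm
      rw [h1]
      refine Submodule.sum_mem _ fun n hn => Submodule.subset_span ?_
      simp only [hG, Set.mem_iUnion]
      exact ⟨x, hx, n, hn, rfl⟩
    | algebraMap c => rw [AlgHom.commutes]; simp
    | add x y _ _ hx hy =>
      rw [map_add, map_add, add_sub_add_comm]
      exact add_mem hx hy
    | mul x y _ _ hx hy =>
      -- A Leibniz rule for `x ↦ x - ε(x)`, both terms of which stay in the right ideal.
      have h1 : x * y - algebraMap k A (hconn.augmentation (x * y)) =
          op y • (x - algebraMap k A (hconn.augmentation x)) +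
            hconn.augmentation x • (y - algebraMap k A (hconn.augmentation y)) := by
        rw [op_smul_eq_mul, Algebra.smul_def, map_mul, map_mul]
        noncomm_ring
      rw [h1]
      exact add_mem (Submodule.smul_mem _ _ hx)
        (Submodule.smul_mem ((Submodule.span Aᵐᵒᵖ G).restrictScalars k) _ hy)
  rw [positiveIdeal, Submodule.span_le]
  rintro a ⟨n, hn, ha⟩
  have h1 := key a
  rwa [hconn.augmentation_eq_zero hn ha, map_zero, sub_zero] at h1

theorem Connected.generatorDegree_ne_top (hconn : Connected 𝒜) (h : Algebra.FiniteType k A) :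
    generatorDegree 𝒜 ≠ ⊤ := by
  obtain ⟨G, hfin, hpos, hspan⟩ := hconn.exists_finite_generators h
  choose! d hd hG using hpos
  have := hfin.fintype
  refine ne_top_of_le_ne_top (ENat.natCast_ne_top (hfin.toFinset.sup d)) ?_
  rw [generatorDegree, ← hspan]
  have h1 := m₀_span_le (A := A) (𝒱 := 𝒜) (s := (Subtype.val : G → A)) (e := fun g => d g)
    (fun g => hG g g.2) (d := hfin.toFinset.sup d)
    (fun g => Finset.le_sup (f := d) (hfin.mem_toFinset.2 g.2))
  rwa [Subtype.range_coe] at h1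

/-- In positive degree, the component is the sum of the `g * 𝒜 (n - deg g)` over finitely many
generators `g` of positive degree; induction on `n`. -/
theorem Connected.finiteDimensional (hconn : Connected 𝒜) (h : Algebra.FiniteType k A) (n : ℕ) :
    FiniteDimensional k (𝒜 n) := by
  obtain ⟨G, hfin, hpos, hspan⟩ := hconn.exists_finite_generators h
  choose! d hd hG using hpos
  induction n using Nat.strong_induction_on with
  | _ n ih =>
    rcases Nat.eq_zero_or_pos n with rfl | hn
    · have : FiniteDimensional k (Submodule.span k {(1 : A)}) :=
        FiniteDimensional.span_of_finite k (Set.finite_singleton 1)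
      refine Submodule.finiteDimensional_of_le (S₂ := Submodule.span k {(1 : A)}) fun a ha => ?_
      obtain ⟨c, rfl, -⟩ := hconn a ha
      rw [Algebra.algebraMap_eq_smul_one]
      exact Submodule.smul_mem _ _ (Submodule.subset_span rfl)
    · have := hfin.to_subtype
      have hfd : ∀ g : G,
          FiniteDimensional k ((𝒜 (n - d g)).map (LinearMap.mulLeft k (g : A))) := fun g => by
        have h1 := hd g g.2
        have := ih (n - d g) (by omega)
        infer_instance
      refine Submodule.finiteDimensional_of_le
        (S₂ := ⨆ g : G, (𝒜 (n - d g)).map (LinearMap.mulLeft k (g : A))) fun a ha => ?_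
      have haP : a ∈ Submodule.span Aᵐᵒᵖ (Set.range (Subtype.val : G → A)) := by
        rw [Subtype.range_coe, hspan]
        exact Submodule.subset_span ⟨n, hn, ha⟩
      obtain ⟨x, hx, rfl⟩ := exists_relMap_eq (𝒜 := 𝒜) (e := fun g : G => d g)
        (fun g => hG g g.2) haP ha
      rw [relMap_apply]
      refine Submodule.sum_mem _ fun g hg => ?_
      rcases (mem_freeGrading 𝒜).1 hx g with h0 | ⟨j, hj, h0⟩
      · exact absurd h0 (Finsupp.mem_support_iff.1 hg)
      · refine Submodule.mem_iSup_of_mem g ⟨x g, ?_, rfl⟩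
        have : n - d g = j := by omega
        rwa [this]

theorem freeProduct_finiteType {I : Type*} [DecidableEq I] [Finite I] {A : I → Type*}
    [∀ i, Ring (A i)] [∀ i, Algebra k (A i)] (h : ∀ i, Algebra.FiniteType k (A i)) :
    Algebra.FiniteType k (LinearAlgebra.FreeProduct k A) := by
  choose X hX using fun i => (h i).out
  have hfin : (⋃ i, LinearAlgebra.FreeProduct.ι k A i '' (X i : Set (A i))).Finite :=
    Set.finite_iUnion fun i => (X i).finite_toSet.image _
  refine ⟨Subalgebra.fg_def.2 ⟨_, hfin, ?_⟩⟩
  rw [eq_top_iff]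
  rintro x -
  refine freeProduct_mem_subalgebra (fun i a => ?_) x
  have h1 : (Algebra.adjoin k (X i : Set (A i))).map (LinearAlgebra.FreeProduct.ι k A i) ≤
      Algebra.adjoin k (⋃ i, LinearAlgebra.FreeProduct.ι k A i '' (X i : Set (A i))) := by
    rw [AlgHom.map_adjoin]
    exact Algebra.adjoin_mono (Set.subset_iUnion
      (fun i => LinearAlgebra.FreeProduct.ι k A i '' (X i : Set (A i))) i)
  rw [hX] at h1
  exact h1 ⟨a, Algebra.mem_top, rfl⟩

end FiniteType

/-! ### The direct sum with common unit -/

section UnitalSum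

variable {k : Type*} [Field k] {I : Type*} {A : I → Type*} [∀ i, Ring (A i)]
  [∀ i, Algebra k (A i)] {𝒜 : ∀ i, ℕ → Submodule k (A i)} [∀ i, GradedAlgebra (𝒜 i)]

variable (𝒜) in
/-- The projection of the direct sum with common unit onto a factor. -/
def unitalSumProj (i : I) : UnitalSum 𝒜 →ₐ[k] A i :=
  (Pi.evalAlgHom k A i).comp (UnitalSum 𝒜).val

theorem unitalSumProj_mem {i : I} {n : ℕ} {x : UnitalSum 𝒜} (hx : x ∈ unitalSumGrading 𝒜 n) :
    unitalSumProj 𝒜 i x ∈ 𝒜 i n :=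
  (mem_unitalSumGrading 𝒜).1 hx i

theorem unitalSum_ext {x y : UnitalSum 𝒜} (h : ∀ i, unitalSumProj 𝒜 i x = unitalSumProj 𝒜 i y) :
    x = y :=
  Subtype.ext (funext h)

theorem unitalSum_connected [Nonempty I] (hconn : ∀ i, Connected (𝒜 i)) :
    Connected (unitalSumGrading 𝒜) := by
  intro x hx
  obtain ⟨c, hc⟩ := x.2
  refine ⟨c, unitalSum_ext fun i => ?_, fun d hd => ?_⟩
  · rw [AlgHom.commutes, ← hc i]
    exact component_same (unitalSumProj_mem hx)
  · obtain ⟨i⟩ := ‹Nonempty I›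
    refine (hconn i).algebraMap_injective ?_
    rw [← AlgHom.commutes (unitalSumProj 𝒜 i), hd, ← hc i]
    exact (component_same (unitalSumProj_mem hx)).symm

variable [DecidableEq I]

variable (𝒜) in
/-- The inclusion into the direct sum with common unit of the elements of a factor without
component of degree zero; the degree zero component of other elements is dropped. -/
def unitalSumIncl (i : I) : A i →ₗ[k] UnitalSum 𝒜 :=
  ((LinearMap.single k A i).comp (LinearMap.id - component (𝒜 i) 0)).codRestrict
    (Subalgebra.toSubmodule (UnitalSum 𝒜)) (fun a => by
      refine ⟨0, fun j => ?_⟩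
      rw [map_zero]
      change component (𝒜 j) 0 (Pi.single i (a - component (𝒜 i) 0 a) j) = 0
      by_cases h : j = i
      · subst h
        rw [Pi.single_eq_same, map_sub, component_same (component_mem (𝒜 j) 0 a), sub_self]
      · rw [Pi.single_eq_of_ne h, map_zero])

theorem unitalSumProj_incl_same {i : I} {a : A i} (ha : component (𝒜 i) 0 a = 0) :
    unitalSumProj 𝒜 i (unitalSumIncl 𝒜 i a) = a := by
  change (Pi.single i (a - component (𝒜 i) 0 a) : ∀ j, A j) i = a
  rw [Pi.single_eq_same, ha, sub_zero]

theorem unitalSumProj_incl_ne {i j : I} (h : j ≠ i) (a : A i) :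
    unitalSumProj 𝒜 j (unitalSumIncl 𝒜 i a) = 0 := by
  change (Pi.single i (a - component (𝒜 i) 0 a) : ∀ j, A j) j = 0
  rw [Pi.single_eq_of_ne h]

theorem component_zero_mul {i : I} (a b : A i) :
    component (𝒜 i) 0 (a * b) = component (𝒜 i) 0 a * component (𝒜 i) 0 b :=
  map_mul (GradedRing.projZeroRingHom (𝒜 i)) a b

/-- In the other coordinates one factor is zero. Thus `(A i)₊` is an ideal of `C` on which `C` acts
through its projection to `A i`. -/
theorem unitalSumIncl_mul {i : I} {a : A i} (ha : component (𝒜 i) 0 a = 0) (x : UnitalSum 𝒜) :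
    unitalSumIncl 𝒜 i a * x = unitalSumIncl 𝒜 i (a * unitalSumProj 𝒜 i x) := by
  refine unitalSum_ext fun j => ?_
  rw [map_mul]
  by_cases h : j = i
  · subst h
    rw [unitalSumProj_incl_same ha, unitalSumProj_incl_same
      (by rw [component_zero_mul, ha, zero_mul])]
  · rw [unitalSumProj_incl_ne h, unitalSumProj_incl_ne h, zero_mul]

theorem mul_unitalSumIncl {i : I} {a : A i} (ha : component (𝒜 i) 0 a = 0) (x : UnitalSum 𝒜) :
    x * unitalSumIncl 𝒜 i a = unitalSumIncl 𝒜 i (unitalSumProj 𝒜 i x * a) := by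
  refine unitalSum_ext fun j => ?_
  rw [map_mul]
  by_cases h : j = i
  · subst h
    rw [unitalSumProj_incl_same ha, unitalSumProj_incl_same
      (by rw [component_zero_mul, ha, mul_zero])]
  · rw [unitalSumProj_incl_ne h, unitalSumProj_incl_ne h, mul_zero]

theorem unitalSumIncl_mem {i : I} {n : ℕ} (hn : 0 < n) {a : A i} (ha : a ∈ 𝒜 i n) :
    unitalSumIncl 𝒜 i a ∈ unitalSumGrading 𝒜 n := by
  rw [mem_unitalSumGrading]
  intro j
  change unitalSumProj 𝒜 j (unitalSumIncl 𝒜 i a) ∈ 𝒜 j n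
  by_cases h : j = i
  · subst h
    rwa [unitalSumProj_incl_same (component_ne ha hn.ne')]
  · rw [unitalSumProj_incl_ne h]
    exact zero_mem _

theorem exists_unitalSumProj_eq (hconn : ∀ i, Connected (𝒜 i)) {i : I} (a : A i) :
    ∃ x, unitalSumProj 𝒜 i x = a := by
  refine ⟨algebraMap k _ ((hconn i).augmentation a) +
    unitalSumIncl 𝒜 i (a - component (𝒜 i) 0 a), ?_⟩
  rw [map_add, AlgHom.commutes, (hconn i).algebraMap_augmentation, unitalSumProj_incl_same]
  · abel
  · rw [map_sub, component_same (component_mem (𝒜 i) 0 a), sub_self]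

theorem sum_unitalSumIncl [Fintype I] {n : ℕ} (hn : 0 < n) {x : UnitalSum 𝒜}
    (hx : x ∈ unitalSumGrading 𝒜 n) :
    ∑ i, unitalSumIncl 𝒜 i (unitalSumProj 𝒜 i x) = x := by
  refine unitalSum_ext fun j => ?_
  rw [map_sum, Finset.sum_eq_single j]
  · exact unitalSumProj_incl_same (component_ne (unitalSumProj_mem hx) hn.ne')
  · exact fun i _ hij => unitalSumProj_incl_ne hij.symm _
  · exact fun h => absurd (Finset.mem_univ j) h

/-- Bounds for the Tor of a family in the direct sum with common unit: it is the sum of the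
modules of relations with coefficients of positive degree over the factors. -/
theorem torBound_unitalSum [Finite I] (hconn : ∀ i, Connected (𝒜 i)) {ι : Type*}
    {s : ι → UnitalSum 𝒜} {e : ι → ℕ}
    {N : ℕ∞} {c : Prop}
    (hT : ∀ i, ∃ (Φ R : Set (ι →₀ A i)) (G : Set (A i)),
      (∀ φ ∈ Φ, ∃ n : ℕ, (n : ℕ∞) ≤ N ∧ HasPositiveCoeffs (𝒜 i) e n φ ∧
        relMap (A i) (fun l => unitalSumProj 𝒜 i (s l)) φ = 0) ∧
      (∀ ω ∈ R, ∃ p, IsRelation (𝒜 i) (fun l => unitalSumProj 𝒜 i (s l)) e p ω ∧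
        ∀ g ∈ G, ∃ j : ℕ, 0 < j ∧ ((p + j : ℕ) : ℕ∞) ≤ N ∧ g ∈ 𝒜 i j) ∧
      (c → Φ.Finite) ∧ (c → R.Finite) ∧ (c → G.Finite) ∧
      Submodule.span (A i)ᵐᵒᵖ G = positiveIdeal (𝒜 i) ∧
      (∀ n x, HasPositiveCoeffs (𝒜 i) e n x →
        relMap (A i) (fun l => unitalSumProj 𝒜 i (s l)) x = 0 →
        x ∈ Submodule.span (A i)ᵐᵒᵖ
          (Φ ∪ decomposableRelations (𝒜 i) (fun l => unitalSumProj 𝒜 i (s l)) e n)) ∧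
      LinearMap.ker (relMap (A i) (fun l => unitalSumProj 𝒜 i (s l))) ≤
        Submodule.span (A i)ᵐᵒᵖ (Φ ∪ R)) :
    TorBound (unitalSumGrading 𝒜) N c s e := by
  have := Fintype.ofFinite I
  choose Φ R G hΦ hR hΦfin hRfin hGfin hG hgen hker using hT
  let J : ∀ i, (ι →₀ A i) →ₗ[k] (ι →₀ UnitalSum 𝒜) :=
    fun i => Finsupp.mapRange.linearMap (unitalSumIncl 𝒜 i)
  have hJ : ∀ i x l, J i x l = unitalSumIncl 𝒜 i (x l) := fun i x l => rfl
  -- the generators over the factor `A i`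
  let Y : ∀ i, Set (ι →₀ A i) := fun i => Φ i ∪ Set.image2 (fun ω g => op g • ω) (R i) (G i)
  have hY : ∀ i, ∀ y ∈ Y i, ∃ n : ℕ, (n : ℕ∞) ≤ N ∧ HasPositiveCoeffs (𝒜 i) e n y ∧
      relMap (A i) (fun l => unitalSumProj 𝒜 i (s l)) y = 0 := by
    rintro i y (hy | ⟨ω, hω, g, hg, rfl⟩)
    · exact hΦ i y hy
    · obtain ⟨p, hp, hpG⟩ := hR i ω hω
      obtain ⟨j, hj, hN, hgj⟩ := hpG g hg
      refine ⟨p + j, hN, fun l => ?_, ?_⟩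
      · rcases (mem_freeGrading (𝒜 i)).1 hp.1 l with h0 | ⟨m, hm, h0⟩
        · left; rw [Finsupp.smul_apply, h0, smul_zero]
        · exact Or.inr ⟨m + j, by omega, by omega, SetLike.GradedMul.mul_mem h0 hgj⟩
      · simp only [map_smul, hp.2, smul_zero]
  have hcomp : ∀ i n x, HasPositiveCoeffs (𝒜 i) e n x → ∀ l, component (𝒜 i) 0 (x l) = 0 := by
    intro i n x hx l
    rcases hx l with h0 | ⟨j, hj, -, h0⟩
    · rw [h0, map_zero]
    · exact component_ne h0 hj.ne'
  have hJpos : ∀ i n x, HasPositiveCoeffs (𝒜 i) e n x →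
      HasPositiveCoeffs (unitalSumGrading 𝒜) e n (J i x) := by
    intro i n x hx l
    rcases hx l with h0 | ⟨j, hj, hn, h0⟩
    · left; rw [hJ, h0, map_zero]
    · exact Or.inr ⟨j, hj, hn, unitalSumIncl_mem hj h0⟩
  have hJrel : ∀ i x, (∀ l, component (𝒜 i) 0 (x l) = 0) → relMap (UnitalSum 𝒜) s (J i x) =
      unitalSumIncl 𝒜 i (relMap (A i) (fun l => unitalSumProj 𝒜 i (s l)) x) := by
    intro i x hx
    have h1 : relMap (UnitalSum 𝒜) s (J i x) =
        x.sum fun l a => s l * unitalSumIncl 𝒜 i a := by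
      rw [relMap_apply]
      exact Finsupp.sum_mapRange_index (hf := map_zero (unitalSumIncl 𝒜 i)) (by simp)
    rw [h1, relMap_apply, Finsupp.sum, Finsupp.sum, map_sum]
    exact Finset.sum_congr rfl fun l _ => mul_unitalSumIncl (hx l) (s l)
  have hJsmul : ∀ i x, (∀ l, component (𝒜 i) 0 (x l) = 0) → ∀ z : UnitalSum 𝒜,
      J i (op (unitalSumProj 𝒜 i z) • x) = op z • J i x := by
    intro i x hx z
    ext1 l
    rw [hJ, Finsupp.smul_apply, Finsupp.smul_apply, hJ, op_smul_eq_mul, op_smul_eq_mul,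
      unitalSumIncl_mul (hx l)]
  refine ⟨⋃ i, J i '' Y i, ?_, fun hc => ?_, fun n x hpos hrel => ?_⟩
  · rintro _ ⟨_, ⟨i, rfl⟩, y, hy, rfl⟩
    obtain ⟨n, hn, hpos, hrel⟩ := hY i y hy
    exact ⟨n, hn, hJpos i n y hpos, by rw [hJrel i y (hcomp i n y hpos), hrel, map_zero]⟩
  · exact Set.finite_iUnion fun i =>
      ((hΦfin i hc).union ((hRfin i hc).image2 _ (hGfin i hc))).image _
  -- Decomposable relations over `C` are not needed: those over the factors are already generated by
  -- `Y`.
  refine Submodule.span_mono Set.subset_union_left ?_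
  have hspan : ∀ i, ∀ y ∈ Submodule.span (A i)ᵐᵒᵖ (Y i), (∀ l, component (𝒜 i) 0 (y l) = 0) ∧
      J i y ∈ Submodule.span (UnitalSum 𝒜)ᵐᵒᵖ (⋃ i, J i '' Y i) := by
    intro i y hy
    induction hy using Submodule.span_induction with
    | mem y hy =>
      obtain ⟨m, -, hm, -⟩ := hY i y hy
      exact ⟨hcomp i m y hm, Submodule.subset_span (Set.mem_iUnion.2 ⟨i, y, hy, rfl⟩)⟩
    | zero => exact ⟨fun l => map_zero _, by rw [map_zero]; exact zero_mem _⟩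
    | add y z _ _ hy hz =>
      refine ⟨fun l => ?_, ?_⟩
      · rw [Finsupp.add_apply, map_add, hy.1, hz.1, add_zero]
      · rw [map_add]; exact add_mem hy.2 hz.2
    | smul b y _ hy =>
      induction b using MulOpposite.rec' with | _ b
      refine ⟨fun l => ?_, ?_⟩
      · rw [Finsupp.smul_apply, op_smul_eq_mul, component_zero_mul, hy.1, zero_mul]
      · obtain ⟨z, rfl⟩ := exists_unitalSumProj_eq hconn b
        rw [hJsmul i y hy.1]
        exact Submodule.smul_mem _ _ hy.2
  -- Relations times positive elements are generated by `Y`: `Φ` is contained in it, and an element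
  -- of `R` need only be multiplied by the generators `G` of the positive ideal, which is two-sided.
  have hmulpos : ∀ i, ∀ y ∈ Submodule.span (A i)ᵐᵒᵖ (Φ i ∪ R i), ∀ w ∈ positiveIdeal (𝒜 i),
      op w • y ∈ Submodule.span (A i)ᵐᵒᵖ (Y i) := by
    intro i y hy
    induction hy using Submodule.span_induction with
    | mem y hy =>
      rcases hy with hy | hy
      · exact fun w _ => Submodule.smul_mem _ _ (Submodule.subset_span (Or.inl hy))
      · intro w hw
        rw [← hG i] at hw
        induction hw using Submodule.span_induction with
        | mem g hg => exact Submodule.subset_span (Or.inr ⟨y, hy, g, hg, rfl⟩)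
        | zero => simp
        | add w w' _ _ hw hw' => rw [op_add, add_smul]; exact add_mem hw hw'
        | smul b w _ hw =>
          induction b using MulOpposite.rec' with | _ b
          rw [op_smul_eq_mul, op_mul, mul_smul]
          exact Submodule.smul_mem _ _ hw
    | zero => intro w _; rw [smul_zero]; exact zero_mem _
    | add y z _ _ hy hz => intro w hw; rw [smul_add]; exact add_mem (hy w hw) (hz w hw)
    | smul b y _ hy =>
      intro w hw
      induction b using MulOpposite.rec' with | _ b
      rw [smul_smul, ← op_mul]
      exact hy _ (mul_mem_positiveIdeal hw)
  let P : ∀ i, (ι →₀ UnitalSum 𝒜) →ₗ[k] (ι →₀ A i) :=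
    fun i => Finsupp.mapRange.linearMap (unitalSumProj 𝒜 i).toLinearMap
  have hP : ∀ i x l, P i x l = unitalSumProj 𝒜 i (x l) := fun i x l => rfl
  -- A coefficient of positive degree is the sum of its coordinates, each taken in its own factor.
  have hxsum : x = ∑ i, J i (P i x) := by
    ext1 l
    rw [Finsupp.finsetSum_apply]
    simp only [hJ, hP]
    rcases hpos l with h0 | ⟨j, hj, -, h0⟩
    · simp only [h0, map_zero, Finset.sum_const_zero]
    · exact (sum_unitalSumIncl hj h0).symm
  rw [hxsum]
  refine Submodule.sum_mem _ fun i _ => (hspan i _ ?_).2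
  have hxpos : HasPositiveCoeffs (𝒜 i) e n (P i x) := by
    intro l
    rcases hpos l with h0 | ⟨j, hj, hn, h0⟩
    · left; rw [hP, h0, map_zero]
    · exact Or.inr ⟨j, hj, hn, unitalSumProj_mem h0⟩
  have hxrel : relMap (A i) (fun l => unitalSumProj 𝒜 i (s l)) (P i x) = 0 := by
    have h1 : relMap (A i) (fun l => unitalSumProj 𝒜 i (s l)) (P i x) =
        unitalSumProj 𝒜 i (relMap (UnitalSum 𝒜) s x) := by
      rw [relMap_apply, relMap_apply, Finsupp.sum, Finsupp.sum, map_sum]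
      refine (Finsupp.sum_mapRange_index (hf := map_zero (unitalSumProj 𝒜 i))
        (h := fun l a => op a • unitalSumProj 𝒜 i (s l)) (by simp)).trans ?_
      refine Finset.sum_congr rfl fun l _ => ?_
      exact (map_mul (unitalSumProj 𝒜 i) _ _).symm
    rw [h1, hrel, map_zero]
  refine Submodule.span_le.2 ?_ (hgen i n _ hxpos hxrel)
  rintro y (hy | ⟨m, j, hj, -, y, hy, w, hw, rfl⟩)
  · exact Submodule.subset_span (Or.inl hy)
  · exact hmulpos i y (hker i hy.2) w (Submodule.subset_span ⟨j, hj, hw⟩)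

end UnitalSum

/-! ### Degree bounds and coherence of the direct sum -/

section UnitalSumCoherence

variable {k : Type*} [Field k] {I : Type*} [Finite I] {A : I → Type*} [∀ i, Ring (A i)]
  [∀ i, Algebra k (A i)] {𝒜 : ∀ i, ℕ → Submodule k (A i)} [∀ i, GradedAlgebra (𝒜 i)]

/-- `D_A(d)` bounds the Tor generators over a factor. The remaining generators are relations of
degree at most `d` times generators of the positive ideal; relations of larger degree have positive
coefficients and are reached by Nakayama. -/
theorem unitalSum_algebraDegreeBound_le [Nonempty I] (hconn : ∀ i, Connected (𝒜 i)) {d : ℕ}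
    {N : ℕ∞} (hN : ∀ i, algebraDegreeBound (𝒜 i) d ≤ N)
    (hG : ∀ i, d + generatorDegree (𝒜 i) ≤ N) :
    algebraDegreeBound (unitalSumGrading 𝒜) d ≤ N := by
  classical
  refine degreeBound_le_of_torBound (unitalSum_connected hconn) fun S e hS hd _ =>
    torBound_unitalSum hconn fun i => ?_
  have hs : ∀ l : S, unitalSumProj 𝒜 i l ∈ 𝒜 i (e l) := fun l => unitalSumProj_mem (hS l)
  obtain ⟨Φ, hΦ, -, hgen⟩ := torBound_of_degreeBound_le (hconn i) (hN i) hs hd fun _ => trivial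
  obtain ⟨G, hGpos, hGspan⟩ := (hconn i).exists_generators
  refine ⟨Φ, {ω | ∃ p ≤ d, IsRelation (𝒜 i) (fun l : S => unitalSumProj 𝒜 i l) e p ω}, G, hΦ,
    ?_, False.elim, False.elim, False.elim, hGspan, hgen, ?_⟩
  · rintro ω ⟨p, hp, hω⟩
    refine ⟨p, hω, fun g hg => ?_⟩
    obtain ⟨j, hj, hjN, hgj⟩ := hGpos g hg
    refine ⟨j, hj, le_trans ?_ (hG i), hgj⟩
    rw [Nat.cast_add]
    exact add_le_add (by exact_mod_cast hp) hjN
  · refine ker_le_of_generates (𝒜 := 𝒜 i) hs (fun n x hx hr => ?_) fun n x hx => ?_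
    · refine SetLike.le_def.1 ?_ (hgen n x hx hr)
      rw [Submodule.span_union, Submodule.span_union]
      exact sup_le_sup_right le_sup_left _
    · by_cases hn : n ≤ d
      · exact Or.inr (Submodule.subset_span (Or.inr ⟨n, hn, hx⟩))
      · exact Or.inl (hasPositiveCoeffs_of_lt hx.1 fun l => by have := hd l; omega)

/-- Coherence of a factor makes the relations finitely generated, and finite type does so for its
positive ideal; hence their products are generated by finitely many. -/
theorem unitalSum_coherent [Nonempty I] (hconn : ∀ i, Connected (𝒜 i))
    (hfin : ∀ i, Algebra.FiniteType k (A i)) (hA : ∀ i, Coherent (𝒜 i)) :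
    Coherent (unitalSumGrading 𝒜) := by
  classical
  refine coherent_of_torBound (unitalSum_connected hconn) fun S e hS =>
    torBound_unitalSum hconn fun i => ?_
  have hs : ∀ l : S, unitalSumProj 𝒜 i l ∈ 𝒜 i (e l) := fun l => unitalSumProj_mem (hS l)
  have hrel := (hA i).relationBound hs
  obtain ⟨Φ, hΦ, hΦfin, hgen⟩ := torBound_of_relationBound (hconn i) hs hrel
  obtain ⟨R, hR, hRfin, hRspan⟩ := hrel
  obtain ⟨G, hGfin, hGpos, hGspan⟩ := (hconn i).exists_finite_generators (hfin i)
  refine ⟨Φ, R, G, hΦ, fun ω hω => ?_, hΦfin, hRfin, fun _ => hGfin, hGspan, hgen, ?_⟩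
  · obtain ⟨p, -, hp⟩ := hR ω hω
    refine ⟨p, ⟨hp, ?_⟩, fun g hg => ?_⟩
    · rw [← LinearMap.mem_ker, ← hRspan]
      exact Submodule.subset_span hω
    · obtain ⟨j, hj, hgj⟩ := hGpos g hg
      exact ⟨j, hj, le_top, hgj⟩
  · rw [← hRspan]
    exact Submodule.span_mono Set.subset_union_right

theorem unitalSum_effectivelyCoherent [Nonempty I] (hconn : ∀ i, Connected (𝒜 i))
    (hfin : ∀ i, Algebra.FiniteType k (A i)) (hA : ∀ i, EffectivelyCoherent (𝒜 i)) :
    EffectivelyCoherent (unitalSumGrading 𝒜) := by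
  intro d hd
  have := Fintype.ofFinite I
  let b : I → ℕ∞ := fun i => max (algebraDegreeBound (𝒜 i) d) (d + generatorDegree (𝒜 i))
  have hb : ∀ i, b i ≤ Finset.univ.sup b := fun i => Finset.le_sup (Finset.mem_univ i)
  refine ne_top_of_le_ne_top ?_ (unitalSum_algebraDegreeBound_le hconn
    (fun i => (le_max_left _ _).trans (hb i)) fun i => (le_max_right _ _).trans (hb i))
  refine ne_of_lt ((Finset.sup_lt_iff (by simp)).2 fun i _ => max_lt ?_ ?_)
  · exact lt_top_iff_ne_top.2 (hA i d hd)
  · exact lt_top_iff_ne_top.2 (WithTop.add_ne_top.2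
      ⟨ENat.natCast_ne_top d, (hconn i).generatorDegree_ne_top (hfin i)⟩)

end UnitalSumCoherence

/-! ### Fox calculus and free algebras -/

section FreeAlgebra

variable {k : Type*} [Field k] {F : Type*} [Ring F] [Algebra k F] {X : Type*} {x : X → F}

theorem mem_subalgebra_of_lift_bijective (hx : Function.Bijective (FreeAlgebra.lift k x))
    {S : Subalgebra k F} (hS : ∀ i, x i ∈ S) (y : F) : y ∈ S := by
  obtain ⟨z, rfl⟩ := hx.2 y
  induction z using FreeAlgebra.induction with
  | grade0 c => rw [AlgHom.commutes]; exact S.algebraMap_mem c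
  | grade1 i => rw [FreeAlgebra.lift_ι_apply]; exact hS i
  | mul y z hy hz => rw [map_mul]; exact S.mul_mem hy hz
  | add y z hy hz => rw [map_add]; exact S.add_mem hy hz

/-- The Fox derivative with respect to a free generator. -/
theorem exists_foxDerivative [DecidableEq X] (hx : Function.Bijective (FreeAlgebra.lift k x))
    (ε : F →ₐ[k] k) (i : X) : ∃ D : F →ₗ[k] F,
      (∀ y z, D (y * z) = y * D z + ε z • D y) ∧ ∀ j, D (x j) = if j = i then 1 else 0 := by
  let h : F →ₐ[k] Matrix (Fin 2) (Fin 2) F :=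
    (FreeAlgebra.lift k fun j => !![x j, if j = i then 1 else 0; 0, algebraMap k F (ε (x j))]).comp
      (AlgEquiv.ofBijective _ hx).symm.toAlgHom
  have hhx : ∀ j, h (x j) = !![x j, if j = i then 1 else 0; 0, algebraMap k F (ε (x j))] := by
    intro j
    have h1 : (AlgEquiv.ofBijective _ hx).symm (x j) = FreeAlgebra.ι k j := by
      rw [AlgEquiv.symm_apply_eq]
      exact (FreeAlgebra.lift_ι_apply x j).symm
    change FreeAlgebra.lift k _ ((AlgEquiv.ofBijective _ hx).symm (x j)) = _
    rw [h1, FreeAlgebra.lift_ι_apply]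
  have hmem : ∀ y, h y 1 0 = 0 ∧ h y 0 0 = y ∧ h y 1 1 = algebraMap k F (ε y) := by
    let S : Subalgebra k F :=
      { carrier := {y | h y 1 0 = 0 ∧ h y 0 0 = y ∧ h y 1 1 = algebraMap k F (ε y)}
        mul_mem' := by
          rintro x y ⟨h1, h2, h3⟩ ⟨h1', h2', h3'⟩
          simp [Matrix.mul_apply, h1, h2, h3, h1', h2', h3']
        add_mem' := by
          rintro x y ⟨h1, h2, h3⟩ ⟨h1', h2', h3'⟩
          simp [h1, h2, h3, h1', h2', h3']
        algebraMap_mem' := by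
          intro c
          simp [AlgHom.commutes, Matrix.algebraMap_matrix_apply] }
    exact mem_subalgebra_of_lift_bijective hx (S := S) fun j => by
      change _ ∧ _ ∧ _
      rw [hhx]
      simp
  refine ⟨(Matrix.entryLinearMap k F 0 1).comp h.toLinearMap, fun y z => ?_, fun j => ?_⟩
  · simp [Matrix.mul_apply, (hmem y).2.1, (hmem z).2.2, Algebra.smul_def, Algebra.commutes]
  · simp [hhx]

/-- The fundamental formula of Fox calculus: by the twisted Leibniz rule, the elements that satisfy
it form a subalgebra, which contains the generators. -/
theorem eq_augmentation_add_sum [Fintype X] [DecidableEq X]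
    (hx : Function.Bijective (FreeAlgebra.lift k x)) {ε : F →ₐ[k] k} (hε : ∀ j, ε (x j) = 0)
    {D : X → F →ₗ[k] F} (hmul : ∀ i y z, D i (y * z) = y * D i z + ε z • D i y)
    (hD : ∀ i j, D i (x j) = if j = i then 1 else 0) (y : F) :
    y = algebraMap k F (ε y) + ∑ i, D i y * x i := by
  have hD1 : ∀ i, D i 1 = 0 := fun i => by simpa using hmul i 1 1
  let S : Subalgebra k F :=
    { carrier := {y | ∑ i, D i y * x i = y - algebraMap k F (ε y)}
      mul_mem' := by
        intro y z hy hz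
        simp only [Set.mem_ofPred_eq] at hy hz ⊢
        simp only [hmul, add_mul, mul_assoc, smul_mul_assoc, Finset.sum_add_distrib,
          ← Finset.mul_sum, ← Finset.smul_sum, hy, hz]
        rw [Algebra.smul_def, Algebra.commutes, map_mul, map_mul]
        noncomm_ring
      add_mem' := by
        intro y z hy hz
        simp only [Set.mem_ofPred_eq] at hy hz ⊢
        simp only [map_add, add_mul, Finset.sum_add_distrib, hy, hz]
        abel
      algebraMap_mem' := by
        intro c
        simp [Algebra.algebraMap_eq_smul_one, hD1] }
  have h : y ∈ S := mem_subalgebra_of_lift_bijective hx (fun j => by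
    change ∑ i, D i (x j) * x i = x j - algebraMap k F (ε (x j))
    simp [hD, hε]) y
  rw [show ∑ i, D i y * x i = _ from h, add_sub_cancel]

variable {𝓕 : ℕ → Submodule k F} [GradedAlgebra 𝓕]

/-- The minimal homogeneous generators of a right ideal of a free algebra are independent. -/
theorem ker_relMap_eq_bot_of_lift_bijective [Finite X] (hconn : Connected 𝓕)
    (hhom : ∀ j, SetLike.IsHomogeneousElem 𝓕 (x j))
    (hx : Function.Bijective (FreeAlgebra.lift k x)) {L : Submodule Fᵐᵒᵖ F} {S : Set F}
    {e : S → ℕ} (hS : IsMinimalGenerating 𝓕 L S e) :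
    LinearMap.ker (relMap F (Subtype.val : S → F)) = ⊥ := by
  classical
  have := Fintype.ofFinite X
  choose d hd using hhom
  choose D hmul hD using fun i => exists_foxDerivative hx hconn.augmentation i
  have hD1 : ∀ i, D i 1 = 0 := fun i => by simpa using hmul i 1 1
  -- A generator of degree zero would be a scalar, with zero derivative, although its own Fox
  -- derivative is `1`.
  have hdpos : ∀ i, 0 < d i := by
    intro i
    refine Nat.pos_of_ne_zero fun h0 => ?_
    obtain ⟨c, hc, -⟩ := hconn (x i) (h0 ▸ hd i)
    have h1 := hD i i
    rw [← hc, Algebra.algebraMap_eq_smul_one, map_smul, hD1, smul_zero, if_pos rfl] at h1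
    have h2 : (0 : k) = 1 := hconn.algebraMap_injective (by rw [map_zero, map_one, h1])
    exact zero_ne_one h2
  have hε : ∀ j, hconn.augmentation (x j) = 0 := fun j =>
    hconn.augmentation_eq_zero (hdpos j) (hd j)
  have hsum := eq_augmentation_add_sum hx hε hmul hD
  -- The Fox derivative lowers degrees by `d i`: the coefficients of `a` may be replaced by their
  -- components of the right degree, and `D i` recovers them.
  have hdeg : ∀ i m, 0 < m → ∀ a ∈ 𝓕 m, D i a = 0 ∨ ∃ j, d i + j = m ∧ D i a ∈ 𝓕 j := by
    intro i m hm a ha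
    let b : X → F := fun j => if d j ≤ m then component 𝓕 (m - d j) (D j a) else 0
    have hb : a = ∑ j, b j * x j := by
      have h1 := hsum a
      rw [hconn.augmentation_eq_zero hm ha, map_zero, zero_add] at h1
      rw [← component_same ha]
      conv_lhs => rw [h1]
      rw [map_sum]
      refine Finset.sum_congr rfl fun j _ => ?_
      by_cases hj : d j ≤ m
      · simp only [b, if_pos hj]
        exact DirectSum.coe_decompose_mul_of_right_mem_of_le 𝓕 (hd j) hj
      · simp only [b, if_neg hj, zero_mul]
        exact DirectSum.coe_decompose_mul_of_right_mem_of_not_le 𝓕 (hd j) hj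
    have hDb : D i a = b i := by
      conv_lhs => rw [hb]
      rw [map_sum]
      simp [hmul, hD, hε]
    rw [hDb]
    by_cases hi : d i ≤ m
    · exact Or.inr ⟨m - d i, by omega, by simp only [b, if_pos hi]; exact component_mem _ _ _⟩
    · exact Or.inl (if_neg hi)
  have key : ∀ n, ∀ a ∈ freeGrading 𝓕 e n, relMap F (Subtype.val : S → F) a = 0 → a = 0 := by
    intro n
    induction n using Nat.strong_induction_on with
    | _ n ih =>
      intro a ha hrel
      have hpos := hS.hasPositiveCoeffs hconn ha hrel
      have hεa : ∀ s, hconn.augmentation (a s) = 0 := by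
        intro s
        rcases hpos s with h0 | ⟨j, hj, -, h0⟩
        · rw [h0, map_zero]
        · exact hconn.augmentation_eq_zero hj h0
      have hDa : ∀ i s, D i (a s) = 0 := by
        intro i s
        rcases Nat.eq_zero_or_pos n with rfl | hn
        · rcases hpos s with h0 | ⟨j, hj, hn, -⟩
          · rw [h0, map_zero]
          · omega
        -- As the coefficients have zero augmentation, deriving them turns a relation into a
        -- relation of smaller degree, which vanishes by induction.
        have h1 : Finsupp.mapRange.linearMap (D i) a = 0 := by
          refine ih (n - d i) (by have := hdpos i; omega) _ ?_ ?_
          · rw [mem_freeGrading]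
            intro t
            rw [Finsupp.mapRange.linearMap_apply, Finsupp.mapRange_apply]
            rcases hpos t with h0 | ⟨j, hj, hnj, h0⟩
            · left; rw [h0, map_zero]
            · rcases hdeg i j hj _ h0 with h0 | ⟨l, hl, h0⟩
              · exact Or.inl h0
              · exact Or.inr ⟨l, by omega, h0⟩
          · have h2 : D i (relMap F (Subtype.val : S → F) a) =
                relMap F (Subtype.val : S → F) (Finsupp.mapRange.linearMap (D i) a) := by
              rw [relMap_apply, relMap_apply, Finsupp.sum, map_sum]
              refine Eq.trans ?_ (Finsupp.sum_mapRange_index (hf := map_zero (D i))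
                (h := fun (t : S) y => op y • (t : F)) (by simp)).symm
              refine Finset.sum_congr rfl fun t _ => ?_
              rw [op_smul_eq_mul, hmul, hεa, zero_smul, add_zero]
              rfl
            rw [← h2, hrel, map_zero]
        exact DFunLike.congr_fun h1 s
      ext s
      -- With zero augmentation and zero Fox derivatives, each coefficient vanishes.
      rw [hsum (a s), hεa]
      simp [hDa]
  rw [eq_bot_iff]
  intro a ha
  have h1 := mem_span_homogeneous_relations (𝒜 := 𝓕) hS.homogeneous ha
  refine Submodule.span_le.2 ?_ h1
  rintro y ⟨hy, n, hn⟩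
  exact key n y hn hy

theorem effectivelyCoherent_of_lift_bijective [Finite X] (hconn : Connected 𝓕)
    (hhom : ∀ j, SetLike.IsHomogeneousElem 𝓕 (x j))
    (hx : Function.Bijective (FreeAlgebra.lift k x)) : EffectivelyCoherent 𝓕 := by
  intro d _
  refine ne_top_of_le_ne_top (ENat.natCast_ne_top 0) ?_
  refine iSup_le fun L => iSup_le fun _ => iSup_le fun _ => iSup_le fun S => iSup_le fun e =>
    iSup_le fun hS => ?_
  rw [syzygies_eq_ker, ker_relMap_eq_bot_of_lift_bijective hconn hhom hx hS, m₀_le_iff,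
    GeneratedInDegreeLE, eq_bot_iff]
  exact Submodule.span_le.2 fun x hx => hx.1

end FreeAlgebra

end GradedCoherence

end

/-! ### The proposition for two algebras -/

theorem proposition3p6 {k : Type*} [Field k]
    -- the two algebras are `A 0` and `A 1`
    (A : Fin 2 → Type*) [∀ i, Ring (A i)] [∀ i, Algebra k (A i)]
    (𝒜 : ∀ i, ℕ → Submodule k (A i)) [∀ i, GradedAlgebra (𝒜 i)]
    (hconn : ∀ i, GradedCoherence.Connected (𝒜 i)) :
    -- the direct sum with common unit and the free product are connected graded algebras
    GradedCoherence.Connected (GradedCoherence.unitalSumGrading 𝒜) ∧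
    GradedCoherence.Connected (GradedCoherence.freeProductGrading 𝒜) ∧
    -- coherence
    ((∀ i, GradedCoherence.Coherent (𝒜 i)) →
      GradedCoherence.Coherent (GradedCoherence.freeProductGrading 𝒜)) ∧
    ((∀ i, Algebra.FiniteType k (A i)) → (∀ i, GradedCoherence.Coherent (𝒜 i)) →
      GradedCoherence.Coherent (GradedCoherence.unitalSumGrading 𝒜)) ∧
    -- effective coherence
    ((∀ i, Algebra.FiniteType k (A i)) → (∀ i, GradedCoherence.EffectivelyCoherent (𝒜 i)) →
      GradedCoherence.EffectivelyCoherent (GradedCoherence.unitalSumGrading 𝒜) ∧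
      GradedCoherence.EffectivelyCoherent (GradedCoherence.freeProductGrading 𝒜)) ∧
    -- explicit bounds
    (∀ d : ℕ, GradedCoherence.algebraDegreeBound (GradedCoherence.unitalSumGrading 𝒜) d ≤
      max (max (GradedCoherence.algebraDegreeBound (𝒜 0) d)
          (GradedCoherence.algebraDegreeBound (𝒜 1) d))
        (max (d + GradedCoherence.generatorDegree (𝒜 0))
          (d + GradedCoherence.generatorDegree (𝒜 1)))) ∧
    (∀ d : ℕ, GradedCoherence.algebraDegreeBound (GradedCoherence.freeProductGrading 𝒜) d ≤
      max (GradedCoherence.truncatedDegreeBound 𝒜 0 d d)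
        (GradedCoherence.truncatedDegreeBound 𝒜 1 d d)) ∧
    -- free algebras on finitely many homogeneous generators
    (∀ (F : Type*) [Ring F] [Algebra k F] (𝓕 : ℕ → Submodule k F) [GradedAlgebra 𝓕] (n : ℕ)
      (x : Fin n → F), GradedCoherence.Connected 𝓕 →
      (∀ j, SetLike.IsHomogeneousElem 𝓕 (x j)) →
      Function.Bijective (FreeAlgebra.lift k x) → GradedCoherence.EffectivelyCoherent 𝓕) := by
  have H := GradedCoherence.isGradedCoproduct_freeProduct hconn
  let : ∀ i, Module (A i)ᵐᵒᵖ (LinearAlgebra.FreeProduct k A) :=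
    fun i => GradedCoherence.freeProductRightModule k A i
  have hact : ∀ i (a : A i) (x : LinearAlgebra.FreeProduct k A),
      op a • x = x * LinearAlgebra.FreeProduct.ι k A i a := fun _ _ _ => rfl
  refine ⟨GradedCoherence.unitalSum_connected hconn, H.connected, H.coherent hconn hact,
    GradedCoherence.unitalSum_coherent hconn, fun hfin hA =>
    ⟨GradedCoherence.unitalSum_effectivelyCoherent hconn hfin hA, H.effectivelyCoherent hconn hact
      (H.connected.finiteDimensional (GradedCoherence.freeProduct_finiteType hfin)) hA⟩,
    fun d => GradedCoherence.unitalSum_algebraDegreeBound_le hconn ?_ ?_,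
    fun d => H.algebraDegreeBound_le hconn hact ?_,
    fun F _ _ 𝓕 _ n x hF hhom hx =>
      GradedCoherence.effectivelyCoherent_of_lift_bijective hF hhom hx⟩
  · exact Fin.forall_fin_two.2
      ⟨(le_max_left _ _).trans (le_max_left _ _), (le_max_right _ _).trans (le_max_left _ _)⟩
  · exact Fin.forall_fin_two.2
      ⟨(le_max_left _ _).trans (le_max_right _ _), (le_max_right _ _).trans (le_max_right _ _)⟩
  · exact Fin.forall_fin_two.2 ⟨le_max_left _ _, le_max_right _ _⟩
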